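/- Let $n\ge 3$ be an integer and $k>0$ a real number. Identify $\mathbb R^2$ with $\mathbb C$, with inner product $\langle a,b\rangle=\mathrm{Re}(\bar a b)$. Let $\mathcal D_2(n)$ be the dihedral group of order $2n$, consisting of the maps $x\mapsto e^{2\pi i l/n}x$ and $x\mapsto e^{2\pi i l/n}\bar x$ ($0\le l<n$), with positive roots $\alpha_l=-i e^{i\pi l/n}$, $1\le l\le n$, associated reflections $\sigma_{\alpha}(x)=x-2\langle \alpha,x\rangle\alpha$, and constant multiplicity $k$. For $\xi\in\mathbb R^2$ let $$T_\xi f(x)=\partial_\xi f(x)+k\sum_{l=1}^n\langle\alpha_l,\xi\rangle\,\frac{f(x)-f(\sigma_{\alpha_l}x)}{\langle\alpha_l,x\rangle}$$ be the Dunkl operators (the quotient being extended by continuity to $\langle\alpha_l,x\rangle=0$), let $E_k(\cdot,y)$ be the Dunkl kernel, i.e. the real-analytic solution on $\mathbb R^2$ of $T_\xi f=\langle\xi,y\rangle f$ for all $\xi$, with $f(0)=1$, and let $$D_k(x,y)=\frac1{2n}\sum_{g\in\mathcal D_2(n)}E_k(gx,y)$$ be the generalized Bessel function. Write $(a)_j=a(a+1)\cdots(a+j-1)$,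 $B(u,v)=\Gamma(u)\Gamma(v)/\Gamma(u+v)$, $b_s^{\theta,n}=\cos(\theta+2\pi s/n)$ for $1\le s\le n$, and let $$\Phi_2^{(n)}(\beta_1,\dots,\beta_n;\gamma;z_1,\dots,z_n)=\sum_{m_1,\dots,m_n\ge0}\frac{(\beta_1)_{m_1}\cdots(\beta_n)_{m_n}}{(\gamma)_{m_1+\cdots+m_n}}\frac{z_1^{m_1}}{m_1!}\cdots\frac{z_n^{m_n}}{m_n!}$$ be the confluent Horn function. Put $c_{n,k}=n\,B(k+\tfrac12,\tfrac12)\,\Gamma(nk)$. Then $D_k(0,y)=1$ for all $y\in\mathbb R^2$, and for all $x=\rho e^{i\phi}$, $y=re^{i\theta}$ with $\rho,r\ge0$ and $\phi,\theta\in[0,\pi/n]$, $$D_k(x,y)=\frac{c_{n,k}}{n\,B(k+\frac12,\frac12)\,\Gamma(nk)}\sum_{j\ge0}\frac{(k)_j(k)_j}{(2k)_j\,(nk)_{nj}\,j!}\Bigl(-4\bigl(\tfrac{\rho r}{2}\bigr)^n\sin(n\theta)\sin(n\phi)\Bigr)^j\,\Phi_2^{(n)}\bigl(k+j,\dots,k+j;\,nk+nj;\,\rho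 r\,b_1^{\theta-\phi,n},\dots,\rho r\,b_n^{\theta-\phi,n}\bigr),$$ where the series over $j$ and the multiple series defining each $\Phi_2^{(n)}$ converge absolutely. (Thus the factor in front of the sum, which is fixed by the normalization $D_k(0,y)=1$, equals $1$.) -/

import Mathlib

noncomputable section

namespace DihedralBessel

/-- The positive roots `-i e^{iπl/n}`, `1 ≤ l ≤ n`, of the dihedral root system `I₂(n)` in `ℂ = ℝ²`.
They are unit vectors; here `l = s + 1`. -/
def posRoot (n : ℕ) (s : Fin n) : ℂ :=
  -Complex.I * Complex.exp (Complex.I * ((Real.pi * ((s : ℕ) + 1) / n : ℝ) : ℂ))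

/-- The orthogonal reflection in the line orthogonal to the unit vector `a`. -/
def reflect (a x : ℂ) : ℂ := x - (2 * inner ℝ a x : ℝ) • a

/-- The difference quotient `(f x - f (σ_a x)) / ⟨a, x⟩` for a unit vector `a`. On the mirror
`⟨a, x⟩ = 0` it takes its limit value `2 ∂_a f (x)` (for `f` of class `C¹`). -/
def diffQuot (a : ℂ) (f : ℂ → ℝ) (x : ℂ) : ℝ :=
  if inner ℝ a x = (0 : ℝ) then 2 * fderiv ℝ f x a
  else (f x - f (reflect a x)) / inner ℝ a x

/-- The Dunkl operator `T_ξ` of the dihedral root system `I₂(n)` with constant multiplicity `k`. -/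
def dunklOp (n : ℕ) (k : ℝ) (ξ : ℂ) (f : ℂ → ℝ) (x : ℂ) : ℝ :=
  fderiv ℝ f x ξ + k * ∑ s : Fin n, inner ℝ (posRoot n s) ξ * diffQuot (posRoot n s) f x

/-- `f` is a real-analytic solution on `ℝ²` of the joint eigenvalue problem
`T_ξ f = ⟨ξ, y⟩ f` for all `ξ`, normalized by `f 0 = 1`. -/
structure IsDunklEigenfunction (n : ℕ) (k : ℝ) (y : ℂ) (f : ℂ → ℝ) : Prop where
  analytic : AnalyticOnNhd ℝ f Set.univ
  eigen : ∀ ξ x : ℂ, dunklOp n k ξ f x = inner ℝ ξ y * f x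
  normalized : f 0 = 1

/-- The Dunkl kernel `E_k(x, y)`: for each `y`, the (unique, if `k ≥ 0`) normalized analytic joint
eigenfunction of the Dunkl operators. -/
def dunklKernel (n : ℕ) (k : ℝ) (x y : ℂ) : ℝ :=
  Classical.epsilon (IsDunklEigenfunction n k y) x

/-- The generalized Bessel function `D_k(x, y)`: the mean of `E_k(g x, y)` over the `2n` elements
`g` of the dihedral group, which are the rotations `x ↦ e^{2πil/n} x` and the reflections
`x ↦ e^{2πil/n} x̄`, `0 ≤ l < n`. -/
def genBessel (n : ℕ) (k : ℝ) (x y : ℂ) : ℝ :=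
  (1 / (2 * n : ℝ)) * ∑ l ∈ Finset.range n,
    (dunklKernel n k (Complex.exp (Complex.I * ((2 * Real.pi * l / n : ℝ) : ℂ)) * x) y +
      dunklKernel n k
        (Complex.exp (Complex.I * ((2 * Real.pi * l / n : ℝ) : ℂ)) * (starRingEnd ℂ) x) y)

/-- The Pochhammer symbol `(a)_j = a (a + 1) ⋯ (a + j - 1)`. -/
def poch (a : ℝ) (j : ℕ) : ℝ := (ascPochhammer ℝ j).eval a

/-- The term of index `m = (m_1, …, m_n)` of the confluent Horn series `Φ₂^{(n)}(β; γ; z)`. -/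
def hornTerm {n : ℕ} (β : Fin n → ℝ) (γ : ℝ) (z : Fin n → ℝ) (m : Fin n → ℕ) : ℝ :=
  (∏ s, poch (β s) (m s)) / poch γ (∑ s, m s) * ∏ s, z s ^ m s / ((m s).factorial : ℝ)

/-- The confluent Horn function `Φ₂^{(n)}(β_1, …, β_n; γ; z_1, …, z_n)`. -/
def hornPhi {n : ℕ} (β : Fin n → ℝ) (γ : ℝ) (z : Fin n → ℝ) : ℝ :=
  ∑' m : Fin n → ℕ, hornTerm β γ z m

/-- `b_s^{θ,n} = cos (θ + 2πs/n)` for `s = 1, …, n`; the index `s : Fin n` stands for `s + 1`. -/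
def bcos (n : ℕ) (θ : ℝ) (s : Fin n) : ℝ :=
  Real.cos (θ + 2 * Real.pi * ((s : ℕ) + 1) / n)

/-- The normalizing constant `c_{n,k}`: the value forced by `D_k(0, y) = 1` in the expansions of
`D_k` that carry the factor `c_{n,k} / (n B(k + 1/2, 1/2) Γ(nk))`. -/
def normConst (n : ℕ) (k : ℝ) : ℝ :=
  n * ProbabilityTheory.beta (k + 1 / 2) (1 / 2) * Real.Gamma (n * k)

end DihedralBessel

end

noncomputable section
namespace DihedralBessel
open PowerSeries Finset

section Formal

variable {K : Type*} [Field K]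

/-- The Pochhammer symbol over an arbitrary field. -/
def pch (a : K) (j : ℕ) : K := (ascPochhammer K j).eval a

@[simp] lemma pch_zero (a : K) : pch a 0 = 1 := by simp [pch]

lemma pch_succ (a : K) (j : ℕ) : pch a (j + 1) = pch a j * (a + j) := by
  simp [pch, ascPochhammer_succ_eval]

lemma pch_add (a : K) (i j : ℕ) : pch a (i + j) = pch a i * pch (a + i) j := by
  induction j with
  | zero => simp
  | succ j ih => rw [← add_assoc, pch_succ, ih, pch_succ]; push_cast; ring

lemma pch_succ_left (a : K) (j : ℕ) : pch a (j + 1) = a * pch (a + 1) j := by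
  rw [add_comm, pch_add, pch_succ]; simp

/-- The binomial series `(1 - X)^(-a)`. -/
def bser (a : K) : K⟦X⟧ := PowerSeries.mk fun m => pch a m / m.factorial

@[simp] lemma coeff_bser (a : K) (m : ℕ) : coeff m (bser a) = pch a m / m.factorial := by
  simp [bser]

/-- The formal sum `∑ i, X ^ i * g i`. -/
def xsum (g : ℕ → K⟦X⟧) : K⟦X⟧ :=
  PowerSeries.mk fun N => ∑ i ∈ range (N + 1), coeff (N - i) (g i)

lemma coeff_xsum (g : ℕ → K⟦X⟧) (N : ℕ) :
    coeff N (xsum g) = ∑ i ∈ range (N + 1), coeff (N - i) (g i) := by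
  simp [xsum]

lemma X_pow_dvd_xsum_sub (g : ℕ → K⟦X⟧) (M : ℕ) :
    (X : K⟦X⟧) ^ M ∣ xsum g - ∑ i ∈ range M, X ^ i * g i := by
  rw [X_pow_dvd_iff]
  intro N hN
  rw [map_sub, coeff_xsum, map_sum, sub_eq_zero]
  rw [← sum_subset (range_subset_range.2 hN : range (N + 1) ⊆ range M)]
  · refine sum_congr rfl fun i hi => ?_
    rw [coeff_X_pow_mul', if_pos (by simp at hi; omega)]
  · intro i _ hi
    rw [coeff_X_pow_mul', if_neg (by simp at hi; omega)]

lemma eq_of_forall_X_pow_dvd {f g : K⟦X⟧} (h : ∀ M, (X : K⟦X⟧) ^ M ∣ f - g) : f = g := by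
  ext N
  have := X_pow_dvd_iff.1 (h (N + 1)) N (by omega)
  rwa [map_sub, sub_eq_zero] at this

lemma mul_xsum (h : K⟦X⟧) (g : ℕ → K⟦X⟧) : h * xsum g = xsum fun i => h * g i := by
  refine eq_of_forall_X_pow_dvd fun M => ?_
  have h1 := X_pow_dvd_xsum_sub g M
  have h2 := X_pow_dvd_xsum_sub (fun i => h * g i) M
  convert dvd_sub (Dvd.dvd.mul_left h1 h) h2 using 1
  rw [mul_sub, mul_sum, sum_congr rfl fun i _ => mul_left_comm h (X ^ i) (g i)]
  ring

lemma subst_xsum {v : K⟦X⟧} (g : ℕ → K⟦X⟧) :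
    (xsum g).subst (X * v) = xsum fun i => v ^ i * (g i).subst (X * v) := by
  have hs : HasSubst (X * v : K⟦X⟧) := HasSubst.of_constantCoeff_zero' (by simp)
  refine eq_of_forall_X_pow_dvd fun M => ?_
  have h1 := map_dvd (substAlgHom (R := K) hs) (X_pow_dvd_xsum_sub g M)
  have h2 := X_pow_dvd_xsum_sub (fun i => v ^ i * (g i).subst (X * v)) M
  simp only [map_sub, map_sum, map_mul, map_pow, substAlgHom_X, coe_substAlgHom hs] at h1
  rw [mul_pow] at h1
  convert dvd_sub (dvd_of_mul_right_dvd h1) h2 using 1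
  have : ∀ i, (X * v) ^ i * (g i).subst (X * v) = X ^ i * (v ^ i * (g i).subst (X * v)) := by
    intro i; ring
  rw [sum_congr rfl fun i _ => this i]
  ring

lemma xsum_xsum (h : ℕ → ℕ → K⟦X⟧) :
    xsum (fun i => xsum (h i)) = xsum fun m => ∑ p ∈ antidiagonal m, h p.1 p.2 := by
  ext N
  simp only [coeff_xsum, map_sum]
  rw [sum_sigma', sum_sigma']
  refine sum_bij' (fun p _ => ⟨p.1 + p.2, (p.1, p.2)⟩) (fun p _ => ⟨p.2.1, p.2.2⟩) ?_ ?_ ?_ ?_ ?_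
  · rintro ⟨i, j⟩ hp; simp at hp ⊢; omega
  · rintro ⟨m, ⟨i, j⟩⟩ hp; simp at hp ⊢; omega
  · rintro ⟨i, j⟩ hp; rfl
  · rintro ⟨m, ⟨i, j⟩⟩ hp; simp at hp; obtain ⟨_, rfl⟩ := hp; rfl
  · rintro ⟨i, j⟩ hp; simp [Nat.sub_sub]

lemma xsum_C (c : ℕ → K) : (xsum fun i => C (c i)) = PowerSeries.mk c := by
  ext N
  rw [coeff_xsum, coeff_mk, sum_range_succ, sum_eq_zero]
  · simp
  · intro i hi
    rw [coeff_C, if_neg (by simp at hi; omega)]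

lemma subst_eq_xsum (f v : K⟦X⟧) :
    f.subst (X * v) = xsum fun i => C (coeff i f) * v ^ i := by
  conv_lhs => rw [show f = xsum fun i => C (coeff i f) by rw [xsum_C]; ext; simp]
  rw [subst_xsum]
  congr 1; ext1 i
  rw [mul_comm]
  congr 1
  exact subst_C _

/-- The power `(1 - f)^(-a)` of a power series `f` without constant term. -/
def opow (a : K) (f : K⟦X⟧) : K⟦X⟧ := (bser a).subst f

lemma opow_X_mul (a : K) (v : K⟦X⟧) :
    opow a (X * v) = xsum fun i => C (pch a i / i.factorial) * v ^ i := by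
  simp [opow, subst_eq_xsum]

lemma hasSubst_of {f : K⟦X⟧} (hf : constantCoeff f = 0) : HasSubst f :=
  HasSubst.of_constantCoeff_zero' hf

lemma exists_eq_X_mul {f : K⟦X⟧} (hf : constantCoeff f = 0) : ∃ v, f = X * v :=
  X_dvd_iff.2 hf

@[simp] lemma constantCoeff_opow (a : K) {f : K⟦X⟧} (hf : constantCoeff f = 0) :
    constantCoeff (opow a f) = 1 := by
  obtain ⟨v, rfl⟩ := exists_eq_X_mul hf
  rw [opow_X_mul, ← coeff_zero_eq_constantCoeff_apply, coeff_xsum]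
  simp

lemma subst_opow (a : K) {f g : K⟦X⟧} (hf : constantCoeff f = 0) (hg : constantCoeff g = 0) :
    (opow a f).subst g = opow a (f.subst g) :=
  subst_comp_subst_apply (hasSubst_of hf) (hasSubst_of hg) _

lemma opow_C_mul_X (a c : K) :
    opow a (C c * X) = PowerSeries.mk fun m => pch a m / m.factorial * c ^ m := by
  rw [mul_comm, opow_X_mul]
  simp_rw [← map_pow, ← map_mul]
  rw [xsum_C]

variable [CharZero K]

lemma bser_ode (a : K) : (1 - X) * d⁄dX K (bser a) = C a * bser a := by
  have hc : ∀ m : ℕ, coeff m (d⁄dX K (bser a)) = pch a m * (a + m) / m.factorial := by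
    intro m
    rw [coeff_derivative, coeff_bser, pch_succ, Nat.factorial_succ]
    have := Nat.cast_add_one_ne_zero (R := K) m
    have := Nat.cast_ne_zero (R := K).2 m.factorial_ne_zero
    push_cast; field_simp
  ext m
  rw [sub_mul, one_mul, map_sub, hc, coeff_C_mul, coeff_bser]
  cases m with
  | zero => simp
  | succ m =>
    rw [coeff_succ_X_mul, hc, pch_succ, Nat.factorial_succ]
    have := Nat.cast_add_one_ne_zero (R := K) m
    have := Nat.cast_ne_zero (R := K).2 m.factorial_ne_zero
    push_cast; field_simp; ring

lemma opow_ode (a : K) {f : K⟦X⟧} (hf : constantCoeff f = 0) :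
    (1 - f) * d⁄dX K (opow a f) = C a * d⁄dX K f * opow a f := by
  have hs := hasSubst_of hf
  have h := congrArg (substAlgHom (R := K) hs) (bser_ode a)
  simp only [map_mul, map_sub, map_one, substAlgHom_X, coe_substAlgHom hs] at h
  rw [opow, derivative_subst hs, ← mul_assoc, h, show subst f (C a : K⟦X⟧) = C a from subst_C _]
  ring

lemma eq_zero_of_ode {a : K} {f y : K⟦X⟧} (hf : constantCoeff f = 0) (hy : constantCoeff y = 0)
    (h : (1 - f) * d⁄dX K y = C a * d⁄dX K f * y) : y = 0 := by
  have hu : (1 - f)⁻¹ * (1 - f) = 1 := PowerSeries.inv_mul_cancel _ (by simp [hf])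
  have h' : d⁄dX K y = ((1 - f)⁻¹ * (C a * d⁄dX K f)) * y := by
    rw [mul_assoc, ← h, ← mul_assoc, hu, one_mul]
  generalize (1 - f)⁻¹ * (C a * d⁄dX K f) = g at h'
  ext N
  induction N using Nat.strong_induction_on with
  | _ N ih =>
    cases N with
    | zero => simpa using hy
    | succ N =>
      have := congrArg (coeff N) h'
      rw [coeff_derivative, coeff_mul, sum_eq_zero] at this
      · have h2 := Nat.cast_add_one_ne_zero (R := K) N
        simpa [h2] using this
      · rintro ⟨i, j⟩ hij
        rw [HasAntidiagonal.mem_antidiagonal] at hij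
        simp only at hij ⊢
        rw [ih j (by omega)]; simp

lemma eq_opow_of_ode {a : K} {f y : K⟦X⟧} (hf : constantCoeff f = 0) (hy : constantCoeff y = 1)
    (h : (1 - f) * d⁄dX K y = C a * d⁄dX K f * y) : y = opow a f := by
  rw [← sub_eq_zero]
  refine eq_zero_of_ode (a := a) hf (by simp [hy, hf]) ?_
  rw [map_sub, mul_sub, h, opow_ode a hf]; ring

lemma opow_mul_opow_arg (a : K) {f g h : K⟦X⟧} (hf : constantCoeff f = 0)
    (hg : constantCoeff g = 0) (hh : (1 - f) * (1 - g) = 1 - h) :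
    opow a f * opow a g = opow a h := by
  have hh' : h = 1 - (1 - f) * (1 - g) := by rw [hh]; ring
  have h0 : constantCoeff h = 0 := by rw [hh']; simp [hf, hg]
  refine eq_opow_of_ode h0 (by simp [hf, hg]) ?_
  have h1 := opow_ode a hf
  have h2 := opow_ode a hg
  rw [hh']
  simp only [Derivation.leibniz, map_sub, derivative_one, smul_eq_mul]
  linear_combination (1 - g) * opow a g * h1 + (1 - f) * opow a f * h2

lemma opow_mul_opow (a b : K) {f : K⟦X⟧} (hf : constantCoeff f = 0) :
    opow a f * opow b f = opow (a + b) f := by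
  refine eq_opow_of_ode hf (by simp [hf]) ?_
  have h1 := opow_ode a hf
  have h2 := opow_ode b hf
  simp only [Derivation.leibniz, smul_eq_mul, map_add]
  linear_combination opow b f * h1 + opow a f * h2

lemma opow_zero {f : K⟦X⟧} (hf : constantCoeff f = 0) : opow 0 f = 1 :=
  (eq_opow_of_ode hf (by simp) (by simp)).symm

lemma opow_neg_one {f : K⟦X⟧} (hf : constantCoeff f = 0) : opow (-1) f = 1 - f :=
  (eq_opow_of_ode hf (by simp [hf]) (by simp; ring)).symm

lemma opow_one_mul {f : K⟦X⟧} (hf : constantCoeff f = 0) : opow 1 f * (1 - f) = 1 := by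
  rw [← opow_neg_one hf, opow_mul_opow _ _ hf]
  simp [opow_zero hf]

lemma opow_add_one_mul (a : K) {f : K⟦X⟧} (hf : constantCoeff f = 0) :
    opow (a + 1) f * (1 - f) = opow a f := by
  rw [← opow_mul_opow _ _ hf, mul_assoc, opow_one_mul hf, mul_one]

lemma opow_pow (a : K) {f : K⟦X⟧} (hf : constantCoeff f = 0) (m : ℕ) :
    opow a f ^ m = opow (m * a) f := by
  induction m with
  | zero => simp [opow_zero hf]
  | succ m ih => rw [pow_succ, ih, opow_mul_opow _ _ hf]; push_cast; ring_nf

lemma opow_prod {ι : Type*} (s : Finset ι) (a : K) (f : ι → K⟦X⟧)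
    (hf : ∀ i ∈ s, constantCoeff (f i) = 0) {h : K⟦X⟧} (hh : ∏ i ∈ s, (1 - f i) = 1 - h) :
    ∏ i ∈ s, opow a (f i) = opow a h := by
  classical
  induction s using Finset.induction_on generalizing h with
  | empty =>
    have : h = 0 := by rw [prod_empty] at hh; linear_combination hh
    rw [this, prod_empty, eq_comm]
    have h0 : constantCoeff (0 : K⟦X⟧) = 0 := by simp
    exact (eq_opow_of_ode h0 (by simp) (by simp)).symm
  | insert i s hi ih =>
    have h0 : constantCoeff (1 - ∏ i ∈ s, (1 - f i)) = 0 := by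
      rw [map_sub, map_prod, prod_eq_one]
      · simp
      · intro j hj; simp [hf j (mem_insert_of_mem hj)]
    rw [prod_insert hi, ih (fun j hj => hf j (mem_insert_of_mem hj))
      (h := 1 - ∏ i ∈ s, (1 - f i)) (by ring)]
    refine opow_mul_opow_arg a (hf i (mem_insert_self _ _)) h0 ?_
    rw [← hh, prod_insert hi]; ring

end Formal
end DihedralBessel
end

noncomputable section
namespace DihedralBessel
open PowerSeries Finset

section Formal

variable {K : Type*} [Field K]

lemma cast_choose_factorial (i m : ℕ) :
    (i + m).choose i * i.factorial * m.factorial = (i + m).factorial := by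
  rw [Nat.choose_symm_add, Nat.add_choose_mul_factorial_mul_factorial]

lemma constantCoeff_C_mul_X (c : K) : constantCoeff (C c * X : K⟦X⟧) = 0 := by simp

/-- Termwise multiplication of the coefficients by binomial coefficients, i.e. `X ^ l` times the
`l`-th Hasse derivative. -/
def hasseX (l : ℕ) (g : K⟦X⟧) : K⟦X⟧ := PowerSeries.mk fun m => m.choose l * coeff m g

lemma hasseX_mul (i : ℕ) (g h : K⟦X⟧) :
    hasseX i (g * h) = ∑ p ∈ antidiagonal i, hasseX p.1 g * hasseX p.2 h := by
  ext J
  simp only [hasseX, coeff_mk, map_sum, coeff_mul]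
  rw [sum_comm, mul_sum]
  refine sum_congr rfl ?_
  rintro ⟨a, b⟩ hab
  have : a + b = J := by simpa using hab
  subst this
  rw [Nat.add_choose_eq]
  push_cast
  rw [sum_mul]
  refine sum_congr rfl fun p _ => ?_
  ring

variable [CharZero K]

lemma choose_mul_pch (k : K) (l m : ℕ) :
    ((l + m).choose l : K) * (pch k (l + m) / (l + m).factorial) =
      pch k l / l.factorial * (pch (k + l) m / m.factorial) := by
  have h1 := Nat.cast_ne_zero (R := K).2 l.factorial_ne_zero
  have h2 := Nat.cast_ne_zero (R := K).2 m.factorial_ne_zero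
  have h3 := Nat.cast_ne_zero (R := K).2 (l + m).factorial_ne_zero
  have h4 : ((l + m).choose l : K) * l.factorial * m.factorial = (l + m).factorial := by
    exact_mod_cast cast_choose_factorial l m
  rw [pch_add]
  field_simp
  linear_combination pch k l * pch (k + l) m * h4

lemma hasseX_opow (k c : K) (l : ℕ) :
    hasseX l (opow k (C c * X)) =
      X ^ l * (C (pch k l / l.factorial * c ^ l) * opow (k + l) (C c * X)) := by
  ext J
  rw [hasseX, coeff_mk, coeff_X_pow_mul', opow_C_mul_X, coeff_mk]
  split_ifs with h
  · obtain ⟨m, rfl⟩ := Nat.exists_eq_add_of_le h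
    rw [coeff_C_mul, opow_C_mul_X, coeff_mk, ← mul_assoc, choose_mul_pch, pow_add,
      Nat.add_sub_cancel_left]
    ring
  · rw [Nat.choose_eq_zero_of_lt (by omega)]; simp

/-- The Vandermonde identity. -/
lemma pch_vandermonde (a b : K) (m : ℕ) :
    ∑ p ∈ antidiagonal m, pch a p.1 / p.1.factorial * (pch b p.2 / p.2.factorial) =
      pch (a + b) m / m.factorial := by
  have h := congrArg (coeff m) (opow_mul_opow a b (f := (X : K⟦X⟧)) (by simp))
  simpa [opow, X_subst, coeff_mul] using h

/-- The coefficients of `(1 - X)^(-k) (1 - c X)^(-k)`. -/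
def hpoly (k c : K) (J : ℕ) : K := coeff J (opow k X * opow k (C c * X))

lemma opow_eq_xsum_one_sub (b d : K) :
    opow b (C d * X) = xsum fun i => C (pch b i / i.factorial * (-(1 - d)) ^ i) * opow (b + i) X := by
  have hX : constantCoeff (X : K⟦X⟧) = 0 := by simp
  have h1 : opow b X * opow b (X * (C (-(1 - d)) * opow 1 X)) = opow b (C d * X) := by
    refine opow_mul_opow_arg b hX (by simp) ?_
    have := opow_one_mul hX
    simp only [map_neg, map_sub, map_one]
    linear_combination X * (1 - C d) * this
  rw [← h1, opow_X_mul, mul_xsum]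
  congr 1; ext1 i
  rw [mul_pow, opow_pow _ hX, ← opow_mul_opow b i hX, mul_one, ← map_pow, map_mul]
  ring

lemma hpoly_eq (k d : K) (hk : ∀ j, pch (2 * k) j ≠ 0) (J : ℕ) :
    J.factorial / pch (2 * k) J * hpoly k d J =
      ∑ i ∈ range (J + 1), J.choose i * (pch k i / pch (2 * k) i * (-(1 - d)) ^ i) := by
  have hX : constantCoeff (X : K⟦X⟧) = 0 := by simp
  rw [hpoly, opow_eq_xsum_one_sub, mul_xsum, coeff_xsum, mul_sum]
  refine sum_congr rfl fun i hi => ?_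
  obtain ⟨m, rfl⟩ := Nat.exists_eq_add_of_le (Nat.lt_succ_iff.1 (mem_range.1 hi))
  rw [mul_left_comm, opow_mul_opow _ _ hX, coeff_C_mul, Nat.add_sub_cancel_left, opow, X_subst,
    coeff_bser]
  have h1 := Nat.cast_ne_zero (R := K).2 i.factorial_ne_zero
  have h2 := Nat.cast_ne_zero (R := K).2 m.factorial_ne_zero
  have h4 : ((i + m).choose i : K) * i.factorial * m.factorial = (i + m).factorial := by
    exact_mod_cast cast_choose_factorial i m
  have h5 := hk (i + m)
  have h6 := hk i
  rw [← h4, show k + (k + (i : K)) = 2 * k + i by ring]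
  rw [pch_add] at h5 ⊢
  have h7 := right_ne_zero_of_mul h5
  field_simp

/-- The moments of `(1 - τ) ^ i * τ ^ l` for the beta distribution, in weighted form. -/
lemma beta_expansion (k : K) (hk : ∀ j, pch (2 * k) j ≠ 0) {A : Type*} [CommRing A] [Algebra K A]
    (Y : A) (m : ℕ) :
    ∑ p ∈ antidiagonal m, algebraMap K A ((-1) ^ p.1 * (pch k p.1 / pch (2 * k) p.1 /
        (p.1.factorial * p.2.factorial))) * Y ^ p.1 =
      ∑ p ∈ antidiagonal m, algebraMap K A (pch k p.1 / p.1.factorial *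
        (pch k p.2 / p.2.factorial) / pch (2 * k) m) * (1 - Y) ^ p.1 := by
  let P : Polynomial K := ∑ p ∈ antidiagonal m, Polynomial.C ((-1) ^ p.1 * (pch k p.1 /
    pch (2 * k) p.1 / (p.1.factorial * p.2.factorial))) * Polynomial.X ^ p.1
  let Q : Polynomial K := ∑ p ∈ antidiagonal m, Polynomial.C (pch k p.1 / p.1.factorial *
    (pch k p.2 / p.2.factorial) / pch (2 * k) m) * (1 - Polynomial.X) ^ p.1
  have hPQ : P = Q := by
    refine Polynomial.funext fun t => ?_
    have h := hpoly_eq k (1 - t) hk m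
    have hm := Nat.cast_ne_zero (R := K).2 m.factorial_ne_zero
    have hs : hpoly k (1 - t) m = ∑ p ∈ antidiagonal m, (pch k p.1 / p.1.factorial) *
        (pch k p.2 / p.2.factorial) * (1 - t) ^ p.1 := by
      rw [hpoly, mul_comm, coeff_mul, opow_C_mul_X, opow, X_subst]
      refine sum_congr rfl fun p _ => ?_
      rw [coeff_mk, coeff_bser]; ring
    rw [hs, ← Nat.sum_antidiagonal_eq_sum_range_succ_mk
      (f := fun p => ((m.choose p.1 : K) * (pch k p.1 / pch (2 * k) p.1 * (-(1 - (1 - t))) ^ p.1)))] at h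
    have h2 : Polynomial.eval t P = (1 / m.factorial) * ∑ p ∈ antidiagonal m,
        ((m.choose p.1 : K) * (pch k p.1 / pch (2 * k) p.1 * (-(1 - (1 - t))) ^ p.1)) := by
      simp only [P, Polynomial.eval_finsetSum, mul_sum]
      refine sum_congr rfl fun p hp => ?_
      have hp' : p.1 + p.2 = m := by simpa using hp
      have h1 := Nat.cast_ne_zero (R := K).2 p.1.factorial_ne_zero
      have h3 := Nat.cast_ne_zero (R := K).2 p.2.factorial_ne_zero
      have h4 : (m.choose p.1 : K) * p.1.factorial * p.2.factorial = m.factorial := by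
        rw [← hp']; exact_mod_cast cast_choose_factorial p.1 p.2
      have h5 : (m.choose p.1 : K) ≠ 0 := by
        intro h0; rw [h0] at h4; simp at h4; exact hm h4.symm
      have h6 := hk p.1
      rw [← h4, show -(1 - (1 - t)) = (-1) * t by ring, mul_pow]
      simp
      field_simp
    rw [h2, ← h]
    simp only [Q, Polynomial.eval_finsetSum, mul_sum]
    refine sum_congr rfl fun p hp => ?_
    simp
    field_simp
  simpa [P, Q] using congrArg (Polynomial.aeval Y) hPQ


/-- The product formula for Gegenbauer polynomials, in generating function form. -/
theorem gegenbauer_product (k c d : K) (hk : ∀ j, pch (2 * k) j ≠ 0) :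
    (xsum fun j => C (pch k j * pch k j / (pch (2 * k) j * j.factorial) *
        ((1 - c) * (1 - d)) ^ j) * (opow (k + j) (C c * X) * opow (k + j) (C d * X))) =
      PowerSeries.mk fun J => J.factorial / pch (2 * k) J * (hpoly k c J * hpoly k d J) := by
  have hX : constantCoeff (X : K⟦X⟧) = 0 := by simp
  have hc := constantCoeff_C_mul_X c
  have hu := opow_one_mul hc
  -- the right-hand side
  have hr : (PowerSeries.mk fun J => J.factorial / pch (2 * k) J * (hpoly k c J * hpoly k d J)) =
      xsum fun m => ∑ p ∈ antidiagonal m, C (pch k m / pch (2 * k) m * (-(1 - d)) ^ m *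
        (pch k p.1 / p.1.factorial * (pch k p.2 / p.2.factorial))) *
          (C (c ^ p.1) * (opow (k + p.1) (C c * X) * opow (k + p.2) X)) := by
    ext J
    rw [coeff_mk, mul_left_comm, hpoly_eq k d hk, coeff_xsum, mul_sum]
    refine sum_congr rfl fun i hi => ?_
    have h := congrArg (coeff J) (hasseX_mul i (opow k (C c * X)) (opow k (C 1 * X)))
    rw [hasseX, coeff_mk] at h
    rw [hpoly, mul_comm (opow k X)]
    simp only [map_one, one_mul] at h
    calc _ = pch k i / pch (2 * k) i * (-(1 - d)) ^ i *
        ((J.choose i : K) * coeff J (opow k (C c * X) * opow k X)) := by ring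
      _ = _ := by
        rw [h, ← coeff_C_mul, mul_sum, map_sum, map_sum]
        refine sum_congr rfl fun p hp => ?_
        have hp' : p.1 + p.2 = i := by simpa using hp
        have h1 := hasseX_opow k c p.1
        have h2 := hasseX_opow k 1 p.2
        rw [map_one, one_mul, one_pow, mul_one] at h2
        rw [h1, h2]
        have hi' : i ≤ J := by simpa [Nat.lt_succ_iff] using hi
        have : ∀ g : K⟦X⟧, coeff (J - i) g = coeff J (X ^ i * g) := by
          intro g; rw [coeff_X_pow_mul', if_pos hi']
        rw [this, ← hp']
        congr 1
        simp only [map_mul, pow_add]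
        ring
  rw [hr]
  -- the left-hand side
  have hl : ∀ j : ℕ, C (pch k j * pch k j / (pch (2 * k) j * j.factorial) *
        ((1 - c) * (1 - d)) ^ j) * (opow (k + j) (C c * X) * opow (k + j) (C d * X)) =
      xsum fun i => C (pch k j * pch k j / (pch (2 * k) j * j.factorial) *
        ((1 - c) * (1 - d)) ^ j * (pch (k + j) i / i.factorial * (-(1 - d)) ^ i)) *
          (opow (k + j) (C c * X) * opow (k + j + i) X) := by
    intro j
    rw [opow_eq_xsum_one_sub (k + j) d, mul_xsum, mul_xsum]
    congr 1; ext1 i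
    rw [map_mul _ _ (pch (k + j) i / _ * _)]
    ring
  simp_rw [hl]
  rw [xsum_xsum]
  congr 1; ext1 m
  have hb := beta_expansion k hk (C (1 - c) * opow 1 (C c * X)) m
  have hY : 1 - C (1 - c) * opow 1 (C c * X) = C c * (opow 1 (C c * X) * (1 - X)) := by
    simp only [map_sub, map_one]
    linear_combination -hu
  rw [hY] at hb
  have := congrArg (fun t => C (pch k m * (-(1 - d)) ^ m) * (opow k (C c * X) * opow (k + m) X) * t) hb
  simp only [mul_sum] at this
  refine Eq.trans ?_ (this.trans ?_)
  · refine sum_congr rfl fun p hp => ?_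
    have hp' : p.1 + p.2 = m := by simpa using hp
    subst hp'
    rw [mul_pow (C (1 - c)), opow_pow 1 hc, mul_one, ← opow_mul_opow k p.1 hc, pch_add,
      show k + ((p.1 + p.2 : ℕ) : K) = k + p.1 + p.2 by push_cast; ring, ← map_pow]
    have e : ∀ t : K, algebraMap K K⟦X⟧ t = C t := fun _ => rfl
    have : pch k p.1 * pch k p.1 / (pch (2 * k) p.1 * p.1.factorial) *
        ((1 - c) * (1 - d)) ^ p.1 * (pch (k + p.1) p.2 / p.2.factorial * (-(1 - d)) ^ p.2) =
        pch k p.1 * pch (k + p.1) p.2 * (-(1 - d)) ^ (p.1 + p.2) * ((-1) ^ p.1 * (pch k p.1 / pch (2 * k) p.1 /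
        (p.1.factorial * p.2.factorial))) * (1 - c) ^ p.1 := by
      have e1 : (-(1 - d)) ^ (p.1 + p.2) = (-1) ^ p.1 * (1 - d) ^ p.1 * (-(1 - d)) ^ p.2 := by
        rw [pow_add, ← mul_pow]; ring
      have e2 : ((-1 : K) ^ p.1) * (-1) ^ p.1 = 1 := by rw [← mul_pow]; simp
      rw [e1, mul_pow]
      linear_combination (-(pch k p.1 ^ 2 * pch (k + p.1) p.2 * (1 - c) ^ p.1 * (1 - d) ^ p.1 *
        (-(1 - d)) ^ p.2 / (pch (2 * k) p.1 * p.1.factorial * p.2.factorial))) * e2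
    rw [this, e]
    simp only [map_mul]
    ring
  · refine sum_congr rfl fun p hp => ?_
    have hp' : p.1 + p.2 = m := by simpa using hp
    subst hp'
    have e : ∀ t : K, algebraMap K K⟦X⟧ t = C t := fun _ => rfl
    have h1 : (1 - X) ^ p.1 * opow (k + p.2 + p.1) X = opow (k + p.2) (X : K⟦X⟧) := by
      rw [← opow_mul_opow _ (p.1 : K) hX, mul_comm, mul_assoc, ← mul_one (p.1 : K), ← opow_pow 1 hX,
        ← mul_pow, opow_one_mul hX, one_pow, mul_one]
    rw [mul_pow, mul_pow, opow_pow 1 hc, mul_one, ← opow_mul_opow k p.1 hc, ← h1,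
      show k + ((p.1 + p.2 : ℕ) : K) = k + p.2 + p.1 by push_cast; ring, ← map_pow, e]
    have : pch k (p.1 + p.2) / pch (2 * k) (p.1 + p.2) * (-(1 - d)) ^ (p.1 + p.2) *
        (pch k p.1 / p.1.factorial * (pch k p.2 / p.2.factorial)) = pch k (p.1 + p.2) * (-(1 - d)) ^ (p.1 + p.2) *
        (pch k p.1 / p.1.factorial * (pch k p.2 / p.2.factorial) / pch (2 * k) (p.1 + p.2)) := by
      ring
    rw [this]
    simp only [map_mul]
    ring

end Formal
end DihedralBessel
end

noncomputable section
namespace DihedralBessel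
open PowerSeries Finset

section Formal

variable {K : Type*} [Field K]

lemma rescale_xsum (r : K) (g : ℕ → K⟦X⟧) :
    rescale r (xsum g) = xsum fun i => C (r ^ i) * rescale r (g i) := by
  ext N
  rw [coeff_rescale, coeff_xsum, coeff_xsum, mul_sum]
  refine sum_congr rfl fun i hi => ?_
  rw [coeff_C_mul, coeff_rescale, ← mul_assoc, ← pow_add,
    Nat.add_sub_cancel' (Nat.lt_succ_iff.1 (mem_range.1 hi))]

lemma rescale_opow (r a c : K) : rescale r (opow a (C c * X)) = opow a (C (r * c) * X) := by
  ext N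
  rw [coeff_rescale, opow_C_mul_X, opow_C_mul_X, coeff_mk, coeff_mk, mul_pow]
  ring

/-- The Gegenbauer polynomial of degree `j` with parameter `k` at `(A + A⁻¹) / 2`. -/
def geg (k A : K) (j : ℕ) : K := coeff j (opow k (C A * X) * opow k (C A⁻¹ * X))

lemma hpoly_sq (k : K) {A : K} (hA : A ≠ 0) (j : ℕ) : hpoly k (A ^ 2) j = A ^ j * geg k A j := by
  rw [hpoly, geg, ← coeff_rescale, map_mul (rescale A), rescale_opow, rescale_opow,
    mul_inv_cancel₀ hA, map_one, one_mul, mul_comm, sq]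

lemma subst_injective_of {u : K⟦X⟧} (hu : constantCoeff u = 0) (hu1 : coeff 1 u ≠ 0)
    {f g : K⟦X⟧} (h : f.subst u = g.subst u) : f = g := by
  have hU : IsUnit (coeff 1 u) := isUnit_iff_ne_zero.2 hu1
  have h1 := congrArg (PowerSeries.subst (substInvOfIsUnit u hU)) h
  rwa [subst_comp_subst_apply (hasSubst_of hu) (HasSubst.substInvOfIsUnit u hU),
    subst_comp_subst_apply (hasSubst_of hu) (HasSubst.substInvOfIsUnit u hU),
    subst_substInvOfIsUnit_right u hu hU, X_subst, X_subst] at h1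

variable [CharZero K]

theorem geg_product (k : K) {A B : K} (hA : A ≠ 0) (hB : B ≠ 0) (hk : ∀ j, pch (2 * k) j ≠ 0) :
    (xsum fun j => C (pch k j * pch k j / (pch (2 * k) j * j.factorial) *
        ((A - A⁻¹) * (B - B⁻¹)) ^ j) *
          (opow (k + j) (C (A / B) * X) * opow (k + j) (C (B / A) * X))) =
      PowerSeries.mk fun J => J.factorial / pch (2 * k) J * (geg k A J * geg k B J) := by
  have h := congrArg (rescale (A * B)⁻¹) (gegenbauer_product k (A ^ 2) (B ^ 2) hk)
  rw [rescale_xsum] at h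
  have e1 : (A * B)⁻¹ * A ^ 2 = A / B := by field_simp
  have e2 : (A * B)⁻¹ * B ^ 2 = B / A := by field_simp
  have e3 : (A - A⁻¹) * (B - B⁻¹) = (A * B)⁻¹ * ((1 - A ^ 2) * (1 - B ^ 2)) := by
    field_simp; ring
  have hC : ∀ r c : K, rescale r (C c) = C c := by
    intro r c; ext N; rw [coeff_rescale, coeff_C]; split_ifs with h0 <;> simp [h0]
  convert h using 1
  · congr 1; ext1 j
    rw [map_mul (rescale _), map_mul (rescale _), rescale_opow, rescale_opow, e1, e2, e3, hC, ← mul_assoc (C _) (C _),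
      ← map_mul, mul_pow]
    congr 2; ring
  · ext J
    rw [coeff_rescale, coeff_mk, coeff_mk, hpoly_sq k hA, hpoly_sq k hB, inv_pow, mul_pow]
    field_simp

lemma sum_choose_pch_eq_zero (N : K) (M : ℕ) :
    ∑ i ∈ range (M + 2), (-1) ^ (M + 1 - i) * ((M + 1).choose i : K) * pch (N + 1 + i) M = 0 := by
  have hP : ((ascPochhammer K M).comp (Polynomial.X + Polynomial.C (N + 1))).natDegree < M + 1 := by
    refine lt_of_le_of_lt Polynomial.natDegree_comp_le ?_
    rw [ascPochhammer_natDegree, Polynomial.natDegree_X_add_C]; omega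
  have h := congrFun (Polynomial.fwdDiff_iter_eq_zero_of_degree_lt hP) 0
  rw [fwdDiff_iter_eq_sum_shift] at h
  simp only [Pi.zero_apply] at h
  rw [← h]
  refine sum_congr rfl fun i _ => ?_
  simp [pch, zsmul_eq_mul, add_comm]

/-- The power `(1 + X)^N` as a series in `X / (1 + X)^2`. -/
lemma xsum_lagrange (N : K) (hN : ∀ j, pch N j ≠ 0) :
    (xsum fun i => C (N * pch N (2 * i) / (i.factorial * pch N (i + 1))) *
      opow (N + 2 * i) (C (-1) * X)) = 1 := by
  ext M
  rw [coeff_xsum, coeff_one]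
  cases M with
  | zero =>
    have := hN 1
    simp [pch_succ] at this
    simp [pch_succ, this]
  | succ M =>
    rw [if_neg (by omega)]
    have h := congrArg (fun t => N / (M + 1).factorial * t) (sum_choose_pch_eq_zero N M)
    simp only [mul_zero, mul_sum] at h
    rw [← h]
    refine sum_congr rfl fun i hi => ?_
    obtain ⟨m, hm⟩ := Nat.exists_eq_add_of_le (Nat.lt_succ_iff.1 (mem_range.1 hi))
    have h4 : ((M + 1).choose i : K) * i.factorial * m.factorial = (M + 1).factorial := by
      rw [hm]; exact_mod_cast cast_choose_factorial i m
    have h1 := Nat.cast_ne_zero (R := K).2 i.factorial_ne_zero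
    have h2 := Nat.cast_ne_zero (R := K).2 m.factorial_ne_zero
    have h3 := Nat.cast_ne_zero (R := K).2 (M + 1).factorial_ne_zero
    have h5 := hN (i + 1)
    have h6 : pch N (2 * i) * pch (N + 2 * i) m = pch N (i + 1) * pch (N + 1 + i) M := by
      rw [show N + 2 * (i : K) = N + ((2 * i : ℕ) : K) by push_cast; ring, ← pch_add,
        show N + 1 + (i : K) = N + ((i + 1 : ℕ) : K) by push_cast; ring, ← pch_add]
      congr 1; omega
    rw [coeff_C_mul, opow_C_mul_X, coeff_mk, hm, Nat.add_sub_cancel_left, ← hm, ← h4]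
    rw [← h4] at h3
    have h7 : ((M + 1).choose i : K) ≠ 0 := left_ne_zero_of_mul (left_ne_zero_of_mul h3)
    field_simp
    linear_combination N * h6

/-- The coefficients of the expansion of `(1 + q ^ 2) ^ N` in powers of `q ^ 2 / (1 + q ^ 2) ^ 2`. -/
def lagr (N : K) (i : ℕ) : K := N * pch N (2 * i) / (i.factorial * pch N (i + 1))

/-- The variable `2 q / (1 + q ^ 2)`. -/
def uvar (K : Type*) [Field K] : K⟦X⟧ := X * (C 2 * opow 1 (C (-1) * X ^ 2))

lemma constantCoeff_uvar : constantCoeff (uvar K) = 0 := by simp [uvar]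

lemma constantCoeff_negXsq : constantCoeff (C (-1) * X ^ 2 : K⟦X⟧) = 0 := by simp

lemma coeff_one_uvar : coeff 1 (uvar K) ≠ 0 := by
  rw [uvar, show (1 : ℕ) = 0 + 1 from rfl, coeff_succ_X_mul, coeff_zero_eq_constantCoeff_apply, map_mul,
    constantCoeff_opow _ constantCoeff_negXsq]
  simp

lemma subst_lagr (N : K) (hN : ∀ j, pch N j ≠ 0) :
    opow N (C (-1) * X ^ 2) *
      PowerSeries.subst (uvar K)
        (PowerSeries.subst (X ^ 2 : K⟦X⟧) (PowerSeries.mk fun i => lagr N i / 4 ^ i)) = 1 := by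
  have hX2 : constantCoeff (X ^ 2 : K⟦X⟧) = 0 := by simp
  have hX1 : constantCoeff (C (-1) * X : K⟦X⟧) = 0 := by simp
  have h := congrArg (PowerSeries.subst (X ^ 2 : K⟦X⟧)) (xsum_lagrange N hN)
  have h2 : (xsum fun i => C (N * pch N (2 * i) / (i.factorial * pch N (i + 1))) *
      opow (N + 2 * i) (C (-1) * X)) = opow N (C (-1) * X) *
        (PowerSeries.mk (lagr N)).subst (X * opow 2 (C (-1) * X)) := by
    rw [subst_eq_xsum, mul_xsum]
    congr 1; ext1 i
    rw [coeff_mk, opow_pow _ hX1, ← opow_mul_opow _ _ hX1, lagr, mul_comm (i : K) 2]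
    ring
  have e : (C (-1) * X : K⟦X⟧).subst (X ^ 2 : K⟦X⟧) = C (-1) * X ^ 2 := by
    rw [subst_mul (hasSubst_of hX2), subst_X (hasSubst_of hX2)]
    congr 1; exact subst_C _
  have hY : constantCoeff (X * opow 2 (C (-1) * X) : K⟦X⟧) = 0 := by simp
  rw [h2, subst_mul (hasSubst_of hX2), subst_opow _ hX1 hX2, e,
    subst_comp_subst_apply (hasSubst_of hY) (hasSubst_of hX2),
    subst_mul (hasSubst_of hX2), subst_opow _ hX1 hX2, e, subst_X (hasSubst_of hX2)] at h
  have h1 : (1 : K⟦X⟧).subst (X ^ 2 : K⟦X⟧) = 1 := by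
    rw [← coe_substAlgHom (hasSubst_of hX2), map_one]
  rw [h1] at h
  rw [← h]
  congr 1
  rw [subst_comp_subst_apply (hasSubst_of hX2) (hasSubst_of constantCoeff_uvar),
    subst_pow (hasSubst_of constantCoeff_uvar), subst_X (hasSubst_of constantCoeff_uvar)]
  have e2 : (PowerSeries.mk fun i => lagr N i / 4 ^ i) = rescale (4 : K)⁻¹ (PowerSeries.mk (lagr N)) := by
    ext i; simp [coeff_rescale]; ring
  have hu2 : constantCoeff (uvar K ^ 2) = 0 := by simp [constantCoeff_uvar]
  have h4 : constantCoeff ((4 : K)⁻¹ • X : K⟦X⟧) = 0 := by simp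
  rw [e2, rescale_eq_subst, subst_comp_subst_apply (hasSubst_of h4) (hasSubst_of hu2)]
  congr 1
  rw [subst_smul (hasSubst_of hu2), subst_X (hasSubst_of hu2), uvar, mul_pow, mul_pow,
    opow_pow _ constantCoeff_negXsq, smul_eq_C_mul, ← map_pow]
  have : (C (4 : K)⁻¹ * C (2 ^ 2) : K⟦X⟧) = 1 := by
    rw [← map_mul]; norm_num
  push_cast
  rw [mul_one]
  linear_combination X ^ 2 * opow 2 (C (-1) * X ^ 2) * this

/-- The generating function of the homogeneous components of the right-hand side. -/
def hornGen {n : ℕ} (k A B : K) (z : Fin n → K) : K⟦X⟧ :=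
  xsum fun j => C (pch k j * pch k j / (pch (2 * k) j * j.factorial) *
    ((A - A⁻¹) * (B - B⁻¹) / 2 ^ n) ^ j) *
      (X ^ ((n - 1) * j) * ∏ s, opow (k + j) (C (z s) * X))

/-- The generating function of the homogeneous components of the Bessel function. -/
def besselGen (n : ℕ) (k A B : K) : K⟦X⟧ :=
  xsum fun j => C (j.factorial / pch (2 * k) j * (geg k A j * geg k B j) / 2 ^ (n * j)) *
    (X ^ ((n - 1) * j) *
      (PowerSeries.mk fun i => lagr (n * k + n * j) i / 4 ^ i).subst (X ^ 2 : K⟦X⟧))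

lemma uvar_pow_aux {n : ℕ} (hn : n ≠ 0) (j : ℕ) :
    (C 2 * opow 1 (C (-1) * X ^ 2)) ^ j * uvar K ^ ((n - 1) * j) =
      X ^ ((n - 1) * j) * (C (2 ^ (n * j)) * opow (n * j : K) (C (-1) * X ^ 2)) := by
  obtain ⟨m, rfl⟩ := Nat.exists_eq_succ_of_ne_zero hn
  rw [uvar, mul_pow X, mul_left_comm, ← pow_add,
    show j + (m.succ - 1) * j = m.succ * j by simp; ring, mul_pow,
    opow_pow _ constantCoeff_negXsq, map_pow]
  push_cast; rw [mul_one]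

theorem subst_besselGen {n : ℕ} (hn : n ≠ 0) (k A B : K)
    (hnk : ∀ i j : ℕ, pch (n * k + n * i) j ≠ 0) :
    opow (n * k) (C (-1) * X ^ 2) * (besselGen n k A B).subst (uvar K) =
      xsum fun j => C (j.factorial / pch (2 * k) j * (geg k A j * geg k B j)) *
        X ^ ((n - 1) * j) := by
  have hu := hasSubst_of (constantCoeff_uvar (K := K))
  conv_lhs => rw [besselGen, uvar, subst_xsum, ← uvar]
  rw [mul_xsum]
  congr 1; ext1 j
  rw [subst_mul hu, subst_mul hu, subst_pow hu, subst_X hu]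
  have h1 := uvar_pow_aux (K := K) hn j
  have h2 := subst_lagr (n * k + n * j : K) (hnk j)
  rw [← opow_mul_opow _ _ constantCoeff_negXsq] at h2
  rw [show ∀ c : K, subst (uvar K) (C c : K⟦X⟧) = C c from fun c => subst_C _]
  have h3 : (C (j.factorial / pch (2 * k) j * (geg k A j * geg k B j) / 2 ^ (n * j)) : K⟦X⟧) *
      C (2 ^ (n * j)) = C (j.factorial / pch (2 * k) j * (geg k A j * geg k B j)) := by
    rw [← map_mul]; congr 1; field_simp
  rw [← h3]
  set Z := (subst (uvar K) (subst (X ^ 2 : K⟦X⟧) (PowerSeries.mk fun i => lagr (n * k + n * j : K) i / 4 ^ i)))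
  set c := (C (j.factorial / pch (2 * k) j * (geg k A j * geg k B j) / 2 ^ (n * j)) : K⟦X⟧)
  generalize opow (n * k : K) (C (-1) * X ^ 2) = o1 at *
  linear_combination o1 * c * Z * h1 + c * X ^ ((n - 1) * j) * C (2 ^ (n * j)) * h2

theorem subst_hornGen {n : ℕ} (hn : n ≠ 0) (k : K) {A B : K} (hA : A ≠ 0) (hB : B ≠ 0)
    (hk : ∀ j, pch (2 * k) j ≠ 0) (z : Fin n → K)
    (hz : ∏ s, (1 - (C (2 * z s) * X - X ^ 2)) =
      (1 - C (A / B) * X ^ n) * (1 - C (B / A) * X ^ n)) :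
    opow (n * k) (C (-1) * X ^ 2) * (hornGen k A B z).subst (uvar K) =
      xsum fun j => C (j.factorial / pch (2 * k) j * (geg k A j * geg k B j)) *
        X ^ ((n - 1) * j) := by
  have hu := hasSubst_of (constantCoeff_uvar (K := K))
  have hXn : constantCoeff (X ^ n : K⟦X⟧) = 0 := by simp [hn]
  have hXn' : (X : K⟦X⟧) ^ n = X * X ^ (n - 1) := by
    rw [← pow_succ']; congr 1; omega
  have hg := congrArg (PowerSeries.subst (X ^ n : K⟦X⟧)) (geg_product k hA hB hk)
  rw [← xsum_C, hXn', subst_xsum, subst_xsum, ← hXn'] at hg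
  have hC : ∀ (c : K) (u : K⟦X⟧), subst u (C c : K⟦X⟧) = C c := fun c u => subst_C _
  have hr : ∀ j : ℕ, ((X : K⟦X⟧) ^ (n - 1)) ^ j = X ^ ((n - 1) * j) := fun j => by rw [pow_mul]
  simp only [hC, hr] at hg
  refine Eq.trans ?_ (hg.trans (by congr 1; ext1 j; rw [mul_comm]))
  conv_lhs => rw [hornGen, uvar, subst_xsum, ← uvar]
  rw [mul_xsum]
  congr 1; ext1 j
  have hcX : ∀ c : K, constantCoeff (C c * X : K⟦X⟧) = 0 := constantCoeff_C_mul_X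
  have hcXu : ∀ c : K, constantCoeff (C c * uvar K) = 0 := by simp [constantCoeff_uvar]
  have hcXn : ∀ c : K, constantCoeff (C c * X ^ n : K⟦X⟧) = 0 := by simp [hn]
  have hq : ∀ c : K, constantCoeff (C c * X - X ^ 2 : K⟦X⟧) = 0 := by simp
  have hprod : opow (n * k + n * j : K) (C (-1) * X ^ 2) * ∏ s, opow (k + j) (C (z s) * uvar K) =
      opow (k + j) (C (A / B) * X ^ n) * opow (k + j) (C (B / A) * X ^ n) := by
    have h1 : ∀ s, opow (k + j) (C (-1) * X ^ 2) * opow (k + j) (C (z s) * uvar K) =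
        opow (k + j) (C (2 * z s) * X - X ^ 2) := by
      intro s
      refine opow_mul_opow_arg _ constantCoeff_negXsq (hcXu _) ?_
      have := opow_one_mul (constantCoeff_negXsq (K := K))
      simp only [uvar, map_neg, map_one, map_mul] at this ⊢
      linear_combination (-C (z s) * X * C 2) * this
    have h2 : opow (n * k + n * j : K) (C (-1) * X ^ 2) =
        ∏ _s : Fin n, opow (k + j) (C (-1) * X ^ 2) := by
      rw [prod_const, card_univ, Fintype.card_fin, opow_pow _ constantCoeff_negXsq]
      congr 1; ring
    rw [h2, ← prod_mul_distrib, prod_congr rfl fun s _ => h1 s]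
    have h3 : (1 - C (A / B) * X ^ n) * (1 - C (B / A) * X ^ n) =
      1 - (1 - (1 - C (A / B) * X ^ n) * (1 - C (B / A) * X ^ n) : K⟦X⟧) := by ring
    rw [opow_mul_opow_arg _ (hcXn _) (hcXn _) h3]
    exact opow_prod _ _ _ (fun s _ => hq _) (hz.trans h3)
  have hsX : ∀ c : K, (C c * X : K⟦X⟧).subst (X ^ n : K⟦X⟧) = C c * X ^ n := by
    intro c
    rw [subst_mul (hasSubst_of hXn), hC, subst_X (hasSubst_of hXn)]
  have hsu : ∀ c : K, (C c * X : K⟦X⟧).subst (uvar K) = C c * uvar K := by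
    intro c
    rw [subst_mul hu, hC, subst_X hu]
  have hps : (∏ s, opow (k + j) (C (z s) * X)).subst (uvar K) =
      ∏ s, opow (k + j) (C (z s) * uvar K) := by
    rw [← coe_substAlgHom hu, map_prod]
    refine prod_congr rfl fun s _ => ?_
    rw [coe_substAlgHom hu, subst_opow _ (hcX _) constantCoeff_uvar, hsu]
  rw [subst_mul hu, subst_mul hu, subst_pow hu, subst_X hu, hps, hC,
    subst_mul (hasSubst_of hXn), subst_mul (hasSubst_of hXn), hC,
    subst_opow _ (hcX _) hXn, subst_opow _ (hcX _) hXn, hsX, hsX, ← hprod,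
    ← opow_mul_opow _ _ constantCoeff_negXsq]
  have h1 := uvar_pow_aux (K := K) hn j
  have h3 : ∀ w : K, (C (w * ((A - A⁻¹) * (B - B⁻¹) / 2 ^ n) ^ j) : K⟦X⟧) * C (2 ^ (n * j)) =
      C (w * ((A - A⁻¹) * (B - B⁻¹)) ^ j) := by
    intro w
    rw [← map_mul]; congr 1
    rw [div_pow, ← pow_mul]; field_simp
  rw [← h3]
  generalize opow (n * k : K) (C (-1) * X ^ 2) = o1
  generalize (∏ s, opow (k + j) (C (z s) * uvar K)) = o2
  generalize (C (_ * ((A - A⁻¹) * (B - B⁻¹) / 2 ^ n) ^ j) : K⟦X⟧) = o3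
  linear_combination o1 * o3 * o2 * h1

/-- The homogeneous components of the Bessel function and of its expansion coincide. -/
theorem hornGen_eq_besselGen {n : ℕ} (hn : n ≠ 0) (k : K) {A B : K} (hA : A ≠ 0) (hB : B ≠ 0)
    (hk : ∀ j, pch (2 * k) j ≠ 0) (hnk : ∀ i j : ℕ, pch (n * k + n * i) j ≠ 0) (z : Fin n → K)
    (hz : ∏ s, (1 - (C (2 * z s) * X - X ^ 2)) =
      (1 - C (A / B) * X ^ n) * (1 - C (B / A) * X ^ n)) :
    hornGen k A B z = besselGen n k A B := by
  refine subst_injective_of constantCoeff_uvar coeff_one_uvar ?_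
  have h := (subst_hornGen hn k hA hB hk z hz).trans (subst_besselGen hn k A B hnk).symm
  refine mul_left_cancel₀ ?_ h
  intro h0
  have := congrArg constantCoeff h0
  rw [constantCoeff_opow _ constantCoeff_negXsq] at this
  simp at this

end Formal
end DihedralBessel
end

noncomputable section
namespace DihedralBessel
open PowerSeries Finset

section Heisenberg

variable {K : Type*} [Field K] [CharZero K]

lemma derivative_opow (a : K) {f : K⟦X⟧} (hf : constantCoeff f = 0) :
    d⁄dX K (opow a f) = C a * d⁄dX K f * opow (a + 1) f := by
  have h1 : (1 - f : K⟦X⟧) ≠ 0 := by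
    intro h; have := congrArg constantCoeff h; simp [hf] at this
  refine mul_left_cancel₀ h1 ?_
  rw [opow_ode a hf, ← opow_add_one_mul a hf]; ring

/-- The generating function of the products of two binomial series. -/
def heisGen (a b Z W : K) : K⟦X⟧ := opow a (C Z * X) * opow b (C W * X)

lemma heisGen_left (a b Z W : K) :
    heisGen a b Z W = (1 - C Z * X) * heisGen (a + 1) b Z W := by
  rw [heisGen, heisGen, ← opow_add_one_mul a (constantCoeff_C_mul_X Z)]; ring

lemma heisGen_right (a b Z W : K) :
    heisGen a b Z W = (1 - C W * X) * heisGen a (b + 1) Z W := by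
  rw [heisGen, heisGen, ← opow_add_one_mul b (constantCoeff_C_mul_X W)]; ring

lemma heisGen_swap (a b Z W : K) : heisGen a b Z W = heisGen b a W Z := mul_comm _ _

lemma derivative_heisGen (a b Z W : K) :
    d⁄dX K (heisGen a b Z W) =
      C (a * Z) * heisGen (a + 1) b Z W + C (b * W) * heisGen a (b + 1) Z W := by
  simp only [heisGen, Derivation.leibniz, derivative_opow _ (constantCoeff_C_mul_X _), smul_eq_mul,
    derivative_C, derivative_X, map_mul]
  ring

lemma coeff_X_mul_derivative (f : K⟦X⟧) (j : ℕ) : coeff j (X * d⁄dX K f) = j * coeff j f := by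
  cases j with
  | zero => simp
  | succ j => rw [coeff_succ_X_mul, coeff_derivative]; push_cast; ring

/-- The Heisenberg polynomials. -/
def heis (k Z W : K) (j : ℕ) : K := coeff j (heisGen (k + 1) k Z W)

/-- The derivative of `heis` with respect to the first variable. -/
def heisZ (k Z W : K) (j : ℕ) : K := (k + 1) * coeff j (X * heisGen (k + 1 + 1) k Z W)

/-- The derivative of `heis` with respect to the second variable. -/
def heisW (k Z W : K) (j : ℕ) : K := k * coeff j (X * heisGen (k + 1) (k + 1) Z W)

lemma heis_zero (k Z W : K) : heis k Z W 0 = 1 := by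
  simp [heis, heisGen]

lemma heisW_sub (k Z W : K) (j : ℕ) :
    (Z - W) * heisW k Z W j = k * (heis k Z W j - heis k W Z j) := by
  rw [heisW, heis, heis, heisGen_right (k + 1) k Z W, heisGen_swap (k + 1) k W Z,
    heisGen_left k (k + 1) Z W, ← map_sub, mul_left_comm, ← coeff_C_mul]
  congr 2
  simp only [map_sub]; ring

lemma heis_euler (k Z W : K) (j : ℕ) :
    Z * heisZ k Z W j + W * heisW k Z W j = j * heis k Z W j := by
  rw [heis, ← coeff_X_mul_derivative, derivative_heisGen, heisZ, heisW, mul_add, map_add, ← mul_assoc,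
    ← mul_assoc, ← coeff_C_mul, ← coeff_C_mul]
  congr 2 <;> · simp only [map_mul]; ring

lemma heisZ_add_heisW (k Z W : K) (j : ℕ) :
    heisZ k Z W (j + 1) + heisW k Z W (j + 1) = (j + 1 + 2 * k) * heis k Z W j := by
  have h : (j : K) * heis k Z W j = coeff j (X * d⁄dX K (heisGen (k + 1) k Z W)) := by
    rw [coeff_X_mul_derivative]; rfl
  rw [heisZ, heisW, coeff_succ_X_mul, coeff_succ_X_mul,
    show (j + 1 + 2 * k) * heis k Z W j = j * heis k Z W j + (2 * k + 1) * heis k Z W j by ring, h,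
    heis, ← coeff_C_mul, ← coeff_C_mul, ← coeff_C_mul, ← map_add, ← map_add]
  congr 1
  rw [derivative_heisGen]
  have h1 := heisGen_left (k + 1) k Z W
  have h2 := heisGen_right (k + 1) k Z W
  simp only [map_mul, map_add, map_ofNat, map_one]
  linear_combination (-(C k + 1)) * h1 - C k * h2

/-- The symmetric homogeneous polynomials attached to the Gegenbauer polynomials. -/
def gegHom (k Z W : K) (j : ℕ) : K := coeff j (heisGen k k Z W)

lemma heis_add_swap (k Z W : K) (j : ℕ) :
    k * (heis k Z W j + heis k W Z j) = (j + 2 * k) * gegHom k Z W j := by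
  have h : (j : K) * gegHom k Z W j = coeff j (X * d⁄dX K (heisGen k k Z W)) := by
    rw [coeff_X_mul_derivative]; rfl
  rw [add_mul, h, derivative_heisGen, heis, heis, heisGen_swap (k + 1) k W Z, gegHom, ← map_add,
    ← coeff_C_mul, ← coeff_C_mul, ← map_add]
  congr 1
  have h1 := heisGen_left k k Z W
  have h2 := heisGen_right k k Z W
  simp only [map_mul, map_ofNat]
  linear_combination (-C k) * h1 - C k * h2

lemma heis_succ (k Z W : K) (j : ℕ) :
    (k + (j + 1)) * heis k Z W (j + 1) =
      k * heis k W Z (j + 1) + (2 * k + (j + 1)) * (Z * heis k Z W j) := by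
  have h1 : Z * heis k Z W j = heis k Z W (j + 1) - gegHom k Z W (j + 1) := by
    rw [heis, heis, gegHom, heisGen_left k k Z W, ← map_sub, ← coeff_C_mul, ← coeff_succ_X_mul]
    congr 1; ring
  have h2 := heis_add_swap k Z W (j + 1)
  push_cast at h2
  rw [h1]
  linear_combination -h2

end Heisenberg

section RootsOfUnity

/-- The rotations `e^{2πi(l+1)/n}`. -/
def rt (n : ℕ) (l : Fin n) : ℂ := Complex.exp (2 * Real.pi * Complex.I / n) ^ ((l : ℕ) + 1)

lemma rt_pow (n : ℕ) (l : Fin n) : rt n l ^ n = 1 := by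
  have hn : n ≠ 0 := by rintro rfl; exact l.elim0
  rw [rt, pow_right_comm, (Complex.isPrimitiveRoot_exp n hn).pow_eq_one, one_pow]

lemma rt_ne_zero (n : ℕ) (l : Fin n) : rt n l ≠ 0 := pow_ne_zero _ (Complex.exp_ne_zero _)

lemma norm_rt (n : ℕ) (l : Fin n) : ‖rt n l‖ = 1 := by
  have hn : n ≠ 0 := by rintro rfl; exact l.elim0
  exact Complex.norm_eq_one_of_pow_eq_one (rt_pow n l) hn

lemma rt_mul_conj (n : ℕ) (l : Fin n) : rt n l * (starRingEnd ℂ) (rt n l) = 1 := by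
  rw [Complex.mul_conj, Complex.normSq_eq_norm_sq, norm_rt]; simp

lemma sum_rt_pow {n : ℕ} (hn : n ≠ 0) (e : ℕ) :
    ∑ l : Fin n, rt n l ^ e = if n ∣ e then (n : ℂ) else 0 := by
  have hp := Complex.isPrimitiveRoot_exp n hn
  set ζ := Complex.exp (2 * Real.pi * Complex.I / n) with hζ
  have h1 : ∑ l : Fin n, rt n l ^ e = ζ ^ e * ∑ i ∈ range n, (ζ ^ e) ^ i := by
    rw [mul_sum, sum_range]
    refine sum_congr rfl fun l _ => ?_
    rw [rt, ← hζ]; ring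
  rw [h1]
  split_ifs with h
  · rw [(hp.pow_eq_one_iff_dvd e).2 h]; simp
  · have h2 : ζ ^ e ≠ 1 := fun h' => h ((hp.pow_eq_one_iff_dvd e).1 h')
    have h3 := mul_neg_geom_sum (ζ ^ e) n
    rw [← pow_mul, mul_comm e n, pow_mul, hp.pow_eq_one, one_pow, sub_self] at h3
    rw [(mul_eq_zero.1 h3).resolve_left (sub_ne_zero.2 h2.symm), mul_zero]

lemma sub_rt_mul_ne_zero {n : ℕ} {z w : ℂ} (h : z ^ n ≠ w ^ n) (l : Fin n) : z - rt n l * w ≠ 0 := by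
  intro h0
  apply h
  rw [sub_eq_zero.1 h0, mul_pow, rt_pow, one_mul]

lemma sum_rt_pow_div {n : ℕ} {z w : ℂ} (h : z ^ n ≠ w ^ n) {i : ℕ} (hi : i < n) :
    ∑ l : Fin n, rt n l ^ (i + 1) / (z - rt n l * w) =
      n * (z ^ i * w ^ (n - 1 - i)) / (z ^ n - w ^ n) := by
  have hn : n ≠ 0 := by omega
  have hZ : z ^ n - w ^ n ≠ 0 := sub_ne_zero.2 h
  have h1 : ∀ l : Fin n, rt n l ^ (i + 1) / (z - rt n l * w) =
      (∑ q ∈ range n, rt n l ^ (i + 1 + q) * (w ^ q * z ^ (n - 1 - q))) / (z ^ n - w ^ n) := by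
    intro l
    rw [div_eq_div_iff (sub_rt_mul_ne_zero h l) hZ]
    have := (Commute.all (rt n l * w) z).geom_sum₂_mul n
    rw [mul_pow, rt_pow, one_mul] at this
    have h2 : ∑ q ∈ range n, rt n l ^ (i + 1 + q) * (w ^ q * z ^ (n - 1 - q)) =
        rt n l ^ (i + 1) * ∑ q ∈ range n, (rt n l * w) ^ q * z ^ (n - 1 - q) := by
      rw [mul_sum]
      refine sum_congr rfl fun q _ => ?_
      rw [pow_add, mul_pow]; ring
    rw [h2]
    linear_combination rt n l ^ (i + 1) * this
  rw [sum_congr rfl fun l _ => h1 l, ← sum_div, sum_comm]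
  congr 1
  rw [sum_eq_single (n - 1 - i)]
  · rw [← sum_mul, sum_rt_pow hn, if_pos (by rw [show i + 1 + (n - 1 - i) = n by omega]),
      show n - 1 - (n - 1 - i) = i by omega]
    ring
  · intro q hq hqi
    rw [← sum_mul, sum_rt_pow hn, if_neg, zero_mul]
    rintro ⟨c, hc⟩
    have hq' := mem_range.1 hq
    have hc1 : c < 2 := by
      by_contra h2
      have : n * 2 ≤ n * c := Nat.mul_le_mul_left n (by omega)
      omega
    interval_cases c
    · omega
    · omega
  · intro h; exact absurd (mem_range.2 (by omega)) h

lemma sum_inv_rt {n : ℕ} (hn : n ≠ 0) {z w : ℂ} (h : z ^ n ≠ w ^ n) :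
    ∑ l : Fin n, 1 / (z - rt n l * w) = n * z ^ (n - 1) / (z ^ n - w ^ n) := by
  have := sum_rt_pow_div h (i := n - 1) (by omega)
  rw [show n - 1 + 1 = n by omega] at this
  simpa [rt_pow] using this

end RootsOfUnity
end DihedralBessel
end

noncomputable section
namespace DihedralBessel
open PowerSeries Finset ComplexConjugate

lemma coeff_X_mul_opow (a Z : ℂ) (m : ℕ) :
    a * coeff m (X * opow (a + 1) (C Z * X)) = pch a m / m.factorial * (m * Z ^ (m - 1)) := by
  cases m with
  | zero => simp
  | succ m =>
    rw [coeff_succ_X_mul, opow_C_mul_X, coeff_mk, pch_succ_left, Nat.factorial_succ]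
    have h1 := Nat.cast_add_one_ne_zero (R := ℂ) m
    have h2 := Nat.cast_ne_zero (R := ℂ).2 m.factorial_ne_zero
    push_cast
    field_simp

lemma hasDerivAt_coeff_heisGen (a b : ℂ) (j : ℕ) {Z W : ℝ → ℂ} {Z' W' : ℂ} {t : ℝ}
    (hZ : HasDerivAt Z Z' t) (hW : HasDerivAt W W' t) :
    HasDerivAt (fun s => coeff j (heisGen a b (Z s) (W s)))
      (a * coeff j (X * heisGen (a + 1) b (Z t) (W t)) * Z' +
        b * coeff j (X * heisGen a (b + 1) (Z t) (W t)) * W') t := by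
  have h1 : ∀ p ∈ antidiagonal j, HasDerivAt (fun s => coeff p.1 (opow a (C (Z s) * X)) *
      coeff p.2 (opow b (C (W s) * X)))
      (a * coeff p.1 (X * opow (a + 1) (C (Z t) * X)) * Z' * coeff p.2 (opow b (C (W t) * X)) +
        coeff p.1 (opow a (C (Z t) * X)) *
          (b * coeff p.2 (X * opow (b + 1) (C (W t) * X)) * W')) t := by
    intro p _
    have e1 : HasDerivAt (fun s => coeff p.1 (opow a (C (Z s) * X)))
        (a * coeff p.1 (X * opow (a + 1) (C (Z t) * X)) * Z') t := by
      rw [coeff_X_mul_opow]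
      simp only [opow_C_mul_X, coeff_mk]
      exact ((hZ.fun_pow p.1).const_mul (pch a p.1 / p.1.factorial)).congr_deriv (by ring)
    have e2 : HasDerivAt (fun s => coeff p.2 (opow b (C (W s) * X)))
        (b * coeff p.2 (X * opow (b + 1) (C (W t) * X)) * W') t := by
      rw [coeff_X_mul_opow]
      simp only [opow_C_mul_X, coeff_mk]
      exact ((hW.fun_pow p.2).const_mul (pch b p.2 / p.2.factorial)).congr_deriv (by ring)
    exact e1.mul e2
  have h2 := HasDerivAt.fun_sum h1
  simp only [heisGen, coeff_mul j (opow a _)]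
  refine h2.congr_deriv ?_
  rw [sum_add_distrib, show X * (opow (a + 1) (C (Z t) * X) * opow b (C (W t) * X)) =
    (X * opow (a + 1) (C (Z t) * X)) * opow b (C (W t) * X) by ring,
    show X * (opow a (C (Z t) * X) * opow (b + 1) (C (W t) * X)) =
    opow a (C (Z t) * X) * (X * opow (b + 1) (C (W t) * X)) by ring, coeff_mul, coeff_mul,
    mul_sum, mul_sum, sum_mul, sum_mul]
  congr 1 <;> exact sum_congr rfl fun p _ => by ring

lemma hasDerivAt_heis (k : ℂ) (j : ℕ) {Z W : ℝ → ℂ} {Z' W' : ℂ} {t : ℝ}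
    (hZ : HasDerivAt Z Z' t) (hW : HasDerivAt W W' t) :
    HasDerivAt (fun s => heis k (Z s) (W s) j)
      (heisZ k (Z t) (W t) j * Z' + heisW k (Z t) (W t) j * W') t :=
  hasDerivAt_coeff_heisGen (k + 1) k j hZ hW

lemma conj_pch (k : ℝ) (m : ℕ) : conj (pch (k : ℂ) m) = pch (k : ℂ) m := by
  induction m with
  | zero => simp
  | succ m ih => rw [pch_succ, map_mul, ih]; simp

lemma conj_coeff_opow (a : ℝ) (Z : ℂ) (m : ℕ) :
    conj (coeff m (opow (a : ℂ) (C Z * X))) = coeff m (opow (a : ℂ) (C (conj Z) * X)) := by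
  rw [opow_C_mul_X, opow_C_mul_X, coeff_mk, coeff_mk, map_mul, map_div₀, conj_pch]; simp

lemma conj_coeff_heisGen (a b : ℝ) (Z W : ℂ) (j : ℕ) :
    conj (coeff j (heisGen (a : ℂ) b Z W)) = coeff j (heisGen (a : ℂ) b (conj Z) (conj W)) := by
  rw [heisGen, heisGen, coeff_mul, coeff_mul, map_sum]
  exact sum_congr rfl fun p _ => by rw [map_mul, conj_coeff_opow, conj_coeff_opow]

lemma conj_heis (k : ℝ) (Z W : ℂ) (j : ℕ) :
    conj (heis (k : ℂ) Z W j) = heis (k : ℂ) (conj Z) (conj W) j := by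
  simpa [heis] using conj_coeff_heisGen (k + 1) k Z W j

/-- The homogeneous polynomials, of degree `m`, in the kernel of the conjugate Dunkl operator. -/
def hpol (n : ℕ) (k : ℝ) (m : ℕ) (x : ℂ) : ℂ :=
  x ^ (m % n) * heis (k : ℂ) (x ^ n) (conj x ^ n) (m / n)

lemma conj_hpol (n : ℕ) (k : ℝ) (m : ℕ) (x : ℂ) :
    conj (hpol n k m x) = conj x ^ (m % n) * heis (k : ℂ) (conj x ^ n) (x ^ n) (m / n) := by
  simp [hpol, conj_heis]

lemma hpol_zero (n : ℕ) (k : ℝ) (x : ℂ) : hpol n k 0 x = 1 := by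
  simp [hpol, heis_zero]

/-- The coefficient of the conjugate in the recursion for `hpol`. -/
def epsc (n : ℕ) (k : ℝ) (m : ℕ) : ℝ := if n ∣ m then k / (k + (m / n : ℕ)) else 0

/-- The coefficient of the predecessor in the recursion for `hpol`. -/
def kapc (n : ℕ) (k : ℝ) (m : ℕ) : ℝ :=
  if n ∣ m then (2 * k + (m / n : ℕ)) / (k + (m / n : ℕ)) else 1

lemma kapc_pos (n : ℕ) {k : ℝ} (hk : 0 < k) (m : ℕ) : 0 < kapc n k m := by
  rw [kapc]; split_ifs <;> positivity

lemma epsc_zero (n : ℕ) {k : ℝ} (hk : 0 < k) : epsc n k 0 = 1 := by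
  simp [epsc, hk.ne']

lemma mod_succ_of_not_dvd {n m : ℕ} (h : ¬ n ∣ m + 1) : (m + 1) % n = m % n + 1 := by
  have h2 : (m + 1) / n = m / n := by
    rw [Nat.succ_div, if_neg h]; simp
  have h3 := Nat.div_add_mod m n
  have h4 := Nat.div_add_mod (m + 1) n
  rw [h2] at h4
  omega

lemma hpol_succ {n : ℕ} (hn : n ≠ 0) {k : ℝ} (hk : 0 < k) (m : ℕ) (x : ℂ) :
    hpol n k (m + 1) x = epsc n k (m + 1) * conj (hpol n k (m + 1) x) +
      kapc n k (m + 1) * (x * hpol n k m x) := by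
  rw [epsc, kapc]
  split_ifs with h
  · obtain ⟨q, hq⟩ := h
    obtain ⟨j, rfl⟩ : ∃ j, q = j + 1 := ⟨q - 1, by
      rcases q with _ | q
      · omega
      · simp⟩
    have hm : m = n - 1 + n * j := by
      rw [mul_add, mul_one] at hq; omega
    have h1 : (m + 1) % n = 0 := by rw [hq]; simp
    have h2 : (m + 1) / n = j + 1 := by rw [hq]; exact Nat.mul_div_cancel_left _ (by omega)
    have h3 : m % n = n - 1 := by
      rw [hm, Nat.add_mul_mod_self_left, Nat.mod_eq_of_lt (by omega)]
    have h4 : m / n = j := by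
      rw [hm, Nat.add_mul_div_left _ _ (by omega), Nat.div_eq_of_lt (by omega), zero_add]
    rw [conj_hpol, hpol, hpol, h1, h2, h3, h4]
    have h5 := heis_succ (k : ℂ) (x ^ n) (conj x ^ n) j
    have h6 : (k : ℂ) + (j + 1) ≠ 0 := by
      have : 0 < k + (j + 1) := by positivity
      exact_mod_cast this.ne'
    have h7 : x * (x ^ (n - 1) * heis (k : ℂ) (x ^ n) (conj x ^ n) j) =
        x ^ n * heis (k : ℂ) (x ^ n) (conj x ^ n) j := by
      rw [← mul_assoc, ← pow_succ', Nat.sub_add_cancel (by omega)]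
    rw [h7]
    push_cast
    field_simp
    linear_combination h5
  · have h1 := mod_succ_of_not_dvd h
    have h2 : (m + 1) / n = m / n := by
      rw [Nat.succ_div, if_neg h]; simp
    rw [hpol, hpol, h1, h2]
    push_cast
    ring

/-- `g` has Dunkl derivative `v` at the regular point `x` in direction `ξ`. -/
def HasDunkl (n : ℕ) (k : ℝ) (g : ℂ → ℂ) (ξ x v : ℂ) : Prop :=
  HasDerivAt (fun t : ℝ => g (x + t * ξ))
    (v - k * ∑ l : Fin n, (ξ - rt n l * conj ξ) / (x - rt n l * conj x) *
      (g x - g (rt n l * conj x))) 0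

lemma hasDerivAt_line (x ξ : ℂ) : HasDerivAt (fun t : ℝ => x + t * ξ) ξ 0 := by
  have := ((Complex.ofRealCLM.hasDerivAt (x := (0 : ℝ))).mul_const ξ).const_add x
  simpa using this

lemma hasDerivAt_line_conj (x ξ : ℂ) : HasDerivAt (fun t : ℝ => conj (x + t * ξ)) (conj ξ) 0 := by
  simpa using hasDerivAt_line (conj x) (conj ξ)

lemma hpol_rt (n : ℕ) (k : ℝ) (m : ℕ) (x : ℂ) (l : Fin n) :
    hpol n k m (rt n l * conj x) = rt n l ^ (m % n) * conj (hpol n k m x) := by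
  have h : conj (rt n l) ^ n = 1 := by rw [← map_pow, rt_pow, map_one]
  rw [conj_hpol, hpol]
  simp only [map_mul, Complex.conj_conj, mul_pow, rt_pow, h, one_mul]
  ring

lemma hasDunkl_hpol_aux {n : ℕ} (hn : 2 ≤ n) (k : ℝ) (m : ℕ) {x : ℂ} (hx : x ^ n ≠ conj x ^ n)
    (ξ : ℂ) : HasDunkl n k (hpol n k m) ξ x
      (ξ * (((m % n : ℕ) * x ^ (m % n - 1)) * heis (k : ℂ) (x ^ n) (conj x ^ n) (m / n) +
        n * x ^ (n - 1) * x ^ (m % n) * heisZ (k : ℂ) (x ^ n) (conj x ^ n) (m / n) +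
        k * (hpol n k m x * (n * x ^ (n - 1) / (x ^ n - conj x ^ n)) -
          conj (hpol n k m x) * ∑ l : Fin n, rt n l ^ (m % n) / (x - rt n l * conj x)))) := by
  have hr : m % n < n := Nat.mod_lt _ (by omega)
  set r := m % n with hrdef
  set j := m / n with hj
  have hZ := (hasDerivAt_line x ξ).fun_pow n
  have hW := (hasDerivAt_line_conj x ξ).fun_pow n
  have h1 := ((hasDerivAt_line x ξ).fun_pow r).mul (hasDerivAt_heis (k : ℂ) j hZ hW)
  rw [HasDunkl]
  simp only [Complex.ofReal_zero, zero_mul, add_zero] at h1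
  refine h1.congr_deriv ?_
  have hs : ∑ l : Fin n, (ξ - rt n l * conj ξ) / (x - rt n l * conj x) *
      (hpol n k m x - hpol n k m (rt n l * conj x)) =
      ξ * (hpol n k m x * (n * x ^ (n - 1) / (x ^ n - conj x ^ n)) -
          conj (hpol n k m x) * ∑ l : Fin n, rt n l ^ r / (x - rt n l * conj x)) -
        conj ξ * (hpol n k m x * (n * (x ^ 0 * conj x ^ (n - 1 - 0)) / (x ^ n - conj x ^ n)) -
          conj (hpol n k m x) * (n * (x ^ r * conj x ^ (n - 1 - r)) / (x ^ n - conj x ^ n))) := by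
    rw [← sum_inv_rt (by omega) hx, ← sum_rt_pow_div hx (i := 0) (by omega), ← sum_rt_pow_div hx hr]
    simp only [mul_sum, ← sum_sub_distrib]
    refine sum_congr rfl fun l _ => ?_
    rw [hpol_rt, ← hrdef]
    ring
  rw [hs]
  have hI := heisW_sub (k : ℂ) (x ^ n) (conj x ^ n) j
  have hd : x ^ n - conj x ^ n ≠ 0 := sub_ne_zero.2 hx
  have h2 : (n : ℂ) * conj x ^ (n - 1) * x ^ r * heisW (k : ℂ) (x ^ n) (conj x ^ n) j =
      k * (hpol n k m x * (n * (x ^ 0 * conj x ^ (n - 1 - 0)) / (x ^ n - conj x ^ n)) -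
          conj (hpol n k m x) * (n * (x ^ r * conj x ^ (n - 1 - r)) / (x ^ n - conj x ^ n))) := by
    rw [conj_hpol, hpol, ← hrdef, ← hj]
    have h3 : conj x ^ (n - 1) = conj x ^ r * conj x ^ (n - 1 - r) := by
      rw [← pow_add]; congr 1; omega
    rw [Nat.sub_zero, h3]
    field_simp
    linear_combination n * conj x ^ r * conj x ^ (n - 1 - r) * x ^ r * hI
  have e1 : hpol n k m x = x ^ r * heis (k : ℂ) (x ^ n) (conj x ^ n) j := rfl
  have e2 := conj_hpol n k m x
  linear_combination conj ξ * h2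

lemma hasDunkl_hpol_zero {n : ℕ} (k : ℝ) {x : ℂ} (ξ : ℂ) : HasDunkl n k (hpol n k 0) ξ x 0 := by
  have : hpol n k 0 = fun _ => 1 := funext fun x => hpol_zero n k x
  rw [HasDunkl, this]
  simpa using hasDerivAt_const (0 : ℝ) (1 : ℂ)

lemma hasDunkl_hpol_succ {n : ℕ} (hn : 2 ≤ n) {k : ℝ} (hk : 0 < k) (m : ℕ) {x : ℂ}
    (hx : x ^ n ≠ conj x ^ n) (ξ : ℂ) : HasDunkl n k (hpol n k (m + 1)) ξ x
      (ξ * (kapc n k (m + 1) * (m + 1 + n * k) * hpol n k m x)) := by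
  convert hasDunkl_hpol_aux hn k (m + 1) hx ξ using 2
  have hd : x ^ n - conj x ^ n ≠ 0 := sub_ne_zero.2 hx
  rw [kapc]
  split_ifs with h
  · obtain ⟨q, hq⟩ := h
    obtain ⟨j, rfl⟩ : ∃ j, q = j + 1 := ⟨q - 1, by
      rcases q with _ | q
      · omega
      · simp⟩
    have hm : m = n - 1 + n * j := by
      rw [mul_add, mul_one] at hq; omega
    have h1 : (m + 1) % n = 0 := by rw [hq]; simp
    have h2 : (m + 1) / n = j + 1 := by rw [hq]; exact Nat.mul_div_cancel_left _ (by omega)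
    have h3 : m % n = n - 1 := by
      rw [hm, Nat.add_mul_mod_self_left, Nat.mod_eq_of_lt (by omega)]
    have h4 : m / n = j := by
      rw [hm, Nat.add_mul_div_left _ _ (by omega), Nat.div_eq_of_lt (by omega), zero_add]
    rw [conj_hpol, hpol, hpol, h1, h2, h3, h4]
    simp only [pow_zero, one_mul, Nat.cast_zero, zero_mul, zero_add, mul_one]
    rw [sum_inv_rt (by omega) hx]
    have h5 := heisZ_add_heisW (k : ℂ) (x ^ n) (conj x ^ n) j
    have h6 : (k : ℂ) + (j + 1) ≠ 0 := by
      have : 0 < k + (j + 1) := by positivity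
      exact_mod_cast this.ne'
    have hI := heisW_sub (k : ℂ) (x ^ n) (conj x ^ n) (j + 1)
    have h7 : (m : ℂ) + 1 = n * (j + 1) := by exact_mod_cast hq
    rw [h7]
    push_cast
    field_simp
    linear_combination (n * x ^ (n - 1) * (k + (j + 1))) * (-(x ^ n - conj x ^ n) * h5 + hI)
  · have h1 := mod_succ_of_not_dvd h
    have h2 : (m + 1) / n = m / n := by
      rw [Nat.succ_div, if_neg h]; simp
    have h3 : m % n < n - 1 := by
      have := Nat.mod_lt (m + 1) (show 0 < n by omega); omega
    rw [conj_hpol, hpol, hpol, h1, h2, sum_rt_pow_div hx (by omega)]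
    have h4 : (m : ℂ) = n * (m / n : ℕ) + (m % n : ℕ) := by exact_mod_cast (Nat.div_add_mod m n).symm
    set j := m / n
    set r := m % n
    have hI := heisW_sub (k : ℂ) (x ^ n) (conj x ^ n) j
    have hE := heis_euler (k : ℂ) (x ^ n) (conj x ^ n) j
    have e1 : x ^ (n - 1) * x ^ (r + 1) = x ^ n * x ^ r := by
      rw [← pow_add, ← pow_add]; congr 1; omega
    have e2 : conj x ^ (r + 1) * conj x ^ (n - 1 - r) = conj x ^ n := by
      rw [← pow_add]; congr 1; omega
    rw [h4]
    push_cast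
    have e3 : x ^ (r + 1) * heis (k : ℂ) (x ^ n) (conj x ^ n) j *
        (n * x ^ (n - 1) / (x ^ n - conj x ^ n)) - conj x ^ (r + 1) *
          heis (k : ℂ) (conj x ^ n) (x ^ n) j *
          (n * (x ^ r * conj x ^ (n - 1 - r)) / (x ^ n - conj x ^ n)) =
        n * x ^ r * (x ^ n * heis (k : ℂ) (x ^ n) (conj x ^ n) j -
          conj x ^ n * heis (k : ℂ) (conj x ^ n) (x ^ n) j) / (x ^ n - conj x ^ n) := by
      linear_combination n * heis (k : ℂ) (x ^ n) (conj x ^ n) j / (x ^ n - conj x ^ n) * e1 -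
        n * heis (k : ℂ) (conj x ^ n) (x ^ n) j * x ^ r / (x ^ n - conj x ^ n) * e2
    rw [e3, mul_assoc (n : ℂ) (x ^ (n - 1)), e1]
    field_simp
    linear_combination x ^ r * n * (-(x ^ n - conj x ^ n) * hE + conj x ^ n * hI)

end DihedralBessel
end

noncomputable section
namespace DihedralBessel
open PowerSeries Finset ComplexConjugate

section DunklCalculus

variable {n : ℕ} {k : ℝ} {g h : ℂ → ℂ} {ξ x v w : ℂ}

lemma HasDunkl.const_mul (hg : HasDunkl n k g ξ x v) (c : ℂ) :
    HasDunkl n k (fun x => c * g x) ξ x (c * v) := by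
  refine (HasDerivAt.const_mul c hg).congr_deriv ?_
  rw [mul_sub, mul_left_comm c, mul_sum]
  congr 2
  exact sum_congr rfl fun l _ => by ring

lemma HasDunkl.add (hg : HasDunkl n k g ξ x v) (hh : HasDunkl n k h ξ x w) :
    HasDunkl n k (fun x => g x + h x) ξ x (v + w) := by
  refine (HasDerivAt.fun_add hg hh).congr_deriv ?_
  rw [sub_add_sub_comm, ← mul_add, ← sum_add_distrib]
  congr 2
  exact sum_congr rfl fun l _ => by ring

lemma HasDunkl.sum {ι : Type*} {s : Finset ι} {g : ι → ℂ → ℂ} {v : ι → ℂ}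
    (hg : ∀ i ∈ s, HasDunkl n k (g i) ξ x (v i)) :
    HasDunkl n k (fun x => ∑ i ∈ s, g i x) ξ x (∑ i ∈ s, v i) := by
  refine (HasDerivAt.fun_sum hg).congr_deriv ?_
  rw [sum_sub_distrib, ← mul_sum, sum_comm]
  congr 2
  refine sum_congr rfl fun l _ => ?_
  rw [← mul_sum, sum_sub_distrib]

lemma conj_sub_rt (l : Fin n) (ξ : ℂ) :
    conj (ξ - rt n l * conj ξ) = -(conj (rt n l)) * (ξ - rt n l * conj ξ) := by
  have := rt_mul_conj n l
  simp only [map_sub, map_mul, Complex.conj_conj]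
  linear_combination (-conj ξ) * this

lemma HasDunkl.conj (hg : HasDunkl n k g ξ x v) :
    HasDunkl n k (fun x => conj (g x)) ξ x (conj v) := by
  have h1 := (Complex.conjCLE.toContinuousLinearMap.hasFDerivAt (x := g (x + ((0 : ℝ) : ℂ) * ξ))).comp_hasDerivAt
    (0 : ℝ) hg
  refine h1.congr_deriv ?_
  simp only [ContinuousLinearEquiv.coe_coe, Complex.conjCLE_apply, map_sub, map_mul, map_sum,
    Complex.conj_ofReal, map_div₀]
  congr 2
  refine sum_congr rfl fun l _ => ?_
  have e1 := conj_sub_rt l ξ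
  have e2 := conj_sub_rt l x
  simp only [map_sub, map_mul, Complex.conj_conj] at e1 e2
  have hne : -(starRingEnd ℂ) (rt n l) ≠ 0 :=
    neg_ne_zero.2 ((map_ne_zero (starRingEnd ℂ)).2 (rt_ne_zero n l))
  rw [Complex.conj_conj, Complex.conj_conj, e1, e2, mul_div_mul_left _ _ hne]

lemma HasDunkl.normSq_mul (hg : HasDunkl n k g ξ x v) (i : ℕ) :
    HasDunkl n k (fun x => (x * (starRingEnd ℂ) x) ^ i * g x) ξ x
      ((x * (starRingEnd ℂ) x) ^ i * v + i * (x * (starRingEnd ℂ) x) ^ (i - 1) *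
        (ξ * (starRingEnd ℂ) x + x * (starRingEnd ℂ) ξ) * g x) := by
  have h1 := (((hasDerivAt_line x ξ).fun_mul (hasDerivAt_line_conj x ξ)).fun_pow i).fun_mul hg
  refine h1.congr_deriv ?_
  have hs : ∀ l : Fin n, rt n l * (starRingEnd ℂ) x * (starRingEnd ℂ) (rt n l * (starRingEnd ℂ) x) =
      x * (starRingEnd ℂ) x := by
    intro l
    rw [map_mul, Complex.conj_conj]
    linear_combination (x * (starRingEnd ℂ) x) * rt_mul_conj n l
  simp only [hs, ← mul_sub, Complex.ofReal_zero, zero_mul, add_zero]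
  have : ∀ l : Fin n, (ξ - rt n l * (starRingEnd ℂ) ξ) / (x - rt n l * (starRingEnd ℂ) x) *
      ((x * (starRingEnd ℂ) x) ^ i * (g x - g (rt n l * (starRingEnd ℂ) x))) =
      (x * (starRingEnd ℂ) x) ^ i * ((ξ - rt n l * (starRingEnd ℂ) ξ) /
        (x - rt n l * (starRingEnd ℂ) x) * (g x - g (rt n l * (starRingEnd ℂ) x))) := fun l => by ring
  rw [sum_congr rfl fun l _ => this l, ← mul_sum]
  ring

end DunklCalculus

/-- The coefficients, depending on the spectral variable, of the Dunkl kernel. -/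
def useq (n : ℕ) (k : ℝ) (y : ℂ) : ℕ → ℂ
  | 0 => 1 / 2
  | m + 1 => conj y / 2 * (useq n k y m + epsc n k m * conj (useq n k y m)) / kapc n k (m + 1)

/-- The Bessel type coefficients. -/
def acoef (n : ℕ) (k : ℝ) (y : ℂ) (m i : ℕ) : ℝ :=
  (Complex.normSq y / 4) ^ i / (i.factorial * pch (n * k + 1) (m + i))

lemma pch_pos {a : ℝ} (ha : 0 < a) (j : ℕ) : 0 < pch a j := by
  induction j with
  | zero => simp
  | succ j ih => rw [pch_succ]; positivity

/-- The twisted coefficient `U + ε conj U`. -/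
def useq' (n : ℕ) (k : ℝ) (y : ℂ) (m : ℕ) : ℂ := useq n k y m + epsc n k m * conj (useq n k y m)

lemma kapc_mul_useq_succ (n : ℕ) {k : ℝ} (hk : 0 < k) (y : ℂ) (m : ℕ) :
    kapc n k (m + 1) * useq n k y (m + 1) = conj y / 2 * useq' n k y m := by
  have : (kapc n k (m + 1) : ℂ) ≠ 0 := by exact_mod_cast (kapc_pos n hk _).ne'
  rw [useq, useq']; field_simp

lemma acoef_succ_left (n : ℕ) {k : ℝ} (hk : 0 < k) (y : ℂ) (m i : ℕ) :
    acoef n k y (m + 1) i * (m + 1 + n * k + i) = acoef n k y m i := by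
  have h1 := (pch_pos (show 0 < n * k + 1 by positivity) (m + i)).ne'
  have h2 : (n * k + 1 + ((m + i : ℕ) : ℝ)) ≠ 0 := by positivity
  rw [acoef, acoef, show m + 1 + i = (m + i) + 1 by ring, pch_succ]
  push_cast at h2 ⊢
  field_simp
  ring

lemma acoef_succ_right (n : ℕ) (k : ℝ) (y : ℂ) (m i : ℕ) :
    acoef n k y m (i + 1) * (i + 1) = Complex.normSq y / 4 * acoef n k y (m + 1) i := by
  have h2 : ((i : ℝ) + 1) ≠ 0 := by positivity
  rw [acoef, acoef, show m + 1 + i = m + (i + 1) by ring, Nat.factorial_succ, pow_succ]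
  push_cast
  field_simp

/-- The summands of the Dunkl kernel. -/
def eterm (n : ℕ) (k : ℝ) (y : ℂ) (m i : ℕ) (x : ℂ) : ℂ :=
  acoef n k y m i * ((x * conj x) ^ i *
    (useq n k y m * hpol n k m x + conj (useq n k y m * hpol n k m x)))

lemma conj_eterm (n : ℕ) (k : ℝ) (y : ℂ) (m i : ℕ) (x : ℂ) :
    conj (eterm n k y m i x) = eterm n k y m i x := by
  simp only [eterm, map_mul, map_add, map_pow, Complex.conj_conj, Complex.conj_ofReal]
  ring

/-- The part of the Dunkl derivative of `eterm` proportional to the preceding polynomial. -/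
def aterm (n : ℕ) (k : ℝ) (y : ℂ) (m i : ℕ) (x : ℂ) : ℂ :=
  match m with
  | 0 => 0
  | m + 1 => acoef n k y m i * ((x * conj x) ^ i * (conj y / 2 * useq' n k y m * hpol n k m x))

/-- The part of the Dunkl derivative of `eterm` proportional to the following polynomial. -/
def bterm (n : ℕ) (k : ℝ) (y : ℂ) (m i : ℕ) (x : ℂ) : ℂ :=
  match i with
  | 0 => 0
  | i + 1 => (Complex.normSq y / 4 * acoef n k y (m + 1) i : ℝ) *
      ((x * conj x) ^ i * (conj x * conj (useq' n k y m * hpol n k m x)))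

lemma hasDunkl_eterm {n : ℕ} (hn : 2 ≤ n) {k : ℝ} (hk : 0 < k) (y : ℂ) (m i : ℕ) {x : ℂ}
    (hx : x ^ n ≠ conj x ^ n) (ξ : ℂ) :
    HasDunkl n k (eterm n k y m i) ξ x
      (ξ * (aterm n k y m i x + bterm n k y m i x) +
        conj (ξ * (aterm n k y m i x + bterm n k y m i x))) := by
  have key : ∀ q : ℂ, HasDunkl n k (hpol n k m) ξ x (ξ * q) →
      (acoef n k y m i * ((x * conj x) ^ i * (useq n k y m * q) + i * (x * conj x) ^ (i - 1) *
        (conj x * (useq n k y m * hpol n k m x + conj (useq n k y m * hpol n k m x)))) =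
          aterm n k y m i x + bterm n k y m i x) →
      HasDunkl n k (eterm n k y m i) ξ x
        (ξ * (aterm n k y m i x + bterm n k y m i x) +
          conj (ξ * (aterm n k y m i x + bterm n k y m i x))) := by
    intro q hq he
    have h1 := hq.const_mul (useq n k y m)
    have h2 := ((h1.add h1.conj).normSq_mul i).const_mul (acoef n k y m i : ℂ)
    refine Eq.mp (congrArg (HasDunkl n k (eterm n k y m i) ξ x) ?_) h2
    rw [← he]
    simp only [map_mul, map_add, map_pow, Complex.conj_conj, Complex.conj_ofReal, map_natCast]
    ring
  have hU : ∀ m, conj (useq' n k y m) = conj (useq n k y m) + epsc n k m * useq n k y m := by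
    intro m; simp [useq']
  have hb : ∀ m, (acoef n k y m i : ℂ) * (i * (x * conj x) ^ (i - 1) *
      (conj x * conj (useq' n k y m * hpol n k m x))) = bterm n k y m i x := by
    intro m
    cases i with
    | zero => simp [bterm]
    | succ i =>
      rw [bterm, ← acoef_succ_right, Nat.add_sub_cancel]; push_cast; ring
  cases m with
  | zero =>
    refine key 0 (by simpa using hasDunkl_hpol_zero k ξ) ?_
    rw [← hb, map_mul, map_mul, hU, aterm, epsc_zero n hk, hpol_zero]
    simp only [map_one, Complex.ofReal_one]; ring
  | succ m =>
    refine key _ (hasDunkl_hpol_succ hn hk m hx ξ) ?_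
    rw [← hb, aterm]
    have h1 := hpol_succ (by omega : n ≠ 0) hk m x
    have h2 := kapc_mul_useq_succ n hk y m
    have h3 : (acoef n k y (m + 1) i : ℂ) * (m + 1 + n * k + i) = acoef n k y m i := by
      exact_mod_cast acoef_succ_left n hk y m i
    have h4 : (i : ℂ) * (x * conj x) ^ (i - 1) * (x * conj x) = i * (x * conj x) ^ i := by
      cases i with
      | zero => simp
      | succ i => simp only [Nat.add_sub_cancel]; ring
    rw [map_mul, map_mul, hU, ← h2, ← h3]
    linear_combination (acoef n k y (m + 1) i * i * (x * conj x) ^ (i - 1) * conj x *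
      useq n k y (m + 1)) * h1 + acoef n k y (m + 1) i * useq n k y (m + 1) * kapc n k (m + 1) *
        hpol n k m x * h4

lemma aterm_add_bterm {n : ℕ} (hn : n ≠ 0) {k : ℝ} (hk : 0 < k) (y : ℂ) (m i : ℕ) (x : ℂ) :
    aterm n k y (m + 2) i x + bterm n k y m (i + 1) x = conj y / 2 * eterm n k y (m + 1) i x := by
  have h1 := congrArg conj (hpol_succ hn hk m x)
  have h2 := congrArg conj (kapc_mul_useq_succ n hk y m)
  simp only [map_mul, map_add, Complex.conj_conj, Complex.conj_ofReal, map_div₀, map_ofNat] at h1 h2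
  have h3 : (Complex.normSq y : ℂ) = y * conj y := (Complex.mul_conj y).symm
  simp only [aterm, bterm, eterm, useq', map_mul]
  push_cast
  rw [h3]
  simp only [useq'] at h2
  linear_combination (-(acoef n k y (m + 1) i * (x * conj x) ^ i * conj x * conj y / 2 * conj (hpol n k m x))) * h2
    - (acoef n k y (m + 1) i * (x * conj x) ^ i * conj y / 2 * conj (useq n k y (m + 1))) * h1

lemma aterm_one {n : ℕ} {k : ℝ} (hk : 0 < k) (y : ℂ) (i : ℕ) (x : ℂ) :
    aterm n k y 1 i x = conj y / 2 * eterm n k y 0 i x := by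
  simp only [aterm, eterm, useq', epsc_zero n hk, map_mul, hpol_zero]
  push_cast; simp only [map_one]; ring

/-- The homogeneous component of degree `N` of the Dunkl kernel. -/
def ecomp (n : ℕ) (k : ℝ) (y : ℂ) (N : ℕ) (x : ℂ) : ℂ :=
  ∑ i ∈ range (N / 2 + 1), eterm n k y (N - 2 * i) i x

lemma conj_ecomp (n : ℕ) (k : ℝ) (y : ℂ) (N : ℕ) (x : ℂ) :
    conj (ecomp n k y N x) = ecomp n k y N x := by
  simp [ecomp, map_sum, conj_eterm]

lemma sum_aterm_bterm {n : ℕ} (hn : n ≠ 0) {k : ℝ} (hk : 0 < k) (y : ℂ) (N : ℕ) (x : ℂ) :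
    ∑ i ∈ range ((N + 1) / 2 + 1), (aterm n k y (N + 1 - 2 * i) i x +
      bterm n k y (N + 1 - 2 * i) i x) = conj y / 2 * ecomp n k y N x := by
  rw [sum_add_distrib, ecomp, mul_sum, sum_range_succ' (fun i => bterm n k y (N + 1 - 2 * i) i x)]
  have hb0 : ∀ m, bterm n k y m 0 x = 0 := fun m => rfl
  have ha0 : ∀ i, aterm n k y 0 i x = 0 := fun m => rfl
  rw [hb0, add_zero]
  rcases Nat.even_or_odd' N with ⟨M, rfl | rfl⟩
  · rw [show (2 * M + 1) / 2 = M by omega, show 2 * M / 2 = M by omega, sum_range_succ,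
      sum_range_succ, add_right_comm, ← sum_add_distrib]
    congr 1
    · refine sum_congr rfl fun i hi => ?_
      have hi' := mem_range.1 hi
      rw [show 2 * M + 1 - 2 * i = (2 * M - 2 * i - 1) + 2 by omega,
        show 2 * M + 1 - 2 * (i + 1) = 2 * M - 2 * i - 1 by omega, aterm_add_bterm hn hk,
        show 2 * M - 2 * i - 1 + 1 = 2 * M - 2 * i by omega]
    · rw [show 2 * M + 1 - 2 * M = 1 by omega, show 2 * M - 2 * M = 0 by omega, aterm_one hk]
  · rw [show (2 * M + 1 + 1) / 2 = M + 1 by omega, show (2 * M + 1) / 2 = M by omega,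
      sum_range_succ, show 2 * M + 1 + 1 - 2 * (M + 1) = 0 by omega, ha0, add_zero,
      ← sum_add_distrib]
    refine sum_congr rfl fun i hi => ?_
    have hi' := mem_range.1 hi
    rw [show 2 * M + 1 + 1 - 2 * i = (2 * M - 2 * i) + 2 by omega,
      show 2 * M + 1 + 1 - 2 * (i + 1) = 2 * M - 2 * i by omega, aterm_add_bterm hn hk,
      show 2 * M - 2 * i + 1 = 2 * M + 1 - 2 * i by omega]

lemma ecomp_zero (n : ℕ) (k : ℝ) (y x : ℂ) : ecomp n k y 0 x = 1 := by
  simp [ecomp, eterm, acoef, useq, hpol_zero, map_ofNat]; norm_num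

lemma hasDunkl_ecomp_zero (n : ℕ) (k : ℝ) (y x ξ : ℂ) :
    HasDunkl n k (ecomp n k y 0) ξ x 0 := by
  rw [HasDunkl, show ecomp n k y 0 = fun _ => 1 from funext fun x => ecomp_zero n k y x]
  simpa using hasDerivAt_const (0 : ℝ) (1 : ℂ)

lemma hasDunkl_ecomp_succ {n : ℕ} (hn : 2 ≤ n) {k : ℝ} (hk : 0 < k) (y : ℂ) (N : ℕ) {x : ℂ}
    (hx : x ^ n ≠ conj x ^ n) (ξ : ℂ) :
    HasDunkl n k (ecomp n k y (N + 1)) ξ x ((inner ℝ ξ y : ℝ) * ecomp n k y N x) := by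
  have h := HasDunkl.sum (s := range ((N + 1) / 2 + 1)) fun i _ =>
    hasDunkl_eterm hn hk y (N + 1 - 2 * i) i hx ξ
  refine Eq.mp (congrArg (HasDunkl n k (ecomp n k y (N + 1)) ξ x) ?_) h
  rw [sum_add_distrib, ← map_sum, ← mul_sum, sum_aterm_bterm (by omega) hk, map_mul, map_mul,
    conj_ecomp, map_div₀, Complex.conj_conj, map_ofNat, Complex.inner]
  have : (((conj ξ * y).re : ℝ) : ℂ) = (conj ξ * y + conj (conj ξ * y)) / 2 := by
    rw [Complex.re_eq_add_conj]
  rw [mul_comm y, this, map_mul, Complex.conj_conj]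
  ring

end DihedralBessel
end

noncomputable section
namespace DihedralBessel
open PowerSeries Finset ComplexConjugate

/-- `g` is a homogeneous polynomial of degree `N` in `x` and `conj x` whose coefficients have
absolute values with sum at most `B`. -/
def HomForm (N : ℕ) (B : ℝ) (g : ℂ → ℂ) : Prop :=
  ∃ c : ℕ → ℂ, (∀ x, g x = ∑ a ∈ range (N + 1), c a * (x ^ a * conj x ^ (N - a))) ∧
    ∑ a ∈ range (N + 1), ‖c a‖ ≤ B

section HomForm

variable {N : ℕ} {B B' : ℝ} {g h : ℂ → ℂ}

lemma HomForm.mono (hg : HomForm N B g) (hB : B ≤ B') : HomForm N B' g := by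
  obtain ⟨c, h1, h2⟩ := hg
  exact ⟨c, h1, h2.trans hB⟩

lemma homForm_monomial (c : ℂ) {a b : ℕ} (hab : a + b = N) :
    HomForm N ‖c‖ (fun x => c * (x ^ a * conj x ^ b)) := by
  have ha : a ∈ range (N + 1) := mem_range.2 (by omega)
  refine ⟨fun i => if i = a then c else 0, fun x => ?_, ?_⟩
  · rw [sum_eq_single_of_mem a ha]
    · beta_reduce; rw [if_pos rfl, show N - a = b by omega]
    · intro i _ hi; beta_reduce; rw [if_neg hi, zero_mul]
  · rw [sum_eq_single_of_mem a ha]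
    · beta_reduce; rw [if_pos rfl]
    · intro i _ hi; beta_reduce; rw [if_neg hi, norm_zero]

lemma HomForm.sum {ι : Type*} {s : Finset ι} {g : ι → ℂ → ℂ} {B : ι → ℝ}
    (hg : ∀ i ∈ s, HomForm N (B i) (g i)) :
    HomForm N (∑ i ∈ s, B i) (fun x => ∑ i ∈ s, g i x) := by
  choose! c h1 h2 using hg
  refine ⟨fun a => ∑ i ∈ s, c i a, fun x => ?_, ?_⟩
  · simp only [sum_mul]
    rw [sum_comm]
    exact sum_congr rfl fun i hi => h1 i hi x
  · calc _ ≤ ∑ a ∈ range (N + 1), ∑ i ∈ s, ‖c i a‖ := sum_le_sum fun a _ => norm_sum_le _ _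
      _ = ∑ i ∈ s, ∑ a ∈ range (N + 1), ‖c i a‖ := sum_comm
      _ ≤ _ := sum_le_sum h2

lemma HomForm.add (hg : HomForm N B g) (hh : HomForm N B' h) :
    HomForm N (B + B') (fun x => g x + h x) := by
  obtain ⟨c, h1, h2⟩ := hg
  obtain ⟨d, h3, h4⟩ := hh
  refine ⟨fun a => c a + d a, fun x => ?_, ?_⟩
  · beta_reduce
    rw [h1, h3, ← sum_add_distrib]
    exact sum_congr rfl fun i _ => by ring
  · calc _ ≤ ∑ a ∈ range (N + 1), (‖c a‖ + ‖d a‖) := sum_le_sum fun a _ => norm_add_le _ _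
      _ ≤ _ := by rw [sum_add_distrib]; exact add_le_add h2 h4

lemma HomForm.conj (hg : HomForm N B g) : HomForm N B (fun x => conj (g x)) := by
  obtain ⟨c, h1, h2⟩ := hg
  refine ⟨fun a => (starRingEnd ℂ) (c (N - a)), fun x => ?_, ?_⟩
  · beta_reduce
    rw [h1, map_sum, ← sum_range_reflect]
    refine sum_congr rfl fun a ha => ?_
    have ha' := mem_range.1 ha
    rw [show N + 1 - 1 - a = N - a by omega, show N - (N - a) = a by omega]
    simp only [map_mul, map_pow, Complex.conj_conj]
    ring
  · rw [← sum_range_reflect] at h2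
    refine le_trans (le_of_eq (sum_congr rfl fun a ha => ?_)) h2
    rw [RCLike.norm_conj, show N + 1 - 1 - a = N - a by omega]

lemma HomForm.norm_le (hg : HomForm N B g) {x : ℂ} {R : ℝ} (hx : ‖x‖ ≤ R) :
    ‖g x‖ ≤ B * R ^ N := by
  obtain ⟨c, h1, h2⟩ := hg
  rw [h1]
  have hR : 0 ≤ R := (norm_nonneg x).trans hx
  calc _ ≤ ∑ a ∈ range (N + 1), ‖c a‖ * R ^ N := by
        refine norm_sum_le_of_le _ fun a ha => ?_
        have ha' := mem_range.1 ha
        rw [norm_mul, norm_mul, norm_pow, norm_pow, RCLike.norm_conj, ← pow_add,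
          show a + (N - a) = N by omega]
        gcongr
    _ ≤ _ := by rw [← sum_mul]; gcongr

lemma HomForm.hasDerivAt_line (hg : HomForm N B g) (x ξ : ℂ) (t : ℝ) {R : ℝ}
    (hx : ‖x + t * ξ‖ ≤ R) :
    ∃ d, HasDerivAt (fun s : ℝ => g (x + s * ξ)) d t ∧ ‖d‖ ≤ B * (N * R ^ (N - 1) * ‖ξ‖) := by
  obtain ⟨c, h1, h2⟩ := hg
  have hR : 0 ≤ R := (norm_nonneg _).trans hx
  have l1 : HasDerivAt (fun s : ℝ => x + s * ξ) ξ t := by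
    simpa using ((Complex.ofRealCLM.hasDerivAt (x := t)).mul_const ξ).const_add x
  have l2 : HasDerivAt (fun s : ℝ => (starRingEnd ℂ) (x + s * ξ)) ((starRingEnd ℂ) ξ) t := by
    simpa using ((Complex.ofRealCLM.hasDerivAt (x := t)).mul_const ((starRingEnd ℂ) ξ)).const_add
      ((starRingEnd ℂ) x)
  have hm := fun a => ((l1.fun_pow a).fun_mul (l2.fun_pow (N - a))).const_mul (c a)
  refine ⟨_, (HasDerivAt.fun_sum (u := range (N + 1)) fun a _ => hm a).congr_of_eventuallyEq
    (Filter.Eventually.of_forall fun s => h1 _), ?_⟩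
  calc _ ≤ ∑ a ∈ range (N + 1), ‖c a‖ * (N * R ^ (N - 1) * ‖ξ‖) := by
        refine norm_sum_le_of_le _ fun a ha => ?_
        have ha' := mem_range.1 ha
        rw [norm_mul]
        gcongr
        refine (norm_add_le _ _).trans ?_
        simp only [norm_mul, norm_pow, RCLike.norm_conj, RCLike.norm_natCast]
        have e1 : (a : ℝ) * ‖x + t * ξ‖ ^ (a - 1) * ‖ξ‖ * ‖x + t * ξ‖ ^ (N - a) ≤
            a * R ^ (N - 1) * ‖ξ‖ := by
          rcases Nat.eq_zero_or_pos a with h0 | h0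
          · simp [h0]
          · rw [show N - 1 = (a - 1) + (N - a) by omega, pow_add]
            calc _ = (a : ℝ) * (‖x + t * ξ‖ ^ (a - 1) * ‖x + t * ξ‖ ^ (N - a)) * ‖ξ‖ := by ring
              _ ≤ _ := by gcongr
        have e2 : ‖x + t * ξ‖ ^ a * ((N - a : ℕ) * ‖x + t * ξ‖ ^ (N - a - 1) * ‖ξ‖) ≤
            (N - a : ℕ) * R ^ (N - 1) * ‖ξ‖ := by
          rcases Nat.eq_zero_or_pos (N - a) with h0 | h0
          · simp [h0]
          · rw [show N - 1 = a + (N - a - 1) by omega, pow_add]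
            calc _ = ((N - a : ℕ) : ℝ) * (‖x + t * ξ‖ ^ a * ‖x + t * ξ‖ ^ (N - a - 1)) * ‖ξ‖ := by ring
              _ ≤ _ := by gcongr
        refine (add_le_add e1 e2).trans (le_of_eq ?_)
        have : (N : ℝ) = a + (N - a : ℕ) := by
          rw [← Nat.cast_add]; congr 1; omega
        rw [this]; ring
    _ ≤ _ := by
      rw [← sum_mul]; gcongr

/-- The multilinear map with diagonal `x ^ a * conj x ^ (N - a)`. -/
def monMulti (N a : ℕ) : ContinuousMultilinearMap ℝ (fun _ : Fin N => ℂ) ℂ :=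
  (ContinuousMultilinearMap.mkPiAlgebraFin ℝ N ℂ).compContinuousLinearMap fun i =>
    if (i : ℕ) < a then ContinuousLinearMap.id ℝ ℂ else Complex.conjCLE.toContinuousLinearMap

lemma monMulti_apply {N a : ℕ} (ha : a ≤ N) (x : ℂ) :
    monMulti N a (fun _ => x) = x ^ a * conj x ^ (N - a) := by
  have h : ∀ i : Fin N, (if (i : ℕ) < a then ContinuousLinearMap.id ℝ ℂ else
      Complex.conjCLE.toContinuousLinearMap) x = if (i : ℕ) < a then x else (starRingEnd ℂ) x := by
    intro i; split_ifs <;> simp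
  simp only [monMulti, ContinuousMultilinearMap.compContinuousLinearMap_apply, h,
    ContinuousMultilinearMap.mkPiAlgebraFin_apply, List.prod_ofFn]
  rw [Fin.prod_univ_eq_prod_range (fun i => if i < a then x else (starRingEnd ℂ) x) N,
    ← prod_range_mul_prod_Ico _ ha, prod_congr rfl fun i hi => if_pos (mem_range.1 hi),
    prod_congr rfl fun i hi => if_neg (not_lt.2 (mem_Ico.1 hi).1)]
  simp

lemma norm_monMulti_le (N a : ℕ) : ‖monMulti N a‖ ≤ 1 := by
  refine ContinuousMultilinearMap.opNorm_le_bound zero_le_one fun m => ?_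
  rw [one_mul]
  simp only [monMulti, ContinuousMultilinearMap.compContinuousLinearMap_apply,
    ContinuousMultilinearMap.mkPiAlgebraFin_apply, List.prod_ofFn, norm_prod]
  refine prod_le_prod (fun _ _ => norm_nonneg _) fun i _ => ?_
  split_ifs <;> simp

theorem analyticOnNhd_tsum_homForm {g : ℕ → ℂ → ℂ} {b : ℕ → ℝ} (hg : ∀ N, HomForm N (b N) (g N))
    (hb : ∀ R : ℝ, 0 ≤ R → Summable fun N => b N * R ^ N) :
    AnalyticOnNhd ℝ (fun x => ∑' N, g N x) Set.univ := by
  choose c h1 h2 using hg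
  let p : FormalMultilinearSeries ℝ ℂ ℂ := fun N => ∑ a ∈ range (N + 1), c N a • monMulti N a
  have hp : ∀ N, ‖p N‖ ≤ b N := by
    intro N
    refine (norm_sum_le_of_le _ fun a _ => ?_).trans (h2 N)
    rw [norm_smul]
    exact mul_le_of_le_one_right (norm_nonneg _) (norm_monMulti_le N a)
  have hr : p.radius = ⊤ := by
    refine p.radius_eq_top_of_summable_norm fun r => ?_
    refine Summable.of_nonneg_of_le (fun N => by positivity) (fun N => ?_) (hb r r.2)
    exact mul_le_mul_of_nonneg_right (hp N) (by positivity)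
  have hs : (fun x => ∑' N, g N x) = p.sum := by
    ext x
    rw [FormalMultilinearSeries.sum]
    congr 1; ext N
    rw [h1, show p N = ∑ a ∈ range (N + 1), c N a • monMulti N a from rfl,
      _root_.sum_apply]
    refine sum_congr rfl fun a ha => ?_
    rw [_root_.smul_apply, monMulti_apply (Nat.lt_succ_iff.1 (mem_range.1 ha)),
      smul_eq_mul]
  have h := (p.hasFPowerSeriesOnBall (by rw [hr]; simp)).analyticOnNhd
  rw [hs]
  intro x _
  exact h x (by rw [hr]; simp)

lemma summable_homForm {g : ℕ → ℂ → ℂ} {b : ℕ → ℝ} (hg : ∀ N, HomForm N (b N) (g N))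
    (hb : ∀ R : ℝ, 0 ≤ R → Summable fun N => b N * R ^ N) (x : ℂ) : Summable fun N => g N x :=
  Summable.of_norm_bounded (hb ‖x‖ (norm_nonneg x)) fun N => (hg N).norm_le le_rfl

lemma hasDerivAt_tsum_homForm {g : ℕ → ℂ → ℂ} {b : ℕ → ℝ} (hg : ∀ N, HomForm N (b N) (g N))
    (hb : ∀ R : ℝ, 0 ≤ R → Summable fun N => b N * R ^ N)
    (hb' : ∀ R : ℝ, 0 ≤ R → Summable fun N => b N * (N * R ^ (N - 1))) (x ξ : ℂ) {d : ℕ → ℂ}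
    (hd : ∀ N, HasDerivAt (fun t : ℝ => g N (x + t * ξ)) (d N) 0) :
    Summable d ∧ HasDerivAt (fun t : ℝ => ∑' N, g N (x + t * ξ)) (∑' N, d N) 0 := by
  set R := ‖x‖ + ‖ξ‖ with hR
  have hR0 : 0 ≤ R := by positivity
  have hball : ∀ t ∈ Set.Ioo (-1 : ℝ) 1, ‖x + t * ξ‖ ≤ R := by
    intro t ht
    refine (norm_add_le _ _).trans ?_
    rw [norm_mul, Complex.norm_real, hR]
    gcongr
    exact mul_le_of_le_one_left (norm_nonneg _) (abs_le.2 ⟨ht.1.le, ht.2.le⟩)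
  have h0 : (0 : ℝ) ∈ Set.Ioo (-1 : ℝ) 1 := by simp
  choose! d' hd1 hd2 using fun (N : ℕ) (t : ℝ) (ht : t ∈ Set.Ioo (-1 : ℝ) 1) =>
    (hg N).hasDerivAt_line x ξ t (hball t ht)
  have hdd : ∀ N, d N = d' N 0 := fun N => (hd N).unique (hd1 N 0 h0)
  have hu : Summable fun N => b N * (N * R ^ (N - 1) * ‖ξ‖) := by
    simpa [mul_assoc] using (hb' R hR0).mul_right ‖ξ‖
  refine ⟨?_, ?_⟩
  · refine Summable.of_norm_bounded hu fun N => ?_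
    rw [hdd]; exact hd2 N 0 h0
  · have := hasDerivAt_tsum_of_isPreconnected hu isOpen_Ioo isPreconnected_Ioo hd1 hd2 h0
      (by simpa using summable_homForm hg hb x) h0
    simpa [hdd] using this

end HomForm

end DihedralBessel
end

noncomputable section
namespace DihedralBessel
open PowerSeries Finset ComplexConjugate

lemma epsc_mem {n : ℕ} {k : ℝ} (hk : 0 < k) (m : ℕ) : 0 ≤ epsc n k m ∧ epsc n k m ≤ 1 := by
  rw [epsc]
  split_ifs
  · refine ⟨by positivity, (div_le_one (by positivity)).2 ?_⟩
    have : (0 : ℝ) ≤ (m / n : ℕ) := by positivity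
    linarith
  · simp

lemma one_le_kapc {n : ℕ} {k : ℝ} (hk : 0 < k) (m : ℕ) : 1 ≤ kapc n k m := by
  rw [kapc]
  split_ifs
  · rw [one_le_div (by positivity)]; linarith
  · exact le_rfl

lemma norm_useq_le (n : ℕ) {k : ℝ} (hk : 0 < k) (y : ℂ) (m : ℕ) : ‖useq n k y m‖ ≤ ‖y‖ ^ m := by
  induction m with
  | zero => simp [useq]; norm_num
  | succ m ih =>
    obtain ⟨h0, h1⟩ := epsc_mem (n := n) hk m
    rw [useq, norm_div, norm_mul, norm_div, RCLike.norm_conj, Complex.norm_real,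
      Real.norm_of_nonneg (kapc_pos n hk _).le]
    refine (div_le_self (by positivity) (one_le_kapc hk _)).trans ?_
    have h2 : ‖useq n k y m + epsc n k m * conj (useq n k y m)‖ ≤ 2 * ‖y‖ ^ m := by
      refine (norm_add_le _ _).trans ?_
      rw [norm_mul, RCLike.norm_conj, Complex.norm_real, Real.norm_of_nonneg h0]
      nlinarith [norm_nonneg (useq n k y m)]
    calc _ ≤ ‖y‖ / ‖(2 : ℂ)‖ * (2 * ‖y‖ ^ m) := by gcongr
      _ = _ := by rw [RCLike.norm_ofNat, pow_succ]; ring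

lemma factorial_le_pch {a : ℝ} (ha : 1 ≤ a) (j : ℕ) : (j.factorial : ℝ) ≤ pch a j := by
  induction j with
  | zero => simp
  | succ j ih =>
    rw [pch_succ, Nat.factorial_succ, mul_comm]
    push_cast
    have : (0 : ℝ) ≤ j := by positivity
    exact mul_le_mul ih (by linarith) (by positivity) (pch_pos (by linarith) j).le

lemma pch_div_factorial_le {a : ℝ} (ha : 1 ≤ a) (j : ℕ) : pch a j / j.factorial ≤ a ^ j := by
  induction j with
  | zero => simp
  | succ j ih =>
    have h : pch a (j + 1) / (j + 1).factorial = pch a j / j.factorial * ((a + j) / (j + 1)) := by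
      rw [pch_succ, Nat.factorial_succ]
      have := Nat.cast_ne_zero (R := ℝ).2 j.factorial_ne_zero
      push_cast; field_simp
    rw [h, pow_succ]
    have hj : (0 : ℝ) ≤ j := by positivity
    refine mul_le_mul ih ?_ (by positivity) (by positivity)
    rw [div_le_iff₀ (by positivity)]
    nlinarith

lemma ofReal_pch (a : ℝ) (m : ℕ) : ((pch a m : ℝ) : ℂ) = pch (a : ℂ) m := by
  induction m with
  | zero => simp
  | succ m ih => rw [pch_succ, pch_succ, ← ih]; push_cast; ring

lemma acoef_nonneg (n : ℕ) {k : ℝ} (hk : 0 < k) (y : ℂ) (m i : ℕ) : 0 ≤ acoef n k y m i := by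
  have := pch_pos (show 0 < n * k + 1 by positivity) (m + i)
  have := Complex.normSq_nonneg y
  rw [acoef]; positivity

lemma acoef_le (n : ℕ) {k : ℝ} (hk : 0 < k) (y : ℂ) (m i : ℕ) :
    acoef n k y m i ≤ ‖y‖ ^ (2 * i) * (2 ^ (m + 2 * i) / (m + 2 * i).factorial) := by
  have h1 := factorial_le_pch (show 1 ≤ n * k + 1 by have : 0 ≤ n * k := by positivity
                                                     linarith) (m + i)
  have h2 : ((m + 2 * i).factorial : ℝ) ≤ 2 ^ (m + 2 * i) * (i.factorial * (m + i).factorial) := by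
    have e := cast_choose_factorial i (m + i)
    have e2 := Nat.choose_le_two_pow (i + (m + i)) i
    rw [show i + (m + i) = m + 2 * i by ring] at e e2
    rw [mul_assoc] at e
    rw [← e]
    exact_mod_cast Nat.mul_le_mul_right _ e2
  have hp := pch_pos (show 0 < n * k + 1 by positivity) (m + i)
  rw [acoef, Complex.normSq_eq_norm_sq, div_eq_mul_inv]
  refine mul_le_mul ?_ ?_ (by positivity) (by positivity)
  · rw [pow_mul]
    gcongr
    have := sq_nonneg ‖y‖
    linarith
  · rw [inv_eq_one_div, div_le_div_iff₀ (by positivity) (by positivity), one_mul]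
    refine h2.trans ?_
    gcongr

lemma homForm_hpol_mul (n : ℕ) {k : ℝ} (hk : 0 < k) (m i : ℕ) (c : ℂ) :
    HomForm (m + 2 * i) (‖c‖ * (2 * k + 1) ^ m)
      (fun x => c * ((x * conj x) ^ i * hpol n k m x)) := by
  have h : ∀ x : ℂ, c * ((x * conj x) ^ i * hpol n k m x) = ∑ p ∈ antidiagonal (m / n),
      (c * (((pch (k + 1) p.1 / p.1.factorial * (pch k p.2 / p.2.factorial) : ℝ)) : ℂ)) *
        (x ^ (i + m % n + n * p.1) * conj x ^ (i + n * p.2)) := by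
    intro x
    rw [hpol, heis, heisGen, coeff_mul, mul_sum, mul_sum, mul_sum]
    refine sum_congr rfl fun p _ => ?_
    rw [opow_C_mul_X, opow_C_mul_X, coeff_mk, coeff_mk]
    push_cast
    rw [ofReal_pch, ofReal_pch]
    push_cast
    ring
  have h2 := HomForm.sum (N := m + 2 * i) (s := antidiagonal (m / n))
    (g := fun p x => (c * (((pch (k + 1) p.1 / p.1.factorial * (pch k p.2 / p.2.factorial) : ℝ)) : ℂ)) *
        (x ^ (i + m % n + n * p.1) * conj x ^ (i + n * p.2))) fun p hp => homForm_monomial _ (by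
      have e1 : p.1 + p.2 = m / n := by simpa using hp
      have e2 := Nat.div_add_mod m n
      rw [← e1, mul_add] at e2
      omega)
  rw [show (fun x => c * ((x * conj x) ^ i * hpol n k m x)) = _ from funext h]
  refine h2.mono ?_
  simp only [norm_mul, Complex.norm_real]
  rw [← mul_sum]
  gcongr
  have e : ∀ p ∈ antidiagonal (m / n), ‖pch (k + 1) p.1 / p.1.factorial‖ * ‖pch k p.2 / p.2.factorial‖ =
      pch (k + 1) p.1 / p.1.factorial * (pch k p.2 / p.2.factorial) := by
    intro p _
    have e1 := pch_pos (show 0 < k + 1 by positivity) p.1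
    have e2 := pch_pos hk p.2
    rw [Real.norm_of_nonneg (by positivity), Real.norm_of_nonneg (by positivity)]
  rw [sum_congr rfl e, pch_vandermonde, show k + 1 + k = 2 * k + 1 by ring]
  refine (pch_div_factorial_le (by linarith) _).trans ?_
  exact pow_le_pow_right₀ (by linarith) (Nat.div_le_self m n)

lemma homForm_ecomp (n : ℕ) {k : ℝ} (hk : 0 < k) (y : ℂ) (N : ℕ) :
    HomForm N (2 * (4 * (2 * k + 1) * ‖y‖) ^ N / N.factorial) (ecomp n k y N) := by
  have h1 : ∀ i ∈ range (N / 2 + 1), HomForm N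
      (2 * (2 * (2 * k + 1) * ‖y‖) ^ N / N.factorial) (eterm n k y (N - 2 * i) i) := by
    intro i hi
    have hi' := mem_range.1 hi
    obtain ⟨m, rfl⟩ : ∃ m, N = m + 2 * i := ⟨N - 2 * i, by omega⟩
    rw [Nat.add_sub_cancel]
    have h := homForm_hpol_mul n hk m i (acoef n k y m i * useq n k y m)
    have h2 := h.add h.conj
    have e : eterm n k y m i = fun x => acoef n k y m i * useq n k y m * ((x * conj x) ^ i * hpol n k m x) +
        conj (acoef n k y m i * useq n k y m * ((x * conj x) ^ i * hpol n k m x)) := by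
      ext x
      simp only [eterm, map_mul, map_pow, Complex.conj_conj, Complex.conj_ofReal]
      ring
    rw [e]
    refine h2.mono ?_
    rw [← two_mul, norm_mul, Complex.norm_real, Real.norm_of_nonneg (acoef_nonneg n hk y m i)]
    have h3 := acoef_le n hk y m i
    have h4 := norm_useq_le n hk y m
    have h5 : (2 * k + 1) ^ m ≤ (2 * k + 1) ^ (m + 2 * i) := pow_le_pow_right₀ (by linarith) (by omega)
    have h6 := acoef_nonneg n hk y m i
    calc _ ≤ 2 * ((‖y‖ ^ (2 * i) * (2 ^ (m + 2 * i) / (m + 2 * i).factorial)) * ‖y‖ ^ m *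
        (2 * k + 1) ^ (m + 2 * i)) := by gcongr
      _ = _ := by rw [mul_pow, mul_pow, pow_add ‖y‖]; ring
  have h2 := HomForm.sum h1
  refine HomForm.mono (g := ecomp n k y N) h2 ?_
  rw [sum_const, card_range, nsmul_eq_mul]
  have h3 : ((N / 2 + 1 : ℕ) : ℝ) ≤ 2 ^ N := by
    have : N / 2 + 1 ≤ 2 ^ N := by
      have := Nat.lt_two_pow_self (n := N)
      omega
    exact_mod_cast this
  calc _ ≤ 2 ^ N * (2 * (2 * (2 * k + 1) * ‖y‖) ^ N / N.factorial) := by gcongr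
    _ = _ := by
      rw [show 4 * (2 * k + 1) * ‖y‖ = 2 * (2 * (2 * k + 1) * ‖y‖) by ring, mul_pow 2]; ring

lemma summable_bound (M R : ℝ) : Summable fun N : ℕ => 2 * M ^ N / N.factorial * R ^ N := by
  have := (Real.summable_pow_div_factorial (M * R)).mul_left 2
  refine this.congr fun N => ?_
  rw [mul_pow]; ring

lemma summable_bound' (M R : ℝ) :
    Summable fun N : ℕ => 2 * M ^ N / N.factorial * (N * R ^ (N - 1)) := by
  rw [← summable_nat_add_iff 1]
  have := (Real.summable_pow_div_factorial (M * R)).mul_left (2 * M)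
  refine this.congr fun N => ?_
  have h1 := Nat.cast_ne_zero (R := ℝ).2 N.factorial_ne_zero
  have h2 : (N : ℝ) + 1 ≠ 0 := by positivity
  rw [mul_pow, Nat.factorial_succ, Nat.add_sub_cancel, pow_succ]
  push_cast; field_simp

/-- The explicit Dunkl kernel. -/
def ekernel (n : ℕ) (k : ℝ) (y x : ℂ) : ℝ := (∑' N, ecomp n k y N x).re

lemma summable_ecomp (n : ℕ) {k : ℝ} (hk : 0 < k) (y x : ℂ) : Summable fun N => ecomp n k y N x :=
  summable_homForm (fun N => homForm_ecomp n hk y N) (fun R _ => summable_bound _ R) x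

lemma analyticOnNhd_ekernel (n : ℕ) {k : ℝ} (hk : 0 < k) (y : ℂ) :
    AnalyticOnNhd ℝ (ekernel n k y) Set.univ := by
  have h := analyticOnNhd_tsum_homForm (fun N => homForm_ecomp n hk y N)
    (fun R _ => summable_bound _ R)
  exact (Complex.reCLM.analyticOnNhd Set.univ).comp h (fun _ _ => Set.mem_univ _)

lemma ekernel_zero (n : ℕ) {k : ℝ} (hk : 0 < k) (y : ℂ) : ekernel n k y 0 = 1 := by
  rw [ekernel, tsum_eq_single 0]
  · rw [ecomp_zero, Complex.one_re]
  · intro N hN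
    have := (homForm_ecomp n hk y N).norm_le (x := 0) (R := 0) (by simp)
    rw [zero_pow hN, mul_zero] at this
    exact norm_le_zero_iff.1 this

/-- The eigenvalue equation in the direction `ξ` at a regular point, for complex sums. -/
lemma hasDunkl_tsum {n : ℕ} (hn : 2 ≤ n) {k : ℝ} (hk : 0 < k) (y : ℂ) {x : ℂ}
    (hx : x ^ n ≠ conj x ^ n) (ξ : ℂ) :
    HasDunkl n k (fun x => ∑' N, ecomp n k y N x) ξ x
      ((inner ℝ ξ y : ℝ) * ∑' N, ecomp n k y N x) := by
  let v : ℕ → ℂ := fun N => match N with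
    | 0 => 0
    | N + 1 => (inner ℝ ξ y : ℝ) * ecomp n k y N x
  have hv : ∀ N, HasDunkl n k (ecomp n k y N) ξ x (v N) := by
    intro N
    cases N with
    | zero => exact hasDunkl_ecomp_zero n k y x ξ
    | succ N => exact hasDunkl_ecomp_succ hn hk y N hx ξ
  have hS := summable_ecomp n hk y
  have h := hasDerivAt_tsum_homForm (fun N => homForm_ecomp n hk y N)
    (fun R _ => summable_bound _ R) (fun R _ => summable_bound' _ R) x ξ hv
  refine h.2.congr_deriv ?_
  have hvs : HasSum v ((inner ℝ ξ y : ℝ) * ∑' N, ecomp n k y N x) := by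
    rw [← hasSum_nat_add_iff' 1]
    simpa [v] using (hS x).hasSum.mul_left ((inner ℝ ξ y : ℝ) : ℂ)
  have hds : HasSum (fun N => (k : ℂ) * ∑ l : Fin n, (ξ - rt n l * conj ξ) / (x - rt n l * conj x) *
      (ecomp n k y N x - ecomp n k y N (rt n l * conj x)))
      (k * ∑ l : Fin n, (ξ - rt n l * conj ξ) / (x - rt n l * conj x) *
      ((∑' N, ecomp n k y N x) - ∑' N, ecomp n k y N (rt n l * conj x))) := by
    refine (hasSum_sum fun l _ => ?_).mul_left _
    exact ((hS x).hasSum.sub (hS _).hasSum).mul_left _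
  exact (hvs.sub hds).tsum_eq

end DihedralBessel
end

noncomputable section
namespace DihedralBessel
open Finset ComplexConjugate Filter Topology

section Geometry

variable {n : ℕ}

lemma posRoot_sq (l : Fin n) : posRoot n l ^ 2 = -rt n l := by
  rw [posRoot, rt, mul_pow, ← Complex.exp_nat_mul, ← Complex.exp_nat_mul, neg_sq, Complex.I_sq,
    neg_one_mul]
  congr 2
  push_cast; ring

lemma norm_posRoot (l : Fin n) : ‖posRoot n l‖ = 1 := by
  rw [posRoot, norm_mul, norm_neg, Complex.norm_I, one_mul, mul_comm, Complex.norm_exp_ofReal_mul_I]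

lemma posRoot_mul_conj (l : Fin n) : posRoot n l * conj (posRoot n l) = 1 := by
  rw [Complex.mul_conj, Complex.normSq_eq_norm_sq, norm_posRoot]; simp

lemma two_inner_posRoot (l : Fin n) (x : ℂ) :
    ((2 * inner ℝ (posRoot n l) x : ℝ) : ℂ) = conj (posRoot n l) * (x - rt n l * conj x) := by
  have h1 := posRoot_sq l
  have h2 := posRoot_mul_conj l
  rw [Complex.inner]
  push_cast
  rw [Complex.re_eq_add_conj, map_mul, Complex.conj_conj]
  linear_combination (-conj x * posRoot n l) * h2 + conj (posRoot n l) * conj x * h1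

lemma reflect_posRoot (l : Fin n) (x : ℂ) : reflect (posRoot n l) x = rt n l * conj x := by
  rw [reflect, Complex.real_smul, two_inner_posRoot]
  linear_combination (-(x - rt n l * conj x)) * posRoot_mul_conj l

lemma inner_posRoot_eq_zero_iff (l : Fin n) (x : ℂ) :
    (inner ℝ (posRoot n l) x : ℝ) = 0 ↔ x - rt n l * conj x = 0 := by
  have h := two_inner_posRoot l x
  have h1 : conj (posRoot n l) ≠ 0 := right_ne_zero_of_mul_eq_one (posRoot_mul_conj l)
  constructor
  · intro h0
    rw [h0] at h
    simpa [h1] using h.symm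
  · intro h0
    rw [h0, mul_zero, Complex.ofReal_eq_zero] at h
    linarith

lemma inner_posRoot_div (l : Fin n) (ξ x : ℂ) :
    ((inner ℝ (posRoot n l) ξ / inner ℝ (posRoot n l) x : ℝ) : ℂ) =
      (ξ - rt n l * conj ξ) / (x - rt n l * conj x) := by
  have h1 : conj (posRoot n l) ≠ 0 := right_ne_zero_of_mul_eq_one (posRoot_mul_conj l)
  rw [← mul_div_mul_left _ _ h1, ← two_inner_posRoot, ← two_inner_posRoot, ← Complex.ofReal_div,
    mul_div_mul_left _ _ two_ne_zero]

lemma norm_reflect_posRoot (l : Fin n) (x : ℂ) : ‖reflect (posRoot n l) x‖ = ‖x‖ := by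
  rw [reflect_posRoot, norm_mul, norm_rt, RCLike.norm_conj, one_mul]

end Geometry

lemma fderiv_apply_eq_of_line {f : ℂ → ℝ} {x ξ : ℂ} {d : ℝ} (hf : DifferentiableAt ℝ f x)
    (h : HasDerivAt (fun t : ℝ => f (x + t * ξ)) d 0) : fderiv ℝ f x ξ = d := by
  have h1 : HasFDerivAt f (fderiv ℝ f x) (x + ((0 : ℝ) : ℂ) * ξ) := by simpa using hf.hasFDerivAt
  exact (h1.comp_hasDerivAt (0 : ℝ) (hasDerivAt_line x ξ)).unique h

lemma differentiable_ekernel (n : ℕ) {k : ℝ} (hk : 0 < k) (y : ℂ) :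
    Differentiable ℝ (ekernel n k y) := fun x =>
  (analyticOnNhd_ekernel n hk y x (Set.mem_univ x)).differentiableAt

lemma dunklOp_ekernel_of_regular {n : ℕ} (hn : 2 ≤ n) {k : ℝ} (hk : 0 < k) (y : ℂ) {x : ℂ}
    (hx : x ^ n ≠ conj x ^ n) (ξ : ℂ) :
    dunklOp n k ξ (ekernel n k y) x = inner ℝ ξ y * ekernel n k y x := by
  have h := hasDunkl_tsum hn hk y hx ξ
  have h1 := Complex.reCLM.hasFDerivAt.comp_hasDerivAt (0 : ℝ) h
  rw [dunklOp, fderiv_apply_eq_of_line (differentiable_ekernel n hk y x) h1, Complex.reCLM_apply,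
    Complex.sub_re, Complex.re_ofReal_mul, Complex.re_ofReal_mul, Complex.re_sum]
  have h2 : ∑ s : Fin n, inner ℝ (posRoot n s) ξ * diffQuot (posRoot n s) (ekernel n k y) x =
      ∑ l : Fin n, ((ξ - rt n l * conj ξ) / (x - rt n l * conj x) *
        ((∑' N, ecomp n k y N x) - ∑' N, ecomp n k y N (rt n l * conj x))).re := by
    refine sum_congr rfl fun l _ => ?_
    have h3 : (inner ℝ (posRoot n l) x : ℝ) ≠ 0 := fun h0 =>
      sub_rt_mul_ne_zero hx l ((inner_posRoot_eq_zero_iff l x).1 h0)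
    rw [diffQuot, if_neg h3, ← inner_posRoot_div, Complex.re_ofReal_mul, Complex.sub_re,
      reflect_posRoot, ekernel, ekernel]
    ring
  rw [h2, ekernel]
  ring

lemma dense_regular {n : ℕ} (hn : n ≠ 0) : Dense {x : ℂ | x ^ n ≠ conj x ^ n} := by
  intro x0
  by_contra hx0
  rw [mem_closure_iff_frequently, not_frequently] at hx0
  have ha : AnalyticOnNhd ℝ (fun x : ℂ => x ^ n - conj x ^ n) Set.univ := by
    have h1 : AnalyticOnNhd ℝ (fun x : ℂ => x) Set.univ := analyticOnNhd_id
    have h2 : AnalyticOnNhd ℝ (fun x : ℂ => conj x) Set.univ :=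
      Complex.conjCLE.toContinuousLinearMap.analyticOnNhd Set.univ
    exact AnalyticOnNhd.sub (h1.fun_pow n) (h2.fun_pow n)
  have hz : (fun x : ℂ => x ^ n - conj x ^ n) =ᶠ[𝓝 x0] 0 := by
    filter_upwards [hx0] with x hx
    simpa [sub_eq_zero] using hx
  have h0 := ha.eqOn_zero_of_preconnected_of_eventuallyEq_zero isPreconnected_univ
    (Set.mem_univ x0) hz (Set.mem_univ (Complex.exp ((Real.pi / (2 * n) : ℝ) * Complex.I)))
  have h1 : Complex.exp ((Real.pi / (2 * n) : ℝ) * Complex.I) ^ n = Complex.I := by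
    have hn' : (n : ℂ) ≠ 0 := Nat.cast_ne_zero.2 hn
    rw [← Complex.exp_nat_mul, show (n : ℂ) * ((Real.pi / (2 * n) : ℝ) * Complex.I) =
      Real.pi / 2 * Complex.I by push_cast; field_simp, Complex.exp_pi_div_two_mul_I]
  simp only [← map_pow, h1, Complex.conj_I, Pi.zero_apply] at h0
  have := congrArg Complex.im h0
  norm_num at this

lemma tendsto_diffQuot {f : ℂ → ℝ} (hf : ContDiff ℝ 1 f) {n : ℕ} (l : Fin n) (x0 : ℂ) :
    Tendsto (diffQuot (posRoot n l) f) (𝓝[{x | x ^ n ≠ conj x ^ n}] x0)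
      (𝓝 (diffQuot (posRoot n l) f x0)) := by
  set a := posRoot n l with ha
  have hcont : Continuous fun x : ℂ => (inner ℝ a x : ℝ) := continuous_const.inner continuous_id
  have hrefl : Continuous (reflect a) := by
    unfold reflect
    exact continuous_id.sub ((continuous_const.mul hcont).smul continuous_const)
  have hreg : ∀ᶠ x in 𝓝[{x | x ^ n ≠ conj x ^ n}] x0, (inner ℝ a x : ℝ) ≠ 0 := by
    filter_upwards [self_mem_nhdsWithin] with x hx h0
    exact sub_rt_mul_ne_zero hx l ((inner_posRoot_eq_zero_iff l x).1 h0)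
  have heq : ∀ᶠ x in 𝓝[{x | x ^ n ≠ conj x ^ n}] x0,
      (f x - f (reflect a x)) / inner ℝ a x = diffQuot a f x := by
    filter_upwards [hreg] with x hx
    rw [diffQuot, if_neg hx]
  refine Tendsto.congr' heq ?_
  by_cases h0 : (inner ℝ a x0 : ℝ) = 0
  · rw [diffQuot, if_pos h0]
    have hs : HasStrictFDerivAt f (fderiv ℝ f x0) x0 :=
      hf.contDiffAt.hasStrictFDerivAt one_ne_zero
    have hr0 : reflect a x0 = x0 := by rw [reflect, h0]; simp
    have ht : Tendsto (fun x => (x, reflect a x)) (𝓝[{x | x ^ n ≠ conj x ^ n}] x0)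
        (𝓝 (x0, x0)) := by
      refine tendsto_nhdsWithin_of_tendsto_nhds ?_
      have := (continuous_id.prodMk hrefl).tendsto x0
      simpa [hr0] using this
    have ho := hs.isLittleO.comp_tendsto ht
    have hd : ∀ x, x - reflect a x = (2 * inner ℝ a x : ℝ) • a := by
      intro x; rw [reflect]; simp
    have ho2 : (fun x => f x - f (reflect a x) - inner ℝ a x * (2 * fderiv ℝ f x0 a))
        =o[𝓝[{x | x ^ n ≠ conj x ^ n}] x0] fun x => (inner ℝ a x : ℝ) := by
      refine (ho.congr_left fun x => ?_).trans_isBigO ?_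
      · simp only [Function.comp, hd, map_smul, smul_eq_mul]; ring
      · refine Asymptotics.IsBigO.of_bound 2 (Eventually.of_forall fun x => ?_)
        show ‖x - reflect a x‖ ≤ _
        rw [hd, norm_smul, ha, norm_posRoot, mul_one, norm_mul, Real.norm_two]
    have h3 := ho2.tendsto_div_nhds_zero.add_const (2 * fderiv ℝ f x0 a)
    rw [zero_add] at h3
    refine h3.congr' ?_
    filter_upwards [hreg] with x hx
    field_simp
    ring
  · rw [diffQuot, if_neg h0]
    refine tendsto_nhdsWithin_of_tendsto_nhds ?_
    exact ((hf.continuous.tendsto x0).sub ((hf.continuous.comp hrefl).tendsto x0)).div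
      (hcont.tendsto x0) h0

theorem isDunklEigenfunction_ekernel {n : ℕ} (hn : 2 ≤ n) {k : ℝ} (hk : 0 < k) (y : ℂ) :
    IsDunklEigenfunction n k y (ekernel n k y) := by
  have han := analyticOnNhd_ekernel n hk y
  refine ⟨han, fun ξ x0 => ?_, ekernel_zero n hk y⟩
  have hf : ContDiff ℝ 1 (ekernel n k y) := by
    rw [← contDiffOn_univ]; exact han.contDiffOn uniqueDiffOn_univ
  have : (𝓝[{x : ℂ | x ^ n ≠ conj x ^ n}] x0).NeBot :=
    mem_closure_iff_nhdsWithin_neBot.1 (dense_regular (by omega) x0)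
  have h1 : Tendsto (dunklOp n k ξ (ekernel n k y)) (𝓝[{x | x ^ n ≠ conj x ^ n}] x0)
      (𝓝 (dunklOp n k ξ (ekernel n k y) x0)) := by
    unfold dunklOp
    refine Tendsto.add ?_ (Tendsto.const_mul _ (tendsto_finsetSum _ fun l _ =>
      (tendsto_diffQuot hf l x0).const_mul _))
    refine tendsto_nhdsWithin_of_tendsto_nhds ?_
    exact ((hf.continuous_fderiv one_ne_zero).clm_apply continuous_const).tendsto x0
  have h2 : Tendsto (fun x => (inner ℝ ξ y : ℝ) * ekernel n k y x) (𝓝[{x | x ^ n ≠ conj x ^ n}] x0)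
      (𝓝 (inner ℝ ξ y * ekernel n k y x0)) :=
    tendsto_nhdsWithin_of_tendsto_nhds ((hf.continuous.tendsto x0).const_mul _)
  refine tendsto_nhds_unique h1 (h2.congr' ?_)
  filter_upwards [self_mem_nhdsWithin] with x hx
  exact (dunklOp_ekernel_of_regular hn hk y hx ξ).symm

lemma IsDunklEigenfunction.euler {n : ℕ} {k : ℝ} {y : ℂ} {f : ℂ → ℝ}
    (hf : IsDunklEigenfunction n k y f) (x : ℂ) :
    fderiv ℝ f x x = inner ℝ x y * f x - k * ∑ l : Fin n, (f x - f (reflect (posRoot n l) x)) := by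
  rw [← hf.eigen x x, dunklOp]
  have : ∀ l : Fin n, inner ℝ (posRoot n l) x * diffQuot (posRoot n l) f x =
      f x - f (reflect (posRoot n l) x) := by
    intro l
    rw [diffQuot]
    split_ifs with h
    · rw [h, zero_mul, reflect, h]; simp
    · field_simp
  rw [sum_congr rfl fun l _ => this l]; ring

/-- The maximum principle behind the uniqueness of the Dunkl kernel. -/
lemma nonpos_of_euler {n : ℕ} {k : ℝ} (hk : 0 ≤ k) {y : ℂ} {g : ℂ → ℝ} (hg : Differentiable ℝ g)
    (h0 : g 0 = 0) (he : ∀ x, fderiv ℝ g x x =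
      inner ℝ x y * g x - k * ∑ l : Fin n, (g x - g (reflect (posRoot n l) x))) (x1 : ℂ) :
    g x1 ≤ 0 := by
  by_contra! hx1
  set c := ‖y‖ + 1 with hc
  let h : ℂ → ℝ := fun x => Real.exp (-(c * ‖x‖)) * g x
  have hcont : Continuous h := by
    have := hg.continuous
    fun_prop
  obtain ⟨x0, hx0, hmax⟩ := (isCompact_closedBall (0 : ℂ) ‖x1‖).exists_isMaxOn
    ⟨x1, by simp⟩ hcont.continuousOn
  have hx0' : ‖x0‖ ≤ ‖x1‖ := by simpa using hx0
  have hm : ∀ x, ‖x‖ ≤ ‖x1‖ → h x ≤ h x0 := fun x hx => hmax (by simpa using hx)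
  have hpos : 0 < g x0 := by
    have : 0 < h x0 := lt_of_lt_of_le (mul_pos (Real.exp_pos _) hx1) (hm x1 le_rfl)
    exact (mul_pos_iff_of_pos_left (Real.exp_pos _)).1 this
  have hne : x0 ≠ 0 := by rintro rfl; rw [h0] at hpos; exact lt_irrefl _ hpos
  have hrefl : ∀ l : Fin n, g (reflect (posRoot n l) x0) ≤ g x0 := by
    intro l
    have := hm (reflect (posRoot n l) x0) (by rw [norm_reflect_posRoot]; exact hx0')
    simp only [h, norm_reflect_posRoot] at this
    exact le_of_mul_le_mul_left this (Real.exp_pos _)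
  have hle : fderiv ℝ g x0 x0 ≤ ‖x0‖ * ‖y‖ * g x0 := by
    rw [he]
    have h1 : 0 ≤ k * ∑ l : Fin n, (g x0 - g (reflect (posRoot n l) x0)) :=
      mul_nonneg hk (sum_nonneg fun l _ => sub_nonneg.2 (hrefl l))
    have h2 := mul_le_mul_of_nonneg_right (real_inner_le_norm x0 y) hpos.le
    linarith
  let u : ℝ → ℝ := fun t => Real.exp (-(c * (t * ‖x0‖))) * g (t • x0)
  have hu : HasDerivAt u (Real.exp (-(c * ‖x0‖)) * (fderiv ℝ g x0 x0 - c * ‖x0‖ * g x0)) 1 := by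
    have e1 : HasDerivAt (fun t : ℝ => Real.exp (-(c * (t * ‖x0‖))))
        (Real.exp (-(c * (1 * ‖x0‖))) * (-(c * (1 * ‖x0‖)))) 1 :=
      ((((hasDerivAt_id (1 : ℝ)).mul_const ‖x0‖).const_mul c).neg).exp
    have e2 : HasDerivAt (fun t : ℝ => t • x0) ((1 : ℝ) • x0) 1 :=
      (hasDerivAt_id (1 : ℝ)).smul_const x0
    have e3 : HasDerivAt (fun t : ℝ => g (t • x0)) (fderiv ℝ g x0 x0) 1 := by
      have : HasFDerivAt g (fderiv ℝ g x0) ((1 : ℝ) • x0) := by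
        simpa using (hg x0).hasFDerivAt
      exact (this.comp_hasDerivAt (1 : ℝ) e2).congr_deriv (by rw [one_smul])
    refine (e1.mul e3).congr_deriv ?_
    simp only [one_mul, one_smul]; ring
  have hslope : 0 ≤ Real.exp (-(c * ‖x0‖)) * (fderiv ℝ g x0 x0 - c * ‖x0‖ * g x0) := by
    have ht := hu.tendsto_slope.mono_left (nhdsWithin_mono 1
      (show Set.Iio (1 : ℝ) ⊆ {1}ᶜ from fun t ht => (Set.mem_Iio.1 ht).ne))
    refine ge_of_tendsto ht ?_
    have hI : Set.Ioo (0 : ℝ) 1 ∈ 𝓝[<] (1 : ℝ) := Ioo_mem_nhdsLT (by norm_num)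
    filter_upwards [hI] with t ht
    have h1 : u t ≤ u 1 := by
      have h2 : ‖t • x0‖ = t * ‖x0‖ := by rw [norm_smul, Real.norm_of_nonneg ht.1.le]
      have h3 := hm (t • x0) (by rw [h2]; nlinarith [norm_nonneg x0, ht.2])
      simp only [h, h2] at h3
      simpa [u] using h3
    rw [slope_def_field]
    exact div_nonneg_of_nonpos (by linarith) (by linarith [ht.2])
  have h4 := nonneg_of_mul_nonneg_right hslope (Real.exp_pos _)
  have h5 : 0 < ‖x0‖ * g x0 := mul_pos (norm_pos_iff.2 hne) hpos
  have h6 : c * ‖x0‖ * g x0 = ‖x0‖ * ‖y‖ * g x0 + ‖x0‖ * g x0 := by rw [hc]; ring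
  linarith

theorem IsDunklEigenfunction.unique {n : ℕ} {k : ℝ} (hk : 0 ≤ k) {y : ℂ} {f g : ℂ → ℝ}
    (hf : IsDunklEigenfunction n k y f) (hg : IsDunklEigenfunction n k y g) : f = g := by
  have key : ∀ {f g : ℂ → ℝ}, IsDunklEigenfunction n k y f → IsDunklEigenfunction n k y g →
      ∀ x, f x - g x ≤ 0 := by
    intro f g hf hg
    have hfd : Differentiable ℝ f := fun x => (hf.analytic x (Set.mem_univ x)).differentiableAt
    have hgd : Differentiable ℝ g := fun x => (hg.analytic x (Set.mem_univ x)).differentiableAt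
    refine nonpos_of_euler (n := n) (y := y) hk (hfd.fun_sub hgd)
      (by rw [hf.normalized, hg.normalized, sub_self]) fun x => ?_
    rw [fderiv_fun_sub (hfd x) (hgd x), _root_.sub_apply, hf.euler, hg.euler]
    have : ∑ l : Fin n, (f x - g x - (f (reflect (posRoot n l) x) - g (reflect (posRoot n l) x))) =
        ∑ l : Fin n, (f x - f (reflect (posRoot n l) x)) -
          ∑ l : Fin n, (g x - g (reflect (posRoot n l) x)) := by
      rw [← sum_sub_distrib]
      exact sum_congr rfl fun l _ => by ring
    rw [this]; ring
  ext x
  have h1 := key hf hg x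
  have h2 := key hg hf x
  linarith

theorem dunklKernel_eq {n : ℕ} (hn : 2 ≤ n) {k : ℝ} (hk : 0 < k) (x y : ℂ) :
    dunklKernel n k x y = ekernel n k y x := by
  have h := isDunklEigenfunction_ekernel hn hk y
  have h2 : IsDunklEigenfunction n k y (Classical.epsilon (IsDunklEigenfunction n k y)) :=
    Classical.epsilon_spec ⟨_, h⟩
  exact congrFun (h2.unique hk.le h) x

end DihedralBessel
end

noncomputable section
namespace DihedralBessel
open Finset ComplexConjugate Filter Topology

lemma genBessel_eq {n : ℕ} (hn : 2 ≤ n) {k : ℝ} (hk : 0 < k) (x y : ℂ) :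
    genBessel n k x y = (1 / (2 * n : ℝ)) * ∑ l : Fin n,
      (ekernel n k y (rt n l * x) + ekernel n k y (rt n l * conj x)) := by
  simp only [genBessel, dunklKernel_eq hn hk]
  congr 1
  have hζ : ∀ l : ℕ, Complex.exp (Complex.I * ((2 * Real.pi * l / n : ℝ) : ℂ)) =
      Complex.exp (2 * Real.pi * Complex.I / n) ^ l := by
    intro l
    rw [← Complex.exp_nat_mul]
    congr 1
    push_cast; ring
  simp only [hζ, rt]
  set ζ := Complex.exp (2 * Real.pi * Complex.I / n) with hz
  have hζn : ζ ^ n = 1 := (Complex.isPrimitiveRoot_exp n (by omega)).pow_eq_one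
  rw [Fin.sum_univ_eq_sum_range (fun l => ekernel n k y (ζ ^ (l + 1) * x) +
    ekernel n k y (ζ ^ (l + 1) * conj x)) n]
  have h := sum_range_succ (fun l => ekernel n k y (ζ ^ l * x) + ekernel n k y (ζ ^ l * conj x)) n
  rw [sum_range_succ', hζn, pow_zero] at h
  exact (add_right_cancel h).symm

lemma genBessel_zero_left {n : ℕ} (hn : 2 ≤ n) {k : ℝ} (hk : 0 < k) (y : ℂ) :
    genBessel n k 0 y = 1 := by
  have : (n : ℝ) ≠ 0 := by positivity
  rw [genBessel_eq hn hk]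
  simp only [map_zero, mul_zero, ekernel_zero n hk, sum_const, card_univ, Fintype.card_fin,
    nsmul_eq_mul]
  field_simp; norm_num

lemma hpol_rt_mul (n : ℕ) (k : ℝ) (m : ℕ) (x : ℂ) (l : Fin n) :
    hpol n k m (rt n l * x) = rt n l ^ (m % n) * hpol n k m x := by
  have h : conj (rt n l) ^ n = 1 := by rw [← map_pow, rt_pow, map_one]
  rw [hpol, hpol]
  simp only [map_mul, mul_pow, rt_pow, h, one_mul]
  ring

/-- The mean of `eterm` over the dihedral group. -/
def gterm (n : ℕ) (k : ℝ) (y : ℂ) (m i : ℕ) (x : ℂ) : ℂ :=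
  if n ∣ m then acoef n k y m i * ((x * conj x) ^ i *
    ((useq n k y m + conj (useq n k y m)) * (hpol n k m x + conj (hpol n k m x)) / 2)) else 0

lemma sum_eterm {n : ℕ} (hn : n ≠ 0) (k : ℝ) (y : ℂ) (m i : ℕ) (x : ℂ) :
    ∑ l : Fin n, (eterm n k y m i (rt n l * x) + eterm n k y m i (rt n l * conj x)) =
      2 * n * gterm n k y m i x := by
  have hc : ∀ l : Fin n, rt n l * conj (rt n l) = 1 := rt_mul_conj n
  have hs : ∑ l : Fin n, rt n l ^ (m % n) = if n ∣ m then (n : ℂ) else 0 := by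
    rw [sum_rt_pow hn]; simp [Nat.dvd_mod_iff]
  have hs' : ∑ l : Fin n, conj (rt n l) ^ (m % n) = if n ∣ m then (n : ℂ) else 0 := by
    have := congrArg conj hs
    rw [map_sum] at this
    simp only [map_pow] at this
    rw [this]; split_ifs <;> simp
  set U := useq n k y m with hU
  set p := hpol n k m x with hp
  have h1 : ∀ l : Fin n, eterm n k y m i (rt n l * x) + eterm n k y m i (rt n l * conj x) =
      rt n l ^ (m % n) * (acoef n k y m i * (x * conj x) ^ i * (U * (p + conj p))) +
      conj (rt n l) ^ (m % n) * (acoef n k y m i * (x * conj x) ^ i * (conj U * (p + conj p))) := by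
    intro l
    have h2 : rt n l * x * conj (rt n l * x) = x * conj x := by
      rw [map_mul]; linear_combination (x * conj x) * hc l
    have h3 : rt n l * conj x * conj (rt n l * conj x) = x * conj x := by
      rw [map_mul, Complex.conj_conj]; linear_combination (x * conj x) * hc l
    rw [eterm, eterm, h2, h3, hpol_rt, hpol_rt_mul, ← hU, ← hp]
    simp only [map_mul, map_pow, Complex.conj_conj]
    ring
  rw [sum_congr rfl fun l _ => h1 l, sum_add_distrib, ← sum_mul, ← sum_mul, hs, hs', gterm]
  split_ifs
  · ring
  · ring

/-- The homogeneous component of the generalized Bessel function. -/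
def gcomp (n : ℕ) (k : ℝ) (y : ℂ) (N : ℕ) (x : ℂ) : ℂ :=
  ∑ i ∈ range (N / 2 + 1), gterm n k y (N - 2 * i) i x

lemma sum_ecomp {n : ℕ} (hn : n ≠ 0) (k : ℝ) (y : ℂ) (N : ℕ) (x : ℂ) :
    ∑ l : Fin n, (ecomp n k y N (rt n l * x) + ecomp n k y N (rt n l * conj x)) =
      2 * n * gcomp n k y N x := by
  simp only [ecomp, ← sum_add_distrib]
  rw [sum_comm, gcomp, mul_sum]
  exact sum_congr rfl fun i _ => sum_eterm hn k y _ i x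

lemma hasSum_ekernel (n : ℕ) {k : ℝ} (hk : 0 < k) (y x : ℂ) :
    HasSum (fun N => (ecomp n k y N x).re) (ekernel n k y x) :=
  Complex.hasSum_re (summable_ecomp n hk y x).hasSum

lemma hasSum_genBessel {n : ℕ} (hn : 2 ≤ n) {k : ℝ} (hk : 0 < k) (x y : ℂ) :
    HasSum (fun N => (gcomp n k y N x).re) (genBessel n k x y) := by
  have hn0 : n ≠ 0 := by omega
  have hn' : (n : ℝ) ≠ 0 := by positivity
  rw [genBessel_eq hn hk]
  have h := (hasSum_sum (s := (univ : Finset (Fin n))) fun l _ =>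
    (hasSum_ekernel n hk y (rt n l * x)).add (hasSum_ekernel n hk y (rt n l * conj x))).mul_left
      (1 / (2 * n : ℝ))
  refine h.congr_fun fun N => ?_
  have h2 := congrArg Complex.re (sum_ecomp hn0 k y N x)
  rw [Complex.re_sum, show (2 * n : ℂ) = ((2 * n : ℝ) : ℂ) by push_cast; rfl,
    Complex.re_ofReal_mul] at h2
  simp only [Complex.add_re] at h2
  rw [h2]; field_simp

section ClosedForm

variable {n : ℕ} {k : ℝ}

lemma useq_block (hk : 0 < k) (y : ℂ) (j r : ℕ) (hr : r < n) :
    useq' n k y (n * j + r) = (conj y / 2) ^ r * useq' n k y (n * j) := by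
  induction r with
  | zero => simp
  | succ r ih =>
    have hd : ¬ n ∣ n * j + (r + 1) := fun h => by
      have := Nat.le_of_dvd (by omega) ((Nat.dvd_add_right (dvd_mul_right n j)).1 h)
      omega
    have h := kapc_mul_useq_succ n hk y (n * j + r)
    rw [add_assoc, kapc, if_neg hd, ih (by omega)] at h
    rw [useq', epsc, if_neg hd, pow_succ]
    push_cast at h ⊢
    linear_combination h

lemma kapc_mul_useq_mul_succ (hn : n ≠ 0) (hk : 0 < k) (y : ℂ) (j : ℕ) :
    kapc n k (n * (j + 1)) * useq n k y (n * (j + 1)) =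
      (conj y / 2) ^ n * useq' n k y (n * j) := by
  obtain ⟨m, rfl⟩ := Nat.exists_eq_succ_of_ne_zero hn
  have h := kapc_mul_useq_succ (m + 1) hk y ((m + 1) * j + m)
  rw [useq_block hk y j m (by omega)] at h
  rw [Nat.succ_eq_add_one, mul_add, mul_one, ← add_assoc, h, pow_succ]
  ring

lemma useq'_mul (hn : n ≠ 0) (hk : 0 < k) (y : ℂ) (j : ℕ) :
    useq' n k y (n * j) = j.factorial / pch (2 * k + 1 : ℂ) j *
      heis (k : ℂ) ((conj y / 2) ^ n) ((y / 2) ^ n) j := by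
  have hn' : 0 < n := Nat.pos_of_ne_zero hn
  induction j with
  | zero =>
    simp [useq', useq, epsc_zero n hk, heis_zero, map_ofNat]; norm_num
  | succ j ih =>
    have h1 := kapc_mul_useq_mul_succ hn hk y j
    have h2 := heis_succ (k : ℂ) ((conj y / 2) ^ n) ((y / 2) ^ n) j
    have hc : conj (heis (k : ℂ) ((conj y / 2) ^ n) ((y / 2) ^ n) (j + 1)) =
        heis (k : ℂ) ((y / 2) ^ n) ((conj y / 2) ^ n) (j + 1) := by
      rw [conj_heis]; simp [map_ofNat]
    rw [ih, kapc, if_pos (dvd_mul_right _ _), Nat.mul_div_cancel_left _ hn'] at h1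
    rw [useq', epsc, if_pos (dvd_mul_right _ _), Nat.mul_div_cancel_left _ hn']
    set u := useq n k y (n * (j + 1))
    set h := heis (k : ℂ) ((conj y / 2) ^ n) ((y / 2) ^ n) (j + 1)
    set Y := (conj y / 2) ^ n
    have hP : ((pch (2 * k + 1) j : ℝ) : ℂ) ≠ 0 := by
      exact_mod_cast (pch_pos (by positivity) j).ne'
    have hPe : ((pch (2 * k + 1) j : ℝ) : ℂ) = pch (2 * k + 1 : ℂ) j := by
      rw [ofReal_pch]; push_cast; rfl
    rw [hPe] at hP
    have ha : (k : ℂ) + (j + 1) ≠ 0 := by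
      exact_mod_cast (show (k : ℝ) + (j + 1) ≠ 0 by positivity)
    have hb : 2 * (k : ℂ) + (j + 1) ≠ 0 := by
      exact_mod_cast (show 2 * (k : ℝ) + (j + 1) ≠ 0 by positivity)
    have hu : u = (k + (j + 1)) * (j.factorial / pch (2 * k + 1 : ℂ) j) *
        ((k + (j + 1)) * h - k * conj h) / (2 * k + (j + 1)) ^ 2 := by
      rw [hc]
      push_cast at h1
      rw [eq_div_iff (pow_ne_zero 2 hb)]
      have h3 : (2 * k + (j + 1) : ℂ) * u = (k + (j + 1)) *
          (Y * (j.factorial / pch (2 * k + 1 : ℂ) j *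
            heis (k : ℂ) Y ((y / 2) ^ n) j)) := by
        rw [← h1]; field_simp
      linear_combination (2 * k + (j + 1) : ℂ) * h3 -
        (k + (j + 1)) * (j.factorial / pch (2 * k + 1 : ℂ) j) * h2
    have hcu : conj u = (k + (j + 1)) * (j.factorial / pch (2 * k + 1 : ℂ) j) *
        ((k + (j + 1)) * conj h - k * h) / (2 * k + (j + 1)) ^ 2 := by
      rw [hu]
      rw [← hPe]
      simp only [map_div₀, map_mul, map_sub, map_add, map_pow, Complex.conj_ofReal, map_natCast,
        map_one, Complex.conj_conj, map_ofNat]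
    rw [hcu, hu, pch_succ, Nat.factorial_succ]
    rw [show 2 * (k : ℂ) + 1 + j = 2 * k + (j + 1) by ring]
    push_cast
    generalize pch (2 * k + 1 : ℂ) j = P at hP ⊢
    obtain ⟨a, haj⟩ : ∃ a : ℂ, (k : ℂ) + (j + 1) = a := ⟨_, rfl⟩
    have hb' : 2 * (k : ℂ) + (j + 1) = a + k := by rw [← haj]; ring
    have hj : (j : ℂ) + 1 = a - k := by rw [← haj]; ring
    rw [hb'] at hb ⊢
    rw [haj] at ha ⊢
    rw [hj]
    field_simp
    ring

lemma useq_add_conj (hn : n ≠ 0) (hk : 0 < k) (y : ℂ) (j : ℕ) :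
    useq n k y (n * j) + conj (useq n k y (n * j)) =
      (k + j) * j.factorial / (k * pch (2 * k + 1 : ℂ) j) *
        gegHom (k : ℂ) ((conj y / 2) ^ n) ((y / 2) ^ n) j := by
  have hn' : 0 < n := Nat.pos_of_ne_zero hn
  have h1 := useq'_mul hn hk y j
  have h2 := heis_add_swap (k : ℂ) ((conj y / 2) ^ n) ((y / 2) ^ n) j
  have hP : ((pch (2 * k + 1) j : ℝ) : ℂ) ≠ 0 := by
    exact_mod_cast (pch_pos (by positivity) j).ne'
  have hPe : ((pch (2 * k + 1) j : ℝ) : ℂ) = pch (2 * k + 1 : ℂ) j := by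
    rw [ofReal_pch]; push_cast; rfl
  have h1c : conj (useq' n k y (n * j)) = j.factorial / pch (2 * k + 1 : ℂ) j *
      heis (k : ℂ) ((y / 2) ^ n) ((conj y / 2) ^ n) j := by
    rw [h1, map_mul, conj_heis, ← hPe]
    simp [map_ofNat]
  have hk' : (k : ℂ) ≠ 0 := by exact_mod_cast hk.ne'
  have ha : (k : ℂ) + j ≠ 0 := by exact_mod_cast (show (k : ℝ) + j ≠ 0 by positivity)
  have hb : (j : ℂ) + 2 * k ≠ 0 := by exact_mod_cast (show (j : ℝ) + 2 * k ≠ 0 by positivity)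
  rw [useq', epsc, if_pos (dvd_mul_right _ _), Nat.mul_div_cancel_left _ hn'] at h1 h1c
  simp only [map_add, map_mul, Complex.conj_ofReal, Complex.conj_conj] at h1c
  set u := useq n k y (n * j)
  rw [hPe] at hP
  push_cast at h1 h1c
  have h3 : (j + 2 * k : ℂ) * (u + conj u) = (k + j) * (j.factorial / pch (2 * k + 1 : ℂ) j) *
      (heis (k : ℂ) ((conj y / 2) ^ n) ((y / 2) ^ n) j +
        heis (k : ℂ) ((y / 2) ^ n) ((conj y / 2) ^ n) j) := by
    have : (k / (k + j) : ℂ) * (k + j) = k := by field_simp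
    linear_combination (k + j : ℂ) * (h1 + h1c) - (u + conj u) * this
  have h4 : (k * (j + 2 * k) : ℂ) * (u + conj u) = (k + j) * (j.factorial / pch (2 * k + 1 : ℂ) j) *
      ((j + 2 * k) * gegHom (k : ℂ) ((conj y / 2) ^ n) ((y / 2) ^ n) j) := by
    linear_combination k * h3 + (k + j) * (j.factorial / pch (2 * k + 1 : ℂ) j) * h2
  apply mul_left_cancel₀ (mul_ne_zero hk' hb)
  rw [h4]
  field_simp

lemma hpol_add_conj (hn : n ≠ 0) (hk : 0 < k) (x : ℂ) (j : ℕ) :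
    hpol n k (n * j) x + conj (hpol n k (n * j) x) =
      (j + 2 * k) / k * gegHom (k : ℂ) (x ^ n) (conj x ^ n) j := by
  have hn' : 0 < n := Nat.pos_of_ne_zero hn
  have hk' : (k : ℂ) ≠ 0 := by exact_mod_cast hk.ne'
  have h2 := heis_add_swap (k : ℂ) (x ^ n) (conj x ^ n) j
  rw [conj_hpol, hpol, Nat.mul_mod_right, Nat.mul_div_cancel_left _ hn', pow_zero, pow_zero,
    one_mul, one_mul, div_mul_eq_mul_div, eq_div_iff hk', ← h2]
  ring

lemma gegHom_mul (k c Z W : ℂ) (j : ℕ) : gegHom k (c * Z) (c * W) j = c ^ j * gegHom k Z W j := by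
  rw [gegHom, gegHom, heisGen, heisGen, PowerSeries.coeff_mul, PowerSeries.coeff_mul, mul_sum]
  refine sum_congr rfl fun p hp => ?_
  simp only [opow_C_mul_X, PowerSeries.coeff_mk, mul_pow]
  rw [← mem_antidiagonal.1 hp, pow_add]
  ring

end ClosedForm

end DihedralBessel
end

noncomputable section
namespace DihedralBessel
open Finset ComplexConjugate PowerSeries

lemma gegHom_swap (k Z W : ℂ) (j : ℕ) : gegHom k Z W j = gegHom k W Z j := by
  rw [gegHom, gegHom, heisGen_swap]

/-- The contribution of `X ^ (n * j + 2 * i)` to `besselGen`. -/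
def besselCoeff (n : ℕ) (k A B : ℂ) (j i : ℕ) : ℂ :=
  j.factorial / pch (2 * k) j * (geg k A j * geg k B j) / 2 ^ (n * j) *
    (lagr (n * k + n * j) i / 4 ^ i)

lemma coeff_subst_X_sq (f : ℂ⟦X⟧) (N : ℕ) {M : ℕ} (hM : N / 2 < M) :
    coeff N (f.subst (X ^ 2 : ℂ⟦X⟧)) = ∑ i ∈ range M, if 2 * i = N then coeff i f else 0 := by
  rw [sq, subst_eq_xsum, coeff_xsum]
  have h : ∀ i ∈ range (N + 1), coeff (N - i) (C (coeff i f) * (X : ℂ⟦X⟧) ^ i) =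
      if 2 * i = N then coeff i f else 0 := by
    intro i hi
    have := mem_range.1 hi
    rw [coeff_C_mul, coeff_X_pow, mul_ite, mul_one, mul_zero]
    congr 1
    exact propext (by omega)
  rw [sum_congr rfl h, ← sum_filter, ← sum_filter]
  congr 1
  ext i
  simp only [mem_filter, mem_range]
  omega

lemma coeff_besselGen {n : ℕ} (hn : n ≠ 0) (k A B : ℂ) (N : ℕ) :
    coeff N (besselGen n k A B) = ∑ j ∈ range (N + 1), ∑ i ∈ range (N / 2 + 1),
      if n * j + 2 * i = N then besselCoeff n k A B j i else 0 := by
  rw [besselGen, coeff_xsum]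
  refine sum_congr rfl fun j hj => ?_
  have hj' := mem_range.1 hj
  have hnj : n * j = (n - 1) * j + j := by
    obtain ⟨m, rfl⟩ := Nat.exists_eq_succ_of_ne_zero hn
    simp [Nat.succ_mul]
  rw [coeff_C_mul, coeff_X_pow_mul', coeff_subst_X_sq _ _ (M := N / 2 + 1) (by omega)]
  split_ifs with h
  · rw [mul_sum]
    refine sum_congr rfl fun i _ => ?_
    rw [coeff_mk, mul_ite, mul_zero, besselCoeff]
    congr 1
    exact propext (by omega)
  · rw [mul_zero, sum_eq_zero]
    intro i _
    rw [if_neg (by omega)]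

lemma gterm_eq {n : ℕ} (hn : n ≠ 0) {k : ℝ} (hk : 0 < k) (ρ r : ℝ) {a b : ℂ} (ha : a * conj a = 1)
    (hb : b * conj b = 1) (j i : ℕ) :
    gterm n k (r * b) (n * j) i (ρ * a) = ((ρ * r : ℝ) : ℂ) ^ (n * j + 2 * i) /
      pch (n * k : ℂ) (n * j + 2 * i) * besselCoeff n k (a ^ n) (b ^ n) j i := by
  have hca : conj a = a⁻¹ := eq_inv_of_mul_eq_one_right ha
  have hcb : conj b = b⁻¹ := eq_inv_of_mul_eq_one_right hb
  have hpos : ∀ (t : ℝ) (m : ℕ), 0 < t → pch (t : ℂ) m ≠ 0 := by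
    intro t m ht
    rw [← ofReal_pch]
    exact_mod_cast (pch_pos ht m).ne'
  have hk' : (k : ℂ) ≠ 0 := by exact_mod_cast hk.ne'
  have hn' : (n : ℂ) ≠ 0 := by exact_mod_cast hn
  have hnpos : (0 : ℝ) < n := by exact_mod_cast Nat.pos_of_ne_zero hn
  have e1 : gegHom (k : ℂ) ((ρ * a) ^ n) (conj (ρ * a : ℂ) ^ n) j = (ρ : ℂ) ^ (n * j) *
      geg (k : ℂ) (a ^ n) j := by
    rw [map_mul, Complex.conj_ofReal, hca, mul_pow, mul_pow, gegHom_mul, ← pow_mul, inv_pow]; rfl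
  have e2 : gegHom (k : ℂ) ((conj (r * b : ℂ) / 2) ^ n) ((r * b / 2) ^ n) j =
      ((r : ℂ) / 2) ^ (n * j) * geg (k : ℂ) (b ^ n) j := by
    rw [map_mul, Complex.conj_ofReal, hcb, mul_div_right_comm, mul_div_right_comm, mul_pow, mul_pow,
      gegHom_mul, ← pow_mul, gegHom_swap, inv_pow]; rfl
  have e3 : (ρ * a : ℂ) * conj (ρ * a : ℂ) = (ρ : ℂ) ^ 2 := by
    rw [map_mul, Complex.conj_ofReal]; linear_combination (ρ : ℂ) ^ 2 * ha
  have e4 : Complex.normSq (r * b) = r ^ 2 := by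
    have : ((Complex.normSq (r * b) : ℝ) : ℂ) = (r : ℂ) ^ 2 := by
      rw [← Complex.mul_conj, map_mul, Complex.conj_ofReal]; linear_combination (r : ℂ) ^ 2 * hb
    exact_mod_cast this
  have e5 : (acoef n k (r * b) (n * j) i : ℂ) =
      ((r : ℂ) ^ 2 / 4) ^ i / (i.factorial * pch (n * k + 1 : ℂ) (n * j + i)) := by
    rw [acoef, e4]; push_cast; rw [ofReal_pch]; push_cast; rfl
  have p1 : pch (2 * k : ℂ) j * (2 * k + j) = 2 * k * pch (2 * k + 1 : ℂ) j := by
    rw [← pch_succ, pch_succ_left]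
  have p2 : pch (n * k : ℂ) (n * j + 2 * i) =
      pch (n * k : ℂ) (n * j) * pch (n * k + n * j : ℂ) (2 * i) := by
    rw [pch_add]; push_cast; rfl
  have p3 : pch (n * k : ℂ) (n * j) * pch (n * k + n * j : ℂ) (i + 1) =
      n * k * pch (n * k + 1 : ℂ) (n * j + i) := by
    rw [← pch_succ_left, add_assoc, pch_add _ (n * j) (i + 1)]; push_cast; rfl
  have q1 : pch (2 * k : ℂ) j ≠ 0 := by exact_mod_cast hpos (2 * k) j (by positivity)
  have q2 : pch (2 * k + 1 : ℂ) j ≠ 0 := by exact_mod_cast hpos (2 * k + 1) j (by positivity)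
  have q3 : pch (n * k : ℂ) (n * j) ≠ 0 := by exact_mod_cast hpos (n * k) (n * j) (by positivity)
  have q4 : pch (n * k + n * j : ℂ) (2 * i) ≠ 0 := by
    exact_mod_cast hpos (n * k + n * j) (2 * i) (by positivity)
  have q5 : pch (n * k + 1 : ℂ) (n * j + i) ≠ 0 := by
    exact_mod_cast hpos (n * k + 1) (n * j + i) (by positivity)
  have q6 : pch (n * k + n * j : ℂ) (i + 1) ≠ 0 := by
    exact_mod_cast hpos (n * k + n * j) (i + 1) (by positivity)
  have q7 : (2 * k + j : ℂ) ≠ 0 := by exact_mod_cast (show (2 * k + j : ℝ) ≠ 0 by positivity)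
  have q8 : (i.factorial : ℂ) ≠ 0 := by exact_mod_cast i.factorial_ne_zero
  have s1 : pch (2 * k + 1 : ℂ) j = pch (2 * k : ℂ) j * (2 * k + j) / (2 * k) := by
    rw [p1]; field_simp
  have s2 : pch (n * k + 1 : ℂ) (n * j + i) =
      pch (n * k : ℂ) (n * j) * pch (n * k + n * j : ℂ) (i + 1) / (n * k) := by
    rw [p3]; field_simp
  rw [gterm, if_pos (dvd_mul_right _ _), useq_add_conj hn hk, hpol_add_conj hn hk, e1, e2, e3, e5,
    besselCoeff, lagr, p2, s1, s2]
  have hcast : ((ρ * r : ℝ) : ℂ) ^ (n * j + 2 * i) =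
      (ρ : ℂ) ^ (n * j) * (r : ℂ) ^ (n * j) * ((ρ : ℂ) ^ 2) ^ i * ((r : ℂ) ^ 2) ^ i := by
    push_cast; ring
  rw [hcast, div_pow, div_pow, add_comm (j : ℂ) (2 * k)]
  clear s1 s2 hcast p1 p2 p3 e1 e2 e3 e4 e5 q2 q5 hpos ha hb hca hcb
  have q9 : (2 : ℂ) ^ (n * j) ≠ 0 := pow_ne_zero _ two_ne_zero
  have q10 : (4 : ℂ) ^ i ≠ 0 := pow_ne_zero _ (by norm_num)
  generalize pch (2 * k : ℂ) j = P1 at *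
  generalize pch (n * k : ℂ) (n * j) = P2 at *
  generalize pch (n * k + n * j : ℂ) (2 * i) = P3 at *
  generalize pch (n * k + n * j : ℂ) (i + 1) = P4 at *
  generalize geg (k : ℂ) (a ^ n) j = g1
  generalize geg (k : ℂ) (b ^ n) j = g2
  generalize (2 : ℂ) ^ (n * j) = c1 at *
  generalize (4 : ℂ) ^ i = c2 at *
  generalize (ρ : ℂ) ^ (n * j) = c3
  generalize (r : ℂ) ^ (n * j) = c4
  generalize ((ρ : ℂ) ^ 2) ^ i = c5
  generalize ((r : ℂ) ^ 2) ^ i = c6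
  generalize (2 * k + j : ℂ) = c7 at *
  field_simp

lemma gcomp_eq {n : ℕ} (hn : n ≠ 0) {k : ℝ} (hk : 0 < k) (ρ r : ℝ) {a b : ℂ} (ha : a * conj a = 1)
    (hb : b * conj b = 1) (N : ℕ) :
    gcomp n k (r * b) N (ρ * a) = ((ρ * r : ℝ) : ℂ) ^ N / pch (n * k : ℂ) N *
      coeff N (besselGen n (k : ℂ) (a ^ n) (b ^ n)) := by
  rw [coeff_besselGen hn, sum_comm, gcomp, mul_sum]
  refine sum_congr rfl fun i hi => ?_
  have hi' := mem_range.1 hi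
  by_cases hd : n ∣ N - 2 * i
  · obtain ⟨j, hj⟩ := hd
    have hN : n * j + 2 * i = N := by omega
    have hjN : j ≤ n * j := Nat.le_mul_of_pos_left j (Nat.pos_of_ne_zero hn)
    rw [sum_eq_single j, if_pos hN, hj, gterm_eq hn hk ρ r ha hb, hN]
    · intro j' _ hne
      refine if_neg fun h => hne ?_
      exact Nat.eq_of_mul_eq_mul_left (Nat.pos_of_ne_zero hn) (by omega)
    · intro h
      exact absurd (mem_range.2 (by omega)) h
  · rw [gterm, if_neg hd, sum_eq_zero, mul_zero]
    intro j _
    refine if_neg fun h => hd ⟨j, by omega⟩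

lemma prod_one_sub_rt {n : ℕ} (hn : n ≠ 0) (c : ℂ) :
    ∏ s : Fin n, (1 - C (c * rt n s) * X : ℂ⟦X⟧) = 1 - C (c ^ n) * X ^ n := by
  classical
  have hp := (Complex.isPrimitiveRoot_exp n hn).map_of_injective
    (f := (C : ℂ →+* ℂ⟦X⟧)) C_injective
  set ζ := Complex.exp (2 * Real.pi * Complex.I / n) with hz
  have h := hp.pow_sub_pow_eq_prod_sub_mul (1 : ℂ⟦X⟧) (C c * X) (Nat.pos_of_ne_zero hn)
  have hinj : Function.Injective fun s : Fin n => (C (rt n s) : ℂ⟦X⟧) := by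
    intro s t hst
    have h1 : ζ * ζ ^ (s : ℕ) = ζ * ζ ^ (t : ℕ) := by
      rw [← pow_succ', ← pow_succ']; exact C_injective hst
    exact Fin.ext ((Complex.isPrimitiveRoot_exp n hn).pow_inj s.2 t.2
      (mul_left_cancel₀ (Complex.exp_ne_zero _) h1))
  have himg : (univ : Finset (Fin n)).image (fun s => (C (rt n s) : ℂ⟦X⟧)) =
      Polynomial.nthRootsFinset n (1 : ℂ⟦X⟧) := by
    refine eq_of_subset_of_card_le ?_ ?_
    · intro t ht
      obtain ⟨s, -, rfl⟩ := mem_image.1 ht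
      rw [Polynomial.mem_nthRootsFinset (Nat.pos_of_ne_zero hn), ← map_pow, rt_pow, map_one]
    · rw [hp.card_nthRootsFinset, card_image_of_injective _ hinj, card_univ, Fintype.card_fin]
  rw [← himg, prod_image fun s _ t _ hst => hinj hst, one_pow, mul_pow, ← map_pow] at h
  rw [h]
  refine prod_congr rfl fun s _ => ?_
  rw [map_mul]; ring

lemma conj_rt (n : ℕ) (s : Fin n) : conj (rt n s) = (rt n s)⁻¹ :=
  eq_inv_of_mul_eq_one_right (rt_mul_conj n s)

lemma prod_one_sub_inv_rt {n : ℕ} (hn : n ≠ 0) (c : ℂ) :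
    ∏ s : Fin n, (1 - C (c * (rt n s)⁻¹) * X : ℂ⟦X⟧) = 1 - C (c ^ n) * X ^ n := by
  have h := congrArg (PowerSeries.map (starRingEnd ℂ)) (prod_one_sub_rt hn (conj c))
  simpa [map_prod, conj_rt] using h

lemma prod_cos {n : ℕ} (hn : n ≠ 0) {a b : ℂ} (ha : a ≠ 0) (hb : b ≠ 0) {z : Fin n → ℂ}
    (hz : ∀ s, 2 * z s = b / a * rt n s + a / b * (rt n s)⁻¹) :
    ∏ s, (1 - (C (2 * z s) * X - X ^ 2) : ℂ⟦X⟧) =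
      (1 - C (a ^ n / b ^ n) * X ^ n) * (1 - C (b ^ n / a ^ n) * X ^ n) := by
  rw [← div_pow, ← div_pow, ← prod_one_sub_inv_rt hn, ← prod_one_sub_rt hn, ← prod_mul_distrib]
  refine prod_congr rfl fun s _ => ?_
  have h1 : b / a * rt n s * (a / b * (rt n s)⁻¹) = 1 := by
    have := rt_ne_zero n s
    field_simp
  have h2 : (C (b / a * rt n s) : ℂ⟦X⟧) * C (a / b * (rt n s)⁻¹) = 1 := by
    rw [← map_mul, h1, map_one]
  rw [hz, map_add]
  linear_combination (-X ^ 2) * h2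

end DihedralBessel
end

noncomputable section
namespace DihedralBessel
open Finset ComplexConjugate PowerSeries

lemma pch_mono {a b : ℝ} (ha : 0 < a) (hab : a ≤ b) (j : ℕ) : pch a j ≤ pch b j := by
  induction j with
  | zero => simp
  | succ j ih =>
    rw [pch_succ, pch_succ]
    exact mul_le_mul ih (by linarith) (by positivity) (pch_pos (ha.trans_le hab) j).le

lemma pch_mul_le {a b : ℝ} (ha : 0 < a) (hb : 0 < b) (i j : ℕ) :
    pch a i * pch b j ≤ pch (a + b) (i + j) := by
  rw [pch_add]
  have hi : (0 : ℝ) ≤ i := i.cast_nonneg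
  exact mul_le_mul (pch_mono ha (by linarith) i) (pch_mono hb (by linarith) j) (pch_pos hb j).le
    (pch_pos (by linarith) i).le

lemma prod_pch_le {ι : Type*} (s : Finset ι) (hs : s.Nonempty) {a : ℝ} (ha : 0 < a) (m : ι → ℕ) :
    ∏ i ∈ s, pch a (m i) ≤ pch (s.card * a) (∑ i ∈ s, m i) := by
  classical
  induction hs using Finset.Nonempty.cons_induction with
  | singleton i => simp
  | cons i s hi hs ih =>
    have hc : (0 : ℝ) < s.card := by exact_mod_cast hs.card_pos
    rw [prod_cons, sum_cons, card_cons,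
      show (((s.card + 1 : ℕ) : ℝ) * a) = a + s.card * a by push_cast; ring]
    exact (mul_le_mul_of_nonneg_left ih (pch_pos ha _).le).trans
      (pch_mul_le ha (by positivity) _ _)

lemma pow_le_pch {a : ℝ} (ha : 0 < a) (j : ℕ) : a ^ j ≤ pch a j := by
  induction j with
  | zero => simp
  | succ j ih =>
    rw [pch_succ, pow_succ]
    have hj : (0 : ℝ) ≤ j := j.cast_nonneg
    exact mul_le_mul ih (by linarith) ha.le (pch_pos ha j).le

lemma summable_prod_pow_div_factorial {n : ℕ} {t : ℝ} (ht : 0 ≤ t) :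
    Summable fun m : Fin n → ℕ => ∏ s, t ^ m s / ((m s).factorial : ℝ) := by
  refine summable_of_sum_le (c := Real.exp t ^ n)
    (fun m => prod_nonneg fun s _ => by positivity) fun u => ?_
  obtain ⟨M, hM⟩ : ∃ M : ℕ, ∀ m ∈ u, ∀ s, m s < M := by
    refine ⟨∑ m ∈ u, ∑ s, m s + 1, fun m hm s => Nat.lt_succ_of_le ?_⟩
    exact (single_le_sum (f := m) (fun _ _ => Nat.zero_le _) (mem_univ s)).trans
      (single_le_sum (f := fun m : Fin n → ℕ => ∑ s, m s) (fun _ _ => Nat.zero_le _) hm)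
  calc ∑ m ∈ u, ∏ s, t ^ m s / ((m s).factorial : ℝ)
      ≤ ∑ m ∈ Fintype.piFinset fun _ : Fin n => range M, ∏ s, t ^ m s / ((m s).factorial : ℝ) := by
        refine sum_le_sum_of_subset_of_nonneg (fun m hm => ?_)
          fun m _ _ => prod_nonneg fun s _ => by positivity
        exact Fintype.mem_piFinset.2 fun s => mem_range.2 (hM m hm s)
    _ = ∏ _s : Fin n, ∑ i ∈ range M, t ^ i / (i.factorial : ℝ) :=
        (prod_univ_sum (fun _ : Fin n => range M) fun _ i => t ^ i / (i.factorial : ℝ)).symm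
    _ ≤ Real.exp t ^ n := by
        rw [prod_const, card_univ, Fintype.card_fin]
        exact pow_le_pow_left₀ (sum_nonneg fun i _ => by positivity)
          (Real.sum_le_exp_of_nonneg ht M) n

lemma abs_hornTerm_le {n : ℕ} (hn : n ≠ 0) {β γ t : ℝ} (hβ : 0 < β) (hγ : γ = n * β) (ht : 0 ≤ t)
    {z : Fin n → ℝ} (hz : ∀ s, |z s| ≤ 1) (m : Fin n → ℕ) :
    |hornTerm (fun _ => β) γ (fun s => t * z s) m| ≤ ∏ s, t ^ m s / ((m s).factorial : ℝ) := by
  have : NeZero n := ⟨hn⟩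
  have hnpos : (0 : ℝ) < n := by exact_mod_cast Nat.pos_of_ne_zero hn
  have h1 : ∏ s, pch β (m s) ≤ pch γ (∑ s, m s) := by
    have := prod_pch_le (univ : Finset (Fin n)) univ_nonempty hβ m
    rwa [card_univ, Fintype.card_fin, ← hγ] at this
  have h0 : 0 ≤ ∏ s, pch β (m s) := prod_nonneg fun s _ => (pch_pos hβ _).le
  have h2 : 0 < pch γ (∑ s, m s) := pch_pos (by rw [hγ]; positivity) _
  change |(∏ s, pch β (m s)) / pch γ (∑ s, m s) * ∏ s, (t * z s) ^ m s / ((m s).factorial : ℝ)| ≤ _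
  rw [abs_mul, abs_of_nonneg (div_nonneg h0 h2.le), abs_prod]
  refine (mul_le_mul (div_le_one_of_le₀ h1 h2.le) (prod_le_prod (fun s _ => abs_nonneg _)
    fun s _ => ?_) (prod_nonneg fun s _ => abs_nonneg _) zero_le_one).trans (one_mul _).le
  rw [abs_div, abs_pow, abs_mul, abs_of_nonneg ht, Nat.abs_cast]
  gcongr
  exact mul_le_of_le_one_right ht (hz s)

/-- The coefficient of the Horn function in the expansion of the generalized Bessel function. -/
def hornCoeff (n : ℕ) (k q : ℝ) (j : ℕ) : ℝ :=
  poch k j * poch k j / (poch (2 * k) j * poch (n * k) (n * j) * j.factorial) * q ^ j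

lemma abs_hornCoeff_le {n : ℕ} (hn : n ≠ 0) {k : ℝ} (hk : 0 < k) (q : ℝ) (j : ℕ) :
    |hornCoeff n k q j| ≤ (|q| / k ^ (n - 1)) ^ j / j.factorial := by
  have : NeZero n := ⟨hn⟩
  have hnpos : (0 : ℝ) < n := by exact_mod_cast Nat.pos_of_ne_zero hn
  change |pch k j * pch k j / (pch (2 * k) j * pch (n * k) (n * j) * j.factorial) * q ^ j| ≤ _
  have p1 := pch_pos hk j
  have p2 : 0 < pch (2 * k) j := pch_pos (by positivity) j
  have p3 : 0 < pch (n * k) (n * j) := pch_pos (by positivity) _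
  have h1 : pch k j ≤ pch (2 * k) j := pch_mono hk (by linarith) j
  have h2 : pch k j * (k ^ (n - 1)) ^ j ≤ pch (n * k) (n * j) := by
    have h3 := prod_pch_le (univ : Finset (Fin n)) univ_nonempty hk fun _ => j
    rw [prod_const, sum_const, card_univ, Fintype.card_fin, smul_eq_mul,
      ← Nat.sub_add_cancel (Nat.pos_of_ne_zero hn), pow_succ', Nat.sub_add_cancel
        (Nat.pos_of_ne_zero hn)] at h3
    refine le_trans (mul_le_mul_of_nonneg_left ?_ p1.le) h3
    rw [← pow_mul, mul_comm (n - 1) j, pow_mul]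
    exact pow_le_pow_left₀ (by positivity) (pow_le_pch hk j) _
  have hf : (0 : ℝ) < j.factorial := by exact_mod_cast j.factorial_pos
  rw [abs_mul, abs_pow, abs_of_nonneg (by positivity), div_pow, div_mul_eq_mul_div,
    div_div, div_le_div_iff₀ (by positivity) (by positivity)]
  have h4 : pch k j * (pch k j * (k ^ (n - 1)) ^ j) ≤ pch (2 * k) j * pch (n * k) (n * j) :=
    mul_le_mul h1 h2 (by positivity) p2.le
  have h5 : 0 ≤ |q| ^ j * j.factorial := by positivity
  nlinarith [mul_le_mul_of_nonneg_left h4 h5]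

section Series

variable {n : ℕ} {k t : ℝ} {z : Fin n → ℝ}

lemma summable_hornTerm (hn : n ≠ 0) (hk : 0 < k) (ht : 0 ≤ t) (hz : ∀ s, |z s| ≤ 1) (j : ℕ) :
    Summable (hornTerm (fun _ : Fin n => k + j) (n * k + n * j) fun s => t * z s) :=
  Summable.of_norm_bounded (summable_prod_pow_div_factorial ht) fun m =>
    abs_hornTerm_le hn (by positivity) (by ring) ht hz m

/-- The term of the double series. -/
def fullTerm (k q t : ℝ) (z : Fin n → ℝ) (p : ℕ × (Fin n → ℕ)) : ℝ :=
  hornCoeff n k q p.1 *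
    hornTerm (fun _ : Fin n => k + p.1) (n * k + n * p.1) (fun s => t * z s) p.2

lemma summable_fullTerm (hn : n ≠ 0) (hk : 0 < k) (q : ℝ) (ht : 0 ≤ t) (hz : ∀ s, |z s| ≤ 1) :
    Summable (fullTerm k q t z) := by
  refine Summable.of_norm_bounded ((Real.summable_pow_div_factorial (|q| / k ^ (n - 1))).mul_of_nonneg
    (summable_prod_pow_div_factorial (n := n) ht) (fun j => by positivity)
    fun m => prod_nonneg fun s _ => by positivity) fun p => ?_
  rw [fullTerm, norm_mul]
  exact mul_le_mul (abs_hornCoeff_le hn hk q _)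
    (abs_hornTerm_le hn (by positivity) (by ring) ht hz _) (norm_nonneg _) (by positivity)

lemma hasSum_hornPhi (hn : n ≠ 0) (hk : 0 < k) (q : ℝ) (ht : 0 ≤ t) (hz : ∀ s, |z s| ≤ 1) :
    HasSum (fun j => hornCoeff n k q j *
      hornPhi (fun _ : Fin n => k + j) (n * k + n * j) fun s => t * z s) (∑' p, fullTerm k q t z p) :=
  (summable_fullTerm hn hk q ht hz).hasSum.prod_fiberwise fun j =>
    (summable_hornTerm hn hk ht hz j).hasSum.mul_left _

end Series

lemma coeff_prod_univ {n : ℕ} (f : Fin n → ℂ⟦X⟧) {d M : ℕ} (hd : d < M) :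
    coeff d (∏ s, f s) = ∑ m ∈ Fintype.piFinset fun _ : Fin n => range M,
      if ∑ s, m s = d then ∏ s, coeff (m s) (f s) else 0 := by
  rw [coeff_prod, ← sum_filter]
  refine sum_nbij (fun l => ⇑l) ?_ ?_ ?_ fun _ _ => rfl
  · intro l hl
    have h := (mem_finsuppAntidiag.1 hl).1
    refine mem_filter.2 ⟨Fintype.mem_piFinset.2 fun s => mem_range.2 (lt_of_le_of_lt ?_ hd), h⟩
    rw [← h]
    exact single_le_sum (f := l) (fun _ _ => Nat.zero_le _) (mem_univ s)
  · exact DFunLike.coe_injective.injOn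
  · intro m hm
    refine ⟨Finsupp.equivFunOnFinite.symm m, ?_, rfl⟩
    rw [mem_coe, mem_finsuppAntidiag]
    exact ⟨(mem_filter.1 (mem_coe.1 hm)).2, subset_univ _⟩

lemma ofReal_fullTerm {n : ℕ} (k t q : ℝ) (z : Fin n → ℝ)
    {A B : ℂ} (hq : (q : ℂ) = t ^ n * ((A - A⁻¹) * (B - B⁻¹) / 2 ^ n)) (j : ℕ) (m : Fin n → ℕ) :
    (fullTerm k q t z (j, m) : ℂ) = (t : ℂ) ^ (n * j + ∑ s, m s) /
      pch (n * k : ℂ) (n * j + ∑ s, m s) *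
        (pch (k : ℂ) j * pch (k : ℂ) j / (pch (2 * k : ℂ) j * j.factorial) *
          ((A - A⁻¹) * (B - B⁻¹) / 2 ^ n) ^ j *
          ∏ s, coeff (m s) (opow (k + j : ℂ) (C (z s : ℂ) * X))) := by
  change (((pch k j * pch k j / (pch (2 * k) j * pch (n * k) (n * j) * j.factorial) * q ^ j) *
    ((∏ s, pch (k + j) (m s)) / pch (n * k + n * j) (∑ s, m s) *
      ∏ s, (t * z s) ^ m s / ((m s).factorial : ℝ)) : ℝ) : ℂ) = _
  have h1 : ∏ s, coeff (m s) (opow (k + j : ℂ) (C (z s : ℂ) * X)) =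
      (∏ s, pch (k + j : ℂ) (m s)) * ∏ s, (z s : ℂ) ^ m s / ((m s).factorial : ℂ) := by
    rw [← prod_mul_distrib]
    refine prod_congr rfl fun s _ => ?_
    rw [opow_C_mul_X, coeff_mk]; ring
  have h2 : ∏ s, (t * z s : ℂ) ^ m s / ((m s).factorial : ℂ) =
      (t : ℂ) ^ (∑ s, m s) * ∏ s, (z s : ℂ) ^ m s / ((m s).factorial : ℂ) := by
    rw [← prod_pow_eq_pow_sum, ← prod_mul_distrib]
    exact prod_congr rfl fun s _ => by ring
  have h3 : pch (n * k : ℂ) (n * j + ∑ s, m s) =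
      pch (n * k : ℂ) (n * j) * pch (n * k + n * j : ℂ) (∑ s, m s) := by
    rw [pch_add]; push_cast; rfl
  push_cast
  simp only [ofReal_pch]
  push_cast
  rw [h1, h2, h3, hq, mul_pow, ← pow_mul, pow_add]
  simp only [div_eq_mul_inv, mul_inv]
  ring

lemma coeff_hornGen {n : ℕ} (hn : n ≠ 0) (k A B : ℂ) (z : Fin n → ℂ) (N : ℕ) :
    coeff N (hornGen k A B z) = ∑ j ∈ range (N + 1),
      ∑ m ∈ Fintype.piFinset fun _ : Fin n => range (N + 1), if n * j + ∑ s, m s = N then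
        (pch k j * pch k j / (pch (2 * k) j * j.factorial) * ((A - A⁻¹) * (B - B⁻¹) / 2 ^ n) ^ j *
          ∏ s, coeff (m s) (opow (k + j) (C (z s) * X))) else 0 := by
  rw [hornGen, coeff_xsum]
  refine sum_congr rfl fun j hj => ?_
  have hj' := mem_range.1 hj
  have hnj : n * j = (n - 1) * j + j := by
    obtain ⟨m, rfl⟩ := Nat.exists_eq_succ_of_ne_zero hn
    simp [Nat.succ_mul]
  rw [coeff_C_mul, coeff_X_pow_mul', coeff_prod_univ _ (M := N + 1) (by omega)]
  split_ifs with h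
  · rw [mul_sum]
    refine sum_congr rfl fun m _ => ?_
    rw [mul_ite, mul_zero]
    congr 1
    exact propext (by omega)
  · rw [mul_zero, sum_eq_zero]
    intro m _
    rw [if_neg (by omega)]

lemma hasSum_hornGen {n : ℕ} (hn : n ≠ 0) {k : ℝ} (hk : 0 < k) {t : ℝ} (ht : 0 ≤ t) {q : ℝ}
    {z : Fin n → ℝ} (hz : ∀ s, |z s| ≤ 1) {A B : ℂ}
    (hq : (q : ℂ) = t ^ n * ((A - A⁻¹) * (B - B⁻¹) / 2 ^ n)) :
    HasSum (fun N => ((t : ℂ) ^ N / pch (n * k : ℂ) N *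
      coeff N (hornGen (k : ℂ) A B fun s => (z s : ℂ))).re) (∑' p, fullTerm k q t z p) := by
  have h := (summable_fullTerm hn hk q ht hz).hasSum.tsum_fiberwise
    fun p : ℕ × (Fin n → ℕ) => n * p.1 + ∑ s, p.2 s
  refine h.congr_fun fun N => ?_
  set F := ((range (N + 1)) ×ˢ Fintype.piFinset fun _ : Fin n => range (N + 1)).filter
    fun p : ℕ × (Fin n → ℕ) => n * p.1 + ∑ s, p.2 s = N with hF
  have hfib : ((fun p : ℕ × (Fin n → ℕ) => n * p.1 + ∑ s, p.2 s) ⁻¹' {N}) = (F : Set _) := by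
    ext ⟨j, m⟩
    simp only [hF, Set.mem_preimage, Set.mem_singleton_iff, coe_filter, mem_product,
      Fintype.mem_piFinset, mem_range, Set.mem_ofPred_eq]
    refine ⟨fun hN => ⟨⟨?_, fun s => ?_⟩, hN⟩, fun h => h.2⟩
    · have := Nat.le_mul_of_pos_left j (Nat.pos_of_ne_zero hn)
      omega
    · have := single_le_sum (f := m) (fun _ _ => Nat.zero_le _) (mem_univ s)
      omega
  rw [hfib, Finset.tsum_subtype' F (fullTerm k q t z), ← Complex.ofReal_re (∑ x ∈ F, _)]
  congr 1
  rw [hF, Complex.ofReal_sum, sum_filter, sum_product, coeff_hornGen hn, mul_sum]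
  refine sum_congr rfl fun j _ => ?_
  rw [mul_sum]
  refine sum_congr rfl fun m _ => ?_
  dsimp only
  split_ifs with hN
  · rw [ofReal_fullTerm k t q z hq, hN]
  · rw [mul_zero]

end DihedralBessel
end

noncomputable section
namespace DihedralBessel
open Finset ComplexConjugate PowerSeries

lemma exp_I_mul_conj (φ : ℝ) :
    Complex.exp (Complex.I * φ) * conj (Complex.exp (Complex.I * φ)) = 1 := by
  rw [← Complex.exp_conj, ← Complex.exp_add]; simp

lemma exp_pow_sub_inv (n : ℕ) (φ : ℝ) :
    Complex.exp (Complex.I * φ) ^ n - (Complex.exp (Complex.I * φ) ^ n)⁻¹ =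
      2 * Complex.I * (Real.sin (n * φ) : ℝ) := by
  rw [← Complex.exp_nat_mul, ← Complex.exp_neg, Complex.ofReal_sin, Complex.sin]
  push_cast
  rw [show (n : ℂ) * (Complex.I * φ) = n * φ * Complex.I by ring, ← neg_mul]
  linear_combination (-(Complex.exp (-(n * φ : ℂ) * Complex.I) -
    Complex.exp (n * φ * Complex.I))) * Complex.I_sq

lemma two_mul_bcos (n : ℕ) (φ θ : ℝ) (s : Fin n) :
    2 * (bcos n (θ - φ) s : ℂ) =
      Complex.exp (Complex.I * θ) / Complex.exp (Complex.I * φ) * rt n s +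
        Complex.exp (Complex.I * φ) / Complex.exp (Complex.I * θ) * (rt n s)⁻¹ := by
  rw [bcos, Complex.ofReal_cos, Complex.cos, rt, ← Complex.exp_nat_mul, ← Complex.exp_neg,
    ← Complex.exp_sub, ← Complex.exp_sub, ← Complex.exp_add, ← Complex.exp_add,
    mul_div_cancel₀ _ two_ne_zero]
  congr 2 <;> · push_cast; ring

theorem genBessel_eq_tsum_hornPhi {n : ℕ} (hn : 2 ≤ n) {k : ℝ} (hk : 0 < k) {ρ r : ℝ} (hρ : 0 ≤ ρ)
    (hr : 0 ≤ r) (φ θ : ℝ) :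
    genBessel n k (ρ * Complex.exp (Complex.I * φ)) (r * Complex.exp (Complex.I * θ)) =
      ∑' j : ℕ, hornCoeff n k (-4 * (ρ * r / 2) ^ n * Real.sin (n * θ) * Real.sin (n * φ)) j *
        hornPhi (fun _ : Fin n => k + j) (n * k + n * j) fun s => ρ * r * bcos n (θ - φ) s := by
  have hn0 : n ≠ 0 := by omega
  have hnpos : (0 : ℝ) < n := by exact_mod_cast Nat.pos_of_ne_zero hn0
  set q := -4 * (ρ * r / 2) ^ n * Real.sin (n * θ) * Real.sin (n * φ) with hq
  set a := Complex.exp (Complex.I * φ) with ha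
  set b := Complex.exp (Complex.I * θ) with hb
  have ha0 : a ≠ 0 := Complex.exp_ne_zero _
  have hb0 : b ≠ 0 := Complex.exp_ne_zero _
  have ha1 : a * conj a = 1 := exp_I_mul_conj φ
  have hb1 : b * conj b = 1 := exp_I_mul_conj θ
  have hz : ∀ s : Fin n, |bcos n (θ - φ) s| ≤ 1 := fun s => Real.abs_cos_le_one _
  have ht : 0 ≤ ρ * r := mul_nonneg hρ hr
  have hqc : (q : ℂ) = ((ρ * r : ℝ) : ℂ) ^ n *
      ((a ^ n - (a ^ n)⁻¹) * (b ^ n - (b ^ n)⁻¹) / 2 ^ n) := by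
    rw [ha, hb, exp_pow_sub_inv, exp_pow_sub_inv, hq]
    push_cast
    rw [div_pow]
    linear_combination (-4 * (ρ * r : ℂ) ^ n / 2 ^ n * Complex.sin (n * θ) *
      Complex.sin (n * φ)) * Complex.I_sq
  have hpos : ∀ (x : ℝ) (m : ℕ), 0 < x → pch (x : ℂ) m ≠ 0 := by
    intro x m hx
    rw [← ofReal_pch]
    exact_mod_cast (pch_pos hx m).ne'
  have hgen := hornGen_eq_besselGen hn0 (k : ℂ) (pow_ne_zero n ha0) (pow_ne_zero n hb0)
    (fun j => by exact_mod_cast hpos (2 * k) j (by positivity))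
    (fun i j => by exact_mod_cast hpos (n * k + n * i) j (by positivity))
    (fun s => (bcos n (θ - φ) s : ℂ)) (prod_cos hn0 ha0 hb0 (two_mul_bcos n φ θ))
  have h1 := hasSum_hornGen hn0 hk ht hz hqc
  have h2 := hasSum_genBessel hn hk (ρ * a) (r * b)
  simp only [gcomp_eq hn0 hk ρ r ha1 hb1, ← hgen] at h2
  rw [h2.unique h1, (hasSum_hornPhi hn0 hk q ht hz).tsum_eq]

end DihedralBessel
end

theorem corollary1 (n : ℕ) (hn : 3 ≤ n) (k : ℝ) (hk : 0 < k) :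
    (∀ y : ℂ, DihedralBessel.genBessel n k 0 y = 1) ∧
    ∀ ρ r φ θ : ℝ, 0 ≤ ρ → 0 ≤ r → φ ∈ Set.Icc 0 (Real.pi / n) → θ ∈ Set.Icc 0 (Real.pi / n) →
      (∀ j : ℕ, Summable (DihedralBessel.hornTerm (fun _ : Fin n => k + j) (n * k + n * j)
        (fun s => ρ * r * DihedralBessel.bcos n (θ - φ) s))) ∧
      Summable (fun j : ℕ =>
        DihedralBessel.poch k j * DihedralBessel.poch k j /
            (DihedralBessel.poch (2 * k) j * DihedralBessel.poch (n * k) (n * j) * j.factorial) *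
          (-4 * (ρ * r / 2) ^ n * Real.sin (n * θ) * Real.sin (n * φ)) ^ j *
          DihedralBessel.hornPhi (fun _ : Fin n => k + j) (n * k + n * j)
            (fun s => ρ * r * DihedralBessel.bcos n (θ - φ) s)) ∧
      DihedralBessel.genBessel n k (ρ * Complex.exp (Complex.I * φ))
          (r * Complex.exp (Complex.I * θ)) =
        DihedralBessel.normConst n k /
            (n * ProbabilityTheory.beta (k + 1 / 2) (1 / 2) * Real.Gamma (n * k)) *
          ∑' j : ℕ,
            DihedralBessel.poch k j * DihedralBessel.poch k j /
                (DihedralBessel.poch (2 * k) j * DihedralBessel.poch (n * k) (n * j) *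
                  j.factorial) *
              (-4 * (ρ * r / 2) ^ n * Real.sin (n * θ) * Real.sin (n * φ)) ^ j *
              DihedralBessel.hornPhi (fun _ : Fin n => k + j) (n * k + n * j)
                (fun s => ρ * r * DihedralBessel.bcos n (θ - φ) s) := by
  have hn0 : n ≠ 0 := by omega
  refine ⟨fun y => DihedralBessel.genBessel_zero_left (by omega) hk y,
    fun ρ r φ θ hρ hr _ _ => ⟨fun j => DihedralBessel.summable_hornTerm hn0 hk
      (mul_nonneg hρ hr) (fun s => Real.abs_cos_le_one _) j, ?_, ?_⟩⟩
  · exact (DihedralBessel.hasSum_hornPhi hn0 hk _ (mul_nonneg hρ hr)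
      (fun s => Real.abs_cos_le_one _)).summable
  · have hn' : (0 : ℝ) < n := by exact_mod_cast Nat.pos_of_ne_zero hn0
    have hbeta : 0 < ProbabilityTheory.beta (k + 1 / 2) (1 / 2) :=
      ProbabilityTheory.beta_pos (by positivity) (by positivity)
    have hGamma : 0 < Real.Gamma (n * k) := Real.Gamma_pos_of_pos (by positivity)
    rw [DihedralBessel.normConst, div_self (by positivity), one_mul]
    exact DihedralBessel.genBessel_eq_tsum_hornPhi (by omega) hk hρ hr φ θ
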